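/- Let $W$ be a simply laced Coxeter group, i.e. a group with a (possibly infinite) set of distinguished generators $\{s_i : i\in I\}$ and Coxeter matrix $(m_{ij})$ with $m_{ij}\in\{2,3\}$ for all $i\neq j$. Let $V$ be the real vector space with basis the simple roots $\{\alpha_i : i \in I\}$, with the Coxeter form $B(\alpha_i,\alpha_j)=-\cos(\pi/m_{ij})$ and the reflection representation $s_i v = v-2B(v,\alpha_i)\alpha_i$ of $W$. Let $\Phi=\{w\alpha_i\}$ be the root system, let $\Phi^+$ be the set of roots with nonnegative coordinates and $\Phi^-=-\Phi^+$, and for $w \in W$ put $\Phi(w)=\Phi^+\cap w^{-1}(\Phi^-)$. The root sequence of a reduced expression $i_1\cdots i_n$ for $w$ is $(r_1,\dots,r_n)$ with $r_l=s_{i_n}\cdots s_{i_{n-l+2}}(\alpha_{i_{n-l+1}})$. An inversion triple of $w$ is a subset of $\Phi(w)$ of the form $\{\alpha,\beta,\alpha+\beta\}$; it is contractible if its elements appear consecutively, in some order, in the root sequence of some reduced expression for $w$. The element $w$ is freely braided if its contractible inversion triples are pairwise disjoint. It is fully commutative if its reduced expressions form a single commutation class, i.e. a single class under the moves that replace a subword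 $ij$ with $m_{ij}=2$ by $ji$. Then $W$ has finitely many freely braided elements if and only if it has finitely many fully commutative elements. Moreover, this is the case if and only if $I$ is finite and each connected component of the Coxeter graph of $W$ is of type $A_n$ ($n\ge 1$), $D_n$ ($n\ge 4$) or $E_n$ ($n\ge 6$, with no upper bound on $n$). Here $A_n$ is the path with $n$ vertices, and $D_n$ and $E_n$ are the trees with $n$ vertices that consist of three paths attached to one branch vertex, with $1,1,n-3$ and $1,2,n-4$ further vertices, respectively. -/

import Mathlib

/-! Freely braided and fully commutative elements of simply laced Coxeter groups. -/

namespace CoxeterMatrix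

variable {B : Type*} (M : CoxeterMatrix B)

/-- A Coxeter matrix is simply laced if its off-diagonal entries are all `2` or `3`. -/
def SimplyLaced : Prop := ∀ i j : B, i ≠ j → M i j = 2 ∨ M i j = 3

/-- The Coxeter graph (labels forgotten): `i` and `j` are joined if `m i j` is neither `1` nor `2`.
(In Mathlib the value `0` stands for `m i j = ∞`.) -/
def coxeterGraph : SimpleGraph B where
  Adj i j := i ≠ j ∧ M i j ≠ 2
  symm := ⟨fun i j h => ⟨h.1.symm, by rw [M.symmetric]; exact h.2⟩⟩
  loopless := ⟨fun _ h => h.1 rfl⟩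

/-- The simple root `α i`, a basis vector of the real vector space `V` with basis indexed by `B`. -/
noncomputable def simpleRoot (_M : CoxeterMatrix B) (i : B) : B →₀ ℝ := Finsupp.single i 1

/-- The Coxeter form, i.e. the bilinear form on `V` with `B(α i, α j) = - cos (π / m i j)`.
If `m i j = ∞`, coded by `0`, the value is `- cos 0 = -1`, as usual. -/
noncomputable def coxeterForm : LinearMap.BilinForm ℝ (B →₀ ℝ) :=
  Finsupp.linearCombination ℝ fun i =>
    Finsupp.linearCombination ℝ fun j => - Real.cos (Real.pi / (M i j : ℝ))

theorem coxeterForm_simpleRoot (i j : B) :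
    M.coxeterForm (M.simpleRoot i) (M.simpleRoot j) = - Real.cos (Real.pi / (M i j : ℝ)) := by
  simp [coxeterForm, simpleRoot]

/-- The simple reflection of `V` with respect to `α i`, i.e. `v ↦ v - 2 B(α i, v) α i`. -/
noncomputable def simpleReflection (i : B) : Module.End ℝ (B →₀ ℝ) :=
  Module.preReflection (M.simpleRoot i) ((2 : ℝ) • M.coxeterForm (M.simpleRoot i))

theorem simpleReflection_apply (i : B) (v : B →₀ ℝ) :
    M.simpleReflection i v =
      v - (2 * M.coxeterForm (M.simpleRoot i) v) • M.simpleRoot i := by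
  simp [simpleReflection, Module.preReflection_apply]

theorem coxeterForm_self (i : B) :
    ((2 : ℝ) • M.coxeterForm (M.simpleRoot i)) (M.simpleRoot i) = 2 := by
  simp [coxeterForm_simpleRoot]

theorem isLiftable_simpleReflection : M.IsLiftable M.simpleReflection := by
  intro i j
  have hi := M.coxeterForm_self i
  have hj := M.coxeterForm_self j
  have ei : M.simpleReflection i = (Module.reflection hi).toLinearMap := rfl
  have ej : M.simpleReflection j = (Module.reflection hj).toLinearMap := rfl
  have hij : ((2 : ℝ) • M.coxeterForm (M.simpleRoot i)) (M.simpleRoot j)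
      = -2 * Real.cos (Real.pi / (M i j : ℝ)) := by
    simp [coxeterForm_simpleRoot]
  have hji : ((2 : ℝ) • M.coxeterForm (M.simpleRoot j)) (M.simpleRoot i)
      = -2 * Real.cos (Real.pi / (M i j : ℝ)) := by
    simp [coxeterForm_simpleRoot, M.symmetric j i]
  have key : (M.simpleReflection i * M.simpleReflection j) ^ M i j
      = ((Module.reflection hi * Module.reflection hj) ^ M i j).toLinearMap := by
    rw [ei, ej]
    generalize M i j = m
    induction m with
    | zero => rfl
    | succ m ih => rw [pow_succ, pow_succ, ih]; rfl
  rw [key]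
  by_cases hdiag : i = j
  · subst hdiag
    ext v : 2
    simp [Module.involutive_reflection hi _]
  have h1 := M.off_diagonal i j hdiag
  generalize hm : M i j = m at *
  obtain rfl | rfl | h3 : m = 0 ∨ m = 2 ∨ 3 ≤ m := by omega
  · rfl
  · have h0 : Real.cos (Real.pi / ((2 : ℕ) : ℝ)) = 0 := by simp
    rw [h0, mul_zero] at hij hji
    refine LinearMap.ext fun v => ?_
    simp only [pow_two, LinearEquiv.coe_coe, LinearEquiv.mul_apply, Module.reflection_apply,
      map_sub, map_smul, hij, hji, hi, hj, Module.End.one_apply]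
    module
  · set θ : ℝ := 2 * (Real.pi / (m : ℝ)) with hθ
    have hm0 : (0 : ℝ) < m := by positivity
    have hmθ : (m : ℝ) * (θ / 2) = Real.pi := by rw [hθ]; field_simp
    have hs : Real.sin θ ≠ 0 := by
      refine (Real.sin_pos_of_pos_of_lt_pi ?_ ?_).ne'
      · rw [hθ]; positivity
      · have : (3 : ℝ) ≤ m := by exact_mod_cast h3
        rw [hθ, ← mul_div_assoc, div_lt_iff₀ hm0]
        nlinarith [Real.pi_pos]
    have ht : 2 * Real.cos θ =
        ((2 : ℝ) • M.coxeterForm (M.simpleRoot i)) (M.simpleRoot j) *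
          ((2 : ℝ) • M.coxeterForm (M.simpleRoot j)) (M.simpleRoot i) - 2 := by
      rw [hij, hji, hθ, Real.cos_two_mul]; ring
    rw [Module.reflection_mul_reflection_pow hi hj m (2 * Real.cos θ) ht]
    have hS := Polynomial.Chebyshev.S_two_mul_real_cos θ
    obtain ⟨p, rfl | rfl⟩ := Nat.even_or_odd' m
    · have e1 : (((2 * p : ℕ) : ℤ) - 1) / 2 = (p : ℤ) - 1 := by omega
      have z : (Polynomial.Chebyshev.S ℝ ((p : ℤ) - 1)).eval (2 * Real.cos θ) = 0 := by
        have := hS ((p : ℤ) - 1)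
        have hp : (((p : ℤ) - 1 : ℤ) + 1 : ℝ) * θ = Real.pi := by
          rw [← hmθ]; push_cast; ring
        rw [hp, Real.sin_pi] at this
        exact (mul_eq_zero.mp this).resolve_right hs
      have e3 : (((2 * p : ℕ) : ℤ) - 3) / 2 = (p : ℤ) - 2 := by omega
      have e2 : (((2 * p : ℕ) : ℤ) - 2) / 2 = (p : ℤ) - 1 := by omega
      rw [e1, e2, e3, z]
      simp
      rfl
    · have e0 : ((2 * p + 1 : ℕ) : ℤ) / 2 = (p : ℤ) := by omega
      have e1 : (((2 * p + 1 : ℕ) : ℤ) - 1) / 2 = (p : ℤ) := by omega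
      have e2 : (((2 * p + 1 : ℕ) : ℤ) - 2) / 2 = (p : ℤ) - 1 := by omega
      have e3 : (((2 * p + 1 : ℕ) : ℤ) - 3) / 2 = (p : ℤ) - 1 := by omega
      have z : (Polynomial.Chebyshev.S ℝ (p : ℤ)).eval (2 * Real.cos θ)
          + (Polynomial.Chebyshev.S ℝ ((p : ℤ) - 1)).eval (2 * Real.cos θ) = 0 := by
        refine (mul_eq_zero.mp ?_).resolve_right hs
        rw [add_mul, hS, hS]
        have a1 : (((p : ℤ) : ℝ) + 1) * θ = Real.pi + θ / 2 := by
          rw [← hmθ]; push_cast; ring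
        have a2 : ((((p : ℤ) - 1 : ℤ) : ℝ) + 1) * θ = Real.pi - θ / 2 := by
          rw [← hmθ]; push_cast; ring
        rw [a1, a2, add_comm Real.pi, Real.sin_add_pi, Real.sin_pi_sub]; ring
      rw [e0, e1, e2, e3, z]
      simp
      rfl

end CoxeterMatrix

namespace CoxeterSystem

variable {B : Type*} {M : CoxeterMatrix B} {W : Type*} [Group W] (cs : CoxeterSystem M W)

/-- The reflection representation of `W` on `V`. -/
noncomputable def reflectionRep : W →* Module.End ℝ (B →₀ ℝ) :=
  cs.lift ⟨M.simpleReflection, M.isLiftable_simpleReflection⟩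

theorem reflectionRep_simple (i : B) :
    cs.reflectionRep (cs.simple i) = M.simpleReflection i :=
  cs.lift_apply_simple M.isLiftable_simpleReflection i

/-- The root system `{w α i}`. -/
def roots : Set (B →₀ ℝ) := {β | ∃ (w : W) (i : B), β = cs.reflectionRep w (M.simpleRoot i)}

/-- The positive roots: the roots with nonnegative coordinates in the basis of simple roots. -/
def positiveRoots : Set (B →₀ ℝ) := {β | β ∈ cs.roots ∧ ∀ i, 0 ≤ β i}

/-- The negative roots: the negatives of the positive roots. -/
def negativeRoots : Set (B →₀ ℝ) := {β | -β ∈ cs.positiveRoots}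

/-- The inversion set `Φ(w)`: the positive roots that `w` makes negative. -/
def inversionSet (w : W) : Set (B →₀ ℝ) :=
  {β | β ∈ cs.positiveRoots ∧ cs.reflectionRep w β ∈ cs.negativeRoots}

/-- The set of reduced expressions for `w`. -/
def reducedExpressions (w : W) : Set (List B) := {ω | cs.IsReduced ω ∧ cs.wordProd ω = w}

/-- The root sequence `(r 1, …, r n)` of a word `i 1 ⋯ i n`, where
`r l = s (i n) ⋯ s (i (n - l + 2)) α (i (n - l + 1))`; in particular `r 1 = α (i n)`, and the last
term is `s (i n) ⋯ s (i 2) α (i 1)`. -/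
noncomputable def rootSequence : List B → List (B →₀ ℝ)
  | [] => []
  | i :: ω => rootSequence ω ++ [cs.reflectionRep (cs.wordProd ω)⁻¹ (M.simpleRoot i)]

/-- An inversion triple of `w` is a subset of `Φ(w)` of the form `{α, β, α + β}`. -/
def IsInversionTriple (w : W) (T : Set (B →₀ ℝ)) : Prop :=
  T ⊆ cs.inversionSet w ∧ ∃ α β : B →₀ ℝ, T = {α, β, α + β}

/-- An inversion triple of `w` is contractible if its elements appear consecutively, in some
order, in some root sequence for `w`. -/
def IsContractibleTriple (w : W) (T : Set (B →₀ ℝ)) : Prop :=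
  cs.IsInversionTriple w T ∧
    ∃ ω ∈ cs.reducedExpressions w, ∃ a b c : B →₀ ℝ,
      T = {a, b, c} ∧ [a, b, c] <:+: cs.rootSequence ω

/-- `w` is freely braided if its contractible inversion triples are pairwise disjoint. -/
def IsFreelyBraided (w : W) : Prop :=
  ∀ T T' : Set (B →₀ ℝ), cs.IsContractibleTriple w T → cs.IsContractibleTriple w T' →
    T ≠ T' → Disjoint T T'

end CoxeterSystem

namespace CoxeterMatrix

variable {B : Type*} (M : CoxeterMatrix B)

/-- A short braid move replaces a subword `i j` with `m i j = 2` by `j i`. -/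
def ShortBraidMove (ω ω' : List B) : Prop :=
  ∃ (u v : List B) (i j : B), M i j = 2 ∧ ω = u ++ [i, j] ++ v ∧ ω' = u ++ [j, i] ++ v

/-- The commutation class of a word: the words obtained from it by sequences of short braid
moves. -/
def commutationClass (ω : List B) : Set (List B) :=
  {ω' | Relation.ReflTransGen M.ShortBraidMove ω ω'}

end CoxeterMatrix

namespace CoxeterSystem

/-- `w` is fully commutative if its reduced expressions form a single commutation class. -/
def IsFullyCommutative {B : Type*} {M : CoxeterMatrix B} {W : Type*} [Group W]
    (cs : CoxeterSystem M W) (w : W) : Prop :=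
  ∃ ω : List B, cs.reducedExpressions w = M.commutationClass ω

end CoxeterSystem

/-- The graph on `n` vertices that consists of the path `0 - 1 - ⋯ - (n - 2)` and of one further
vertex `n - 1`, which is joined to the vertex `k` of the path only. -/
def pathWithLeaf (n k : ℕ) : SimpleGraph (Fin n) :=
  SimpleGraph.fromRel fun i j : Fin n =>
    ((i : ℕ) + 1 = j ∧ (j : ℕ) + 1 < n) ∨ ((i : ℕ) = k ∧ (j : ℕ) + 1 = n)

/-- The graph is of type `A n` for some `n ≥ 1`: a path with `n` vertices. -/
def SimpleGraph.IsTypeA {V : Type*} (G : SimpleGraph V) : Prop :=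
  ∃ n : ℕ, 1 ≤ n ∧ Nonempty (G ≃g SimpleGraph.pathGraph n)

/-- The graph is of type `D n` for some `n ≥ 4`: three arms with `1`, `1` and `n - 3` vertices are
attached to a branch vertex. -/
def SimpleGraph.IsTypeD {V : Type*} (G : SimpleGraph V) : Prop :=
  ∃ n : ℕ, 4 ≤ n ∧ Nonempty (G ≃g pathWithLeaf n 1)

/-- The graph is of type `E n` for some `n ≥ 6`: three arms with `1`, `2` and `n - 4` vertices are
attached to a branch vertex. There is no upper bound on `n`. -/
def SimpleGraph.IsTypeE {V : Type*} (G : SimpleGraph V) : Prop :=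
  ∃ n : ℕ, 6 ≤ n ∧ Nonempty (G ≃g pathWithLeaf n 2)

/-! ### The Coxeter form and the simple reflections -/

namespace CoxeterMatrix

variable {B : Type*} {M : CoxeterMatrix B}

/-! The finiteness conditions are linked in a cycle: finitely many freely braided elements, finitely
many fully commutative ones, the list of graphs, and back. All of it is carried out on words. Call a
word braid-free if two consecutive occurrences of a letter are always separated by at least two
occurrences of its neighbours. Such words are reduced and represent fully commutative elements
(`isReduced_of_braidFree`, `commEquiv_of_wordProd_eq`).

A contractible triple comes from a factor i j i with m i j = 3 in some reduced word
(`IsContractibleTriple.exists_braid`). The braid move changes the letter counts, so a fully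
commutative element has no contractible triple and is trivially freely braided.

If there are finitely many fully commutative elements, there are finitely many generators, and the
lengths of braid-free words are bounded. Cycles, paths with a fork at both ends, and trees with
three arms of lengths 2,2,2 or 1,3,3 carry nonempty words all of whose powers are braid-free
(`Recurrent`), so they cannot occur in the graph. Looking at a longest path, one sees that a finite
connected graph without them is of type A, D or E (`isType_of_forall_recurrent`).

Conversely, all these graphs are induced subgraphs of one infinite tree `infiniteE`, where the
multiplicity of a letter in a braid-free word is bounded in terms of the largest letter
(`infiniteE.count_le`). It remains to pass from freely braided elements to braid-free words. In a
reduced word of a freely braided element, delete every letter i whose next occurrence is separated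
from it by only one neighbour (`prune`). Two braids that share an outer letter, or are nested, would
give distinct triples with a common root; as these overlaps are excluded, the deletion leaves a
braid-free word (`braidFree_prune`). Each deleted letter is followed by a retained occurrence of the
same letter, so the length at most halves (`length_le`). Hence lengths of freely braided elements
are bounded too. -/

theorem coxeterForm_comm (u v : B →₀ ℝ) : M.coxeterForm u v = M.coxeterForm v u := by
  have h : M.coxeterForm = M.coxeterForm.flip := by
    refine Finsupp.lhom_ext' fun i => LinearMap.ext_ring ?_
    refine Finsupp.lhom_ext' fun j => LinearMap.ext_ring ?_
    simp [coxeterForm, M.symmetric j i]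
  exact (congrFun (congrArg DFunLike.coe (congrFun (congrArg DFunLike.coe h) u)) v)

theorem coxeterForm_simpleRoot_self (i : B) :
    M.coxeterForm (M.simpleRoot i) (M.simpleRoot i) = 1 := by
  simp [coxeterForm_simpleRoot]

theorem coxeterForm_of_eq_two {i j : B} (h : M i j = 2) :
    M.coxeterForm (M.simpleRoot i) (M.simpleRoot j) = 0 := by
  simp [coxeterForm_simpleRoot, h]

theorem coxeterForm_of_eq_three {i j : B} (h : M i j = 3) :
    M.coxeterForm (M.simpleRoot i) (M.simpleRoot j) = -1 / 2 := by
  simp [coxeterForm_simpleRoot, h]; norm_num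

theorem simpleReflection_self (i : B) :
    M.simpleReflection i (M.simpleRoot i) = -M.simpleRoot i := by
  rw [simpleReflection_apply, coxeterForm_simpleRoot_self]; module

theorem simpleReflection_of_eq_two {i j : B} (h : M i j = 2) :
    M.simpleReflection i (M.simpleRoot j) = M.simpleRoot j := by
  rw [simpleReflection_apply, coxeterForm_of_eq_two h]; module

theorem simpleReflection_of_eq_three {i j : B} (h : M i j = 3) :
    M.simpleReflection i (M.simpleRoot j) = M.simpleRoot i + M.simpleRoot j := by
  rw [simpleReflection_apply, coxeterForm_of_eq_three h]; module

theorem coxeterForm_simpleReflection (i : B) (u v : B →₀ ℝ) :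
    M.coxeterForm (M.simpleReflection i u) (M.simpleReflection i v) = M.coxeterForm u v := by
  simp only [simpleReflection_apply, map_sub, map_smul, LinearMap.sub_apply, LinearMap.smul_apply,
    smul_eq_mul, coxeterForm_simpleRoot_self, coxeterForm_comm u (M.simpleRoot i)]
  ring

theorem simpleRoot_self_apply (i : B) : M.simpleRoot i i = 1 := by simp [simpleRoot]

theorem simpleRoot_apply_of_ne {i j : B} (h : i ≠ j) : M.simpleRoot i j = 0 := by
  simp [simpleRoot, h]

theorem simpleRoot_nonneg (i : B) : 0 ≤ M.simpleRoot i := by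
  classical
  intro j
  simp only [simpleRoot, Finsupp.single_apply, Finsupp.coe_zero, Pi.zero_apply]
  split_ifs <;> norm_num

end CoxeterMatrix

/-! ### Signs of roots, descents and faithfulness -/

namespace CoxeterSystem

variable {B : Type*} {M : CoxeterMatrix B} {W : Type*} [Group W] {cs : CoxeterSystem M W}

theorem reflectionRep_mul_apply (a b : W) (v : B →₀ ℝ) :
    cs.reflectionRep (a * b) v = cs.reflectionRep a (cs.reflectionRep b v) := by
  rw [map_mul]; rfl

theorem reflectionRep_inv_apply_self (a : W) (v : B →₀ ℝ) :
    cs.reflectionRep a⁻¹ (cs.reflectionRep a v) = v := by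
  rw [← reflectionRep_mul_apply]; simp

theorem reflectionRep_apply_inv_self (a : W) (v : B →₀ ℝ) :
    cs.reflectionRep a (cs.reflectionRep a⁻¹ v) = v := by
  rw [← reflectionRep_mul_apply]; simp

theorem reflectionRep_injective (a : W) : Function.Injective (cs.reflectionRep a) :=
  Function.LeftInverse.injective (g := cs.reflectionRep a⁻¹) (reflectionRep_inv_apply_self a)

theorem coxeterForm_reflectionRep (w : W) (u v : B →₀ ℝ) :
    M.coxeterForm (cs.reflectionRep w u) (cs.reflectionRep w v) = M.coxeterForm u v := by
  induction w using cs.simple_induction_left with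
  | one => simp
  | mul_simple_left w i ih =>
    rw [reflectionRep_mul_apply, reflectionRep_mul_apply, reflectionRep_simple, M.coxeterForm_simpleReflection, ih]

theorem simple_mul_comm {i j : B} (h : M i j = 2) :
    cs.simple i * cs.simple j = cs.simple j * cs.simple i := by
  have := cs.simple_mul_simple_pow i j
  rw [h, pow_two, mul_eq_one_iff_eq_inv] at this
  simpa using this

theorem simple_braid {i j : B} (h : M i j = 3) :
    cs.simple i * cs.simple j * cs.simple i = cs.simple j * cs.simple i * cs.simple j := by
  have := cs.simple_mul_simple_pow i j
  rw [h, pow_succ, pow_two, mul_eq_one_iff_eq_inv] at this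
  calc cs.simple i * cs.simple j * cs.simple i
      = cs.simple i * cs.simple j * (cs.simple i * cs.simple j) * cs.simple j := by
        simp [mul_assoc]
    _ = _ := by rw [this]; simp

/-- The image of a simple root under `w` is nonnegative if the simple root is not a right descent
of `w`. -/
theorem reflectionRep_nonneg (hM : M.SimplyLaced) {w : W} {i : B} (h : ¬cs.IsRightDescent w i) :
    0 ≤ cs.reflectionRep w (M.simpleRoot i) := by
  obtain ⟨n, hn⟩ : ∃ n, cs.length w = n := ⟨_, rfl⟩
  induction n using Nat.strong_induction_on generalizing w i with
  | _ n ih =>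
  subst hn
  by_cases hw : w = 1
  · subst hw; simpa using M.simpleRoot_nonneg i
  obtain ⟨j, hj⟩ := cs.exists_rightDescent_of_ne_one hw
  have hij : i ≠ j := by rintro rfl; exact h hj
  obtain ⟨v, rfl⟩ : ∃ v, w = v * cs.simple j := ⟨w * cs.simple j, by simp⟩
  have hvj : ¬cs.IsRightDescent v j := by
    have := cs.isRightDescent_iff_not_isRightDescent_mul.1 hj
    simpa using this
  have hlv : cs.length (v * cs.simple j) = cs.length v + 1 := cs.not_isRightDescent_iff.1 hvj
  have hl := cs.not_isRightDescent_iff.1 h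
  rw [reflectionRep_mul_apply, reflectionRep_simple]
  rcases hM j i hij.symm with h2 | h3
  · rw [M.simpleReflection_of_eq_two h2]
    refine ih _ (by omega) (fun hd => ?_) rfl
    have hd' := cs.isRightDescent_iff.1 hd
    rw [mul_assoc, simple_mul_comm h2, ← mul_assoc] at hl
    have := cs.length_mul_le (v * cs.simple i) (cs.simple j)
    rw [cs.length_simple] at this
    omega
  · rw [M.simpleReflection_of_eq_three h3]
    -- Here w = v s_j and w α_i = v α_i + v α_j. If i is a descent of v = u s_i, then w α_i = u α_j
    -- instead, and j is not a descent of u, since otherwise u s_i s_j s_i = u s_j s_i s_j would be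
    -- too short.
    by_cases hd : cs.IsRightDescent v i
    · obtain ⟨u, rfl⟩ : ∃ u, v = u * cs.simple i := ⟨v * cs.simple i, by simp⟩
      have hui := cs.isRightDescent_iff.1 hd
      rw [cs.simple_mul_simple_cancel_right] at hui
      rw [← M.simpleReflection_of_eq_three h3, reflectionRep_mul_apply, reflectionRep_simple,
        M.simpleReflection_of_eq_three h3, map_add, M.simpleReflection_self,
        M.simpleReflection_of_eq_three (by rw [M.symmetric]; exact h3)]
      have e : M.simpleRoot i + M.simpleRoot j + -M.simpleRoot i = M.simpleRoot j := by abel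
      rw [e]
      refine ih _ (by omega) (fun hd2 => ?_) rfl
      have hd2' := cs.isRightDescent_iff.1 hd2
      have hb := simple_braid (cs := cs) h3
      have e2 : u * cs.simple i * cs.simple j * cs.simple i
          = u * cs.simple j * cs.simple i * cs.simple j := by
        rw [mul_assoc, mul_assoc, ← mul_assoc (cs.simple i), ← hb]; simp only [mul_assoc]
      rw [e2] at hl
      have h1 := cs.length_mul_le (u * cs.simple j * cs.simple i) (cs.simple j)
      have h2 := cs.length_mul_le (u * cs.simple j) (cs.simple i)
      rw [cs.length_simple] at h1 h2
      omega
    · rw [map_add]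
      exact add_nonneg (ih _ (by omega) hvj rfl) (ih _ (by omega) hd rfl)

theorem reflectionRep_nonpos (hM : M.SimplyLaced) {w : W} {i : B} (h : cs.IsRightDescent w i) :
    cs.reflectionRep w (M.simpleRoot i) ≤ 0 := by
  have := reflectionRep_nonneg hM (cs.isRightDescent_iff_not_isRightDescent_mul.1 h)
  rw [reflectionRep_mul_apply, reflectionRep_simple, M.simpleReflection_self, map_neg] at this
  exact neg_nonneg.1 this

theorem reflectionRep_simpleRoot_ne_zero (w : W) (i : B) :
    cs.reflectionRep w (M.simpleRoot i) ≠ 0 := by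
  intro h
  have h1 := coxeterForm_reflectionRep (cs := cs) w (M.simpleRoot i) (M.simpleRoot i)
  rw [h, M.coxeterForm_simpleRoot_self] at h1
  simp at h1

theorem isRightDescent_iff_nonpos (hM : M.SimplyLaced) {w : W} {i : B} :
    cs.IsRightDescent w i ↔ cs.reflectionRep w (M.simpleRoot i) ≤ 0 := by
  refine ⟨reflectionRep_nonpos hM, fun h => ?_⟩
  by_contra hd
  exact reflectionRep_simpleRoot_ne_zero w i (le_antisymm h (reflectionRep_nonneg hM hd))

theorem isLeftDescent_iff_nonpos (hM : M.SimplyLaced) {w : W} {i : B} :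
    cs.IsLeftDescent w i ↔ cs.reflectionRep w⁻¹ (M.simpleRoot i) ≤ 0 := by
  rw [← isRightDescent_iff_nonpos hM, cs.isRightDescent_inv_iff]

/-- A nonnegative root that becomes nonpositive under a simple reflection is the simple root. -/
theorem eq_simpleRoot_of_simpleReflection_nonpos {w : W} {i k : B}
    (h0 : 0 ≤ cs.reflectionRep w (M.simpleRoot i))
    (h1 : M.simpleReflection k (cs.reflectionRep w (M.simpleRoot i)) ≤ 0) :
    cs.reflectionRep w (M.simpleRoot i) = M.simpleRoot k := by
  have hf := coxeterForm_reflectionRep (cs := cs) w (M.simpleRoot i) (M.simpleRoot i)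
  rw [M.coxeterForm_simpleRoot_self] at hf
  generalize cs.reflectionRep w (M.simpleRoot i) = β at *
  -- The reflection s_k changes only the k-th coordinate, so all others are both nonnegative and
  -- nonpositive. Norm one then fixes the coefficient.
  have hβ : β = β k • M.simpleRoot k := by
    ext j
    by_cases hj : j = k
    · subst hj; simp [M.simpleRoot_self_apply]
    · have := h1 j
      rw [M.simpleReflection_apply] at this
      simp only [Finsupp.coe_sub, Finsupp.coe_smul, Pi.sub_apply, Pi.smul_apply,
        M.simpleRoot_apply_of_ne (Ne.symm hj), smul_eq_mul, mul_zero, sub_zero,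
        Finsupp.coe_zero, Pi.zero_apply] at this ⊢
      exact le_antisymm this (h0 j)
  have hc : β k * β k = 1 := by
    rw [hβ] at hf
    simpa [M.coxeterForm_simpleRoot_self] using hf
  have h0k : 0 ≤ β k := h0 k
  have : β k = 1 := by nlinarith
  rw [hβ, this, one_smul]

/-- If `w α i` changes its sign along a word, then some letter of the word is responsible. -/
theorem exists_eq_simpleRoot_of_nonpos (hM : M.SimplyLaced) {ω : List B} {i : B}
    (h : cs.reflectionRep (cs.wordProd ω) (M.simpleRoot i) ≤ 0) :
    ∃ (α β : List B) (k : B), ω = α ++ k :: β ∧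
      cs.reflectionRep (cs.wordProd β) (M.simpleRoot i) = M.simpleRoot k := by
  induction ω with
  | nil =>
    exact absurd (le_antisymm h (by simpa using M.simpleRoot_nonneg i))
      (reflectionRep_simpleRoot_ne_zero _ i)
  | cons k ω ih =>
    by_cases h' : cs.reflectionRep (cs.wordProd ω) (M.simpleRoot i) ≤ 0
    · obtain ⟨α, β, l, rfl, hl⟩ := ih h'
      exact ⟨k :: α, β, l, rfl, hl⟩
    · refine ⟨[], ω, k, rfl, eq_simpleRoot_of_simpleReflection_nonpos
        (reflectionRep_nonneg hM (by rwa [isRightDescent_iff_nonpos hM])) ?_⟩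
      rwa [cs.wordProd_cons, reflectionRep_mul_apply, reflectionRep_simple] at h

/-- A nontrivial element has a right descent and makes that simple root nonpositive, so it does not
act as the identity. -/
theorem reflectionRep_faithful (hM : M.SimplyLaced) {a b : W}
    (h : cs.reflectionRep a = cs.reflectionRep b) : a = b := by
  have h1 : cs.reflectionRep (b⁻¹ * a) = 1 := by
    rw [map_mul, h, ← map_mul]; simp
  by_contra hne
  obtain ⟨i, hi⟩ := cs.exists_rightDescent_of_ne_one (w := b⁻¹ * a)
    (fun h => hne (inv_mul_eq_one.1 h).symm)
  have h2 := reflectionRep_nonpos hM hi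
  rw [h1] at h2
  exact reflectionRep_simpleRoot_ne_zero (cs := cs) 1 i
    (by simpa using le_antisymm h2 (M.simpleRoot_nonneg i))

/-- Since w preserves the form, it conjugates the reflection in a root to the reflection in the
image root; faithfulness lifts this from V to W. -/
theorem mul_simple_eq_simple_mul (hM : M.SimplyLaced) {w : W} {i k : B}
    (h : cs.reflectionRep w (M.simpleRoot i) = M.simpleRoot k) :
    w * cs.simple i = cs.simple k * w := by
  refine reflectionRep_faithful (cs := cs) hM (LinearMap.ext fun v => ?_)
  rw [reflectionRep_mul_apply, reflectionRep_mul_apply, reflectionRep_simple, reflectionRep_simple,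
    M.simpleReflection_apply, M.simpleReflection_apply, map_sub, map_smul, h, ← h,
    coxeterForm_reflectionRep]

end CoxeterSystem

/-! ### Traces of words and braid-free words -/

namespace SimpleGraph

set_option linter.unusedSectionVars false

variable {V : Type*} [DecidableEq V] (G : SimpleGraph V) [DecidableRel G.Adj]

/-- The trace of a word at the letter `i`: occurrences of `i` are recorded as `true`, occurrences of
neighbours of `i` as `false`, and all other letters are dropped. -/
def trace (i : V) (ω : List V) : List Bool :=
  ω.filterMap fun k => if k = i then some true else if G.Adj i k then some false else none

/-- The number of occurrences of neighbours of `i` in a word. -/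
def nbrCount (i : V) (ω : List V) : ℕ := ω.countP fun k => G.Adj i k

/-- A word is braid-free if any two consecutive occurrences of a letter are separated by at least
two occurrences of its neighbours. -/
def BraidFree (ω : List V) : Prop :=
  ∀ i, ¬[true, true] <:+: G.trace i ω ∧ ¬[true, false, true] <:+: G.trace i ω

variable {G}

@[simp] theorem trace_nil (i : V) : G.trace i [] = [] := rfl

@[simp] theorem trace_append (i : V) (α β : List V) :
    G.trace i (α ++ β) = G.trace i α ++ G.trace i β := by simp [trace]

@[simp] theorem trace_cons_self (i : V) (ω : List V) :
    G.trace i (i :: ω) = true :: G.trace i ω := by simp [trace]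

theorem trace_cons_of_adj {i k : V} (h : G.Adj i k) (ω : List V) :
    G.trace i (k :: ω) = false :: G.trace i ω := by simp [trace, h, h.ne']

theorem trace_cons_of_not_adj {i k : V} (hne : k ≠ i) (h : ¬G.Adj i k) (ω : List V) :
    G.trace i (k :: ω) = G.trace i ω := by simp [trace, h, hne]

theorem trace_cons_of_ne {i k : V} (hne : k ≠ i) (ω : List V) :
    G.trace i (k :: ω) = G.trace i ω ∨ G.trace i (k :: ω) = false :: G.trace i ω := by
  by_cases h : G.Adj i k
  · exact .inr (trace_cons_of_adj h ω)
  · exact .inl (trace_cons_of_not_adj hne h ω)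

theorem trace_eq_nil_iff {i : V} {ω : List V} :
    G.trace i ω = [] ↔ ∀ k ∈ ω, k ≠ i ∧ ¬G.Adj i k := by
  simp only [trace, List.filterMap_eq_nil_iff]
  refine forall₂_congr fun k _ => ?_
  split_ifs <;> simp_all

theorem trace_eq_true_cons {i : V} {ω : List V} {L : List Bool} (h : G.trace i ω = true :: L) :
    ∃ β γ, ω = β ++ i :: γ ∧ G.trace i β = [] ∧ G.trace i γ = L := by
  obtain ⟨β, k, γ, rfl, h1, h2, h3⟩ := List.filterMap_eq_cons_iff.1 h
  have hk : k = i := by by_contra hk; simp only [hk, if_false] at h2; split_ifs at h2; simp at h2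
  subst hk
  exact ⟨β, γ, rfl, List.filterMap_eq_nil_iff.2 h1, h3⟩

theorem trace_eq_false_cons {i : V} {ω : List V} {L : List Bool} (h : G.trace i ω = false :: L) :
    ∃ β k γ, ω = β ++ k :: γ ∧ G.trace i β = [] ∧ G.Adj i k ∧ G.trace i γ = L := by
  obtain ⟨β, k, γ, rfl, h1, h2, h3⟩ := List.filterMap_eq_cons_iff.1 h
  refine ⟨β, k, γ, rfl, List.filterMap_eq_nil_iff.2 h1, ?_, h3⟩
  by_contra hk
  simp only [hk, if_false] at h2
  split_ifs at h2
  simp at h2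

@[simp] theorem nbrCount_nil (i : V) : G.nbrCount i [] = 0 := rfl

theorem nbrCount_append (i : V) (α β : List V) :
    G.nbrCount i (α ++ β) = G.nbrCount i α + G.nbrCount i β := List.countP_append

theorem nbrCount_cons_of_adj {i k : V} (h : G.Adj i k) (ω : List V) :
    G.nbrCount i (k :: ω) = G.nbrCount i ω + 1 := by simp [nbrCount, h]

theorem nbrCount_cons_of_not_adj {i k : V} (h : ¬G.Adj i k) (ω : List V) :
    G.nbrCount i (k :: ω) = G.nbrCount i ω := by simp [nbrCount, h]

theorem trace_of_notMem {i : V} {ω : List V} (h : i ∉ ω) :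
    G.trace i ω = List.replicate (G.nbrCount i ω) false := by
  induction ω with
  | nil => rfl
  | cons k ω ih =>
    have hk : k ≠ i := by rintro rfl; simp at h
    have := ih fun h' => h (List.mem_cons_of_mem _ h')
    by_cases hadj : G.Adj i k
    · rw [trace_cons_of_adj hadj, nbrCount_cons_of_adj hadj, this, List.replicate_succ]
    · rw [trace_cons_of_not_adj hk hadj, nbrCount_cons_of_not_adj hadj, this]

theorem mem_of_true_mem_trace {i : V} {ω : List V} (h : true ∈ G.trace i ω) : i ∈ ω := by
  by_contra hi
  rw [trace_of_notMem hi] at h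
  simp [List.mem_replicate] at h

theorem trace_isInfix {α ω : List V} (h : α <:+: ω) (i : V) : G.trace i α <:+: G.trace i ω := by
  obtain ⟨s, t, rfl⟩ := h
  exact ⟨G.trace i s, G.trace i t, by simp⟩

theorem BraidFree.of_isInfix {α ω : List V} (h : G.BraidFree ω) (hα : α <:+: ω) : G.BraidFree α :=
  fun i => ⟨fun h' => (h i).1 (h'.trans (trace_isInfix hα i)),
    fun h' => (h i).2 (h'.trans (trace_isInfix hα i))⟩

theorem braidFree_congr {ω ω' : List V} (h : ∀ i, G.trace i ω = G.trace i ω') :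
    G.BraidFree ω ↔ G.BraidFree ω' := by simp only [BraidFree, h]

theorem BraidFree.two_le {α β γ : List V} {i : V} (h : G.BraidFree (α ++ i :: (β ++ i :: γ)))
    (hi : i ∉ β) : 2 ≤ G.nbrCount i β := by
  have h' := h i
  simp only [trace_append, trace_cons_self, trace_of_notMem hi] at h'
  generalize G.nbrCount i β = n at *
  by_contra hn
  obtain rfl | rfl : n = 0 ∨ n = 1 := by omega
  · exact h'.1 ⟨G.trace i α, G.trace i γ, by simp⟩
  · exact h'.2 ⟨G.trace i α, G.trace i γ, by simp⟩

/-- Together with `BraidFree.two_le` this describes braid-freeness by gaps: traces suit commutation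
moves, gaps suit counting. -/
theorem braidFree_of_two_le {ω : List V}
    (h : ∀ α i β γ, ω = α ++ i :: (β ++ i :: γ) → i ∉ β → 2 ≤ G.nbrCount i β) :
    G.BraidFree ω := by
  have split : ∀ i, ∀ A L : List Bool, G.trace i ω = A ++ true :: L →
      ∃ α ρ, ω = α ++ i :: ρ ∧ G.trace i ρ = L := by
    intro i A L hL
    obtain ⟨α, ρ, rfl, -, h2⟩ := List.filterMap_eq_append_iff.1 hL
    obtain ⟨β, γ, rfl, -, h3⟩ := trace_eq_true_cons h2
    exact ⟨α ++ β, γ, by simp, h3⟩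
  refine fun i => ⟨?_, ?_⟩
  · rintro ⟨A, C, hAC⟩
    obtain ⟨α, ρ, rfl, hρ⟩ := split i A (true :: C) (by simp [← hAC])
    obtain ⟨β, γ, rfl, hβ, -⟩ := trace_eq_true_cons hρ
    have hi : i ∉ β := fun hi => (trace_eq_nil_iff.1 hβ i hi).1 rfl
    have := h α i β γ rfl hi
    rw [trace_of_notMem hi] at hβ
    simp at hβ
    omega
  · rintro ⟨A, C, hAC⟩
    obtain ⟨α, ρ, rfl, hρ⟩ := split i A (false :: true :: C) (by simp [← hAC])
    obtain ⟨β, k, ρ, rfl, hβ, hk, hρ⟩ := trace_eq_false_cons hρ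
    obtain ⟨β', γ, rfl, hβ', -⟩ := trace_eq_true_cons hρ
    have hi : i ∉ β := fun hi => (trace_eq_nil_iff.1 hβ i hi).1 rfl
    have hi' : i ∉ β' := fun hi => (trace_eq_nil_iff.1 hβ' i hi).1 rfl
    have := h α i (β ++ k :: β') γ (by simp) (by simp [hi, hi', hk.ne])
    rw [nbrCount_append, nbrCount_cons_of_adj hk] at this
    rw [trace_of_notMem hi] at hβ
    rw [trace_of_notMem hi'] at hβ'
    simp at hβ hβ'
    omega

end SimpleGraph

/-! ### Commutation classes of words -/

namespace CoxeterMatrix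

variable {B : Type*} {M : CoxeterMatrix B}

theorem eq_two_of_not_adj {i j : B} (hne : i ≠ j) (h : ¬M.coxeterGraph.Adj i j) : M i j = 2 := by
  by_contra h2
  exact h ⟨hne, h2⟩

theorem SimplyLaced.eq_three (hM : M.SimplyLaced) {i j : B} (h : M.coxeterGraph.Adj i j) :
    M i j = 3 := (hM i j h.1).resolve_left h.2

theorem ne_of_eq_two {i j : B} (h : M i j = 2) : i ≠ j := by
  rintro rfl
  simp at h

theorem not_adj_of_eq_two {i j : B} (h : M i j = 2) : ¬M.coxeterGraph.Adj i j := fun h' => h'.2 h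

variable (M) in
/-- Two words are commutation equivalent if they are connected by short braid moves. -/
def CommEquiv (ω ω' : List B) : Prop := Relation.ReflTransGen M.ShortBraidMove ω ω'

namespace CommEquiv

@[refl] theorem refl (ω : List B) : M.CommEquiv ω ω := Relation.ReflTransGen.refl

theorem trans {a b c : List B} (h : M.CommEquiv a b) (h' : M.CommEquiv b c) : M.CommEquiv a c :=
  Relation.ReflTransGen.trans h h'

theorem symm {a b : List B} (h : M.CommEquiv a b) : M.CommEquiv b a := by
  induction h with
  | refl => rfl
  | tail _ h ih =>
    obtain ⟨u, v, i, j, hij, rfl, rfl⟩ := h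
    exact Relation.ReflTransGen.head ⟨u, v, j, i, by rw [M.symmetric]; exact hij, rfl, rfl⟩ ih

theorem append_left (α : List B) {a b : List B} (h : M.CommEquiv a b) :
    M.CommEquiv (α ++ a) (α ++ b) := by
  induction h with
  | refl => rfl
  | tail _ h ih =>
    obtain ⟨u, v, i, j, hij, rfl, rfl⟩ := h
    exact ih.tail ⟨α ++ u, v, i, j, hij, by simp, by simp⟩

theorem cons (i : B) {a b : List B} (h : M.CommEquiv a b) : M.CommEquiv (i :: a) (i :: b) :=
  h.append_left [i]

theorem swap {i j : B} (h : M i j = 2) (ω : List B) :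
    M.CommEquiv (i :: j :: ω) (j :: i :: ω) :=
  Relation.ReflTransGen.single ⟨[], ω, i, j, h, rfl, rfl⟩

theorem perm {a b : List B} (h : M.CommEquiv a b) : a.Perm b := by
  induction h with
  | refl => rfl
  | tail _ h ih =>
    obtain ⟨u, v, i, j, hij, rfl, rfl⟩ := h
    refine ih.trans ?_
    exact (((List.Perm.swap j i []).append_left u).append_right v)

theorem wordProd_eq {W : Type*} [Group W] (cs : CoxeterSystem M W) {a b : List B}
    (h : M.CommEquiv a b) : cs.wordProd a = cs.wordProd b := by
  induction h with
  | refl => rfl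
  | tail _ h ih =>
    obtain ⟨u, v, i, j, hij, rfl, rfl⟩ := h
    rw [ih]
    simp only [cs.wordProd_append, cs.wordProd_cons, cs.wordProd_nil, mul_one,
      CoxeterSystem.simple_mul_comm hij]

variable [DecidableEq B] [DecidableRel M.coxeterGraph.Adj]

/-- Two commuting letters that are both recorded at k must both be neighbours of k, and the trace
does not distinguish neighbours. So traces are invariants of the commutation class. -/
theorem trace_eq {a b : List B} (h : M.CommEquiv a b) (k : B) :
    M.coxeterGraph.trace k a = M.coxeterGraph.trace k b := by
  induction h with
  | refl => rfl
  | tail _ h ih =>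
    obtain ⟨u, v, i, j, hij, rfl, rfl⟩ := h
    rw [ih]
    have h1 := not_adj_of_eq_two hij
    have h2 : ¬M.coxeterGraph.Adj j i := fun h => h1 h.symm
    have h3 := ne_of_eq_two hij
    simp only [SimpleGraph.trace_append, List.append_cancel_left_eq, List.append_cancel_right_eq]
    simp only [SimpleGraph.trace, List.filterMap_cons, List.filterMap_nil]
    by_cases hi : i = k
    · subst hi; simp [h1, h3.symm]
    by_cases hj : j = k
    · subst hj; simp [h2, h3]
    simp only [hi, hj, if_false]
    split_ifs <;> rfl

theorem cons_append {i : B} {β : List B} (h : M.coxeterGraph.trace i β = []) (γ : List B) :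
    M.CommEquiv (i :: (β ++ γ)) (β ++ i :: γ) := by
  induction β with
  | nil => rfl
  | cons k β ih =>
    have h' := SimpleGraph.trace_eq_nil_iff.1 h
    have hk := h' k (by simp)
    exact (swap (eq_two_of_not_adj hk.1.symm hk.2) _).trans
      (cons k (ih (SimpleGraph.trace_eq_nil_iff.2 fun l hl => h' l (by simp [hl]))))

/-- An i that precedes all its neighbours commutes with everything before it and moves to the front.
-/
theorem exists_cons {i : B} {ω : List B} {L : List Bool}
    (h : M.coxeterGraph.trace i ω = true :: L) : ∃ ρ, M.CommEquiv ω (i :: ρ) := by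
  obtain ⟨β, γ, rfl, hβ, -⟩ := SimpleGraph.trace_eq_true_cons h
  exact ⟨β ++ γ, (cons_append hβ γ).symm⟩

theorem braidFree {a b : List B} (h : M.CommEquiv a b) (ha : M.coxeterGraph.BraidFree a) :
    M.coxeterGraph.BraidFree b := (SimpleGraph.braidFree_congr h.trace_eq).1 ha

end CommEquiv

end CoxeterMatrix

/-! ### Braid-free words are reduced and represent fully commutative elements -/

namespace CoxeterSystem

variable {B : Type*} {M : CoxeterMatrix B} {W : Type*} [Group W] {cs : CoxeterSystem M W}

theorem isReduced_of_eq {ω ω' : List B} (h : cs.IsReduced ω) (hπ : cs.wordProd ω' = cs.wordProd ω)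
    (hl : ω'.length ≤ ω.length) : cs.IsReduced ω' := by
  refine le_antisymm (cs.length_wordProd_le _) ?_
  rw [hπ, h.eq]; exact hl

theorem IsReduced.congr_commEquiv {ω ω' : List B} (h : cs.IsReduced ω) (hc : M.CommEquiv ω ω') :
    cs.IsReduced ω' :=
  isReduced_of_eq h (hc.wordProd_eq cs).symm hc.perm.length_eq.ge

theorem IsReduced.of_isInfix {ω ω' : List B} (h : cs.IsReduced ω) (hi : ω' <:+: ω) :
    cs.IsReduced ω' := by
  obtain ⟨s, t, rfl⟩ := hi
  have h1 := h.eq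
  simp only [cs.wordProd_append, List.length_append] at h1
  have h2 := cs.length_mul_le (cs.wordProd s * cs.wordProd ω') (cs.wordProd t)
  have h3 := cs.length_mul_le (cs.wordProd s) (cs.wordProd ω')
  have h4 := cs.length_wordProd_le s
  have h5 := cs.length_wordProd_le t
  have h6 := cs.length_wordProd_le ω'
  exact le_antisymm h6 (by omega)

theorem IsReduced.tail {ω : List B} {i : B} (h : cs.IsReduced (i :: ω)) : cs.IsReduced ω :=
  h.of_isInfix (List.suffix_cons i ω).isInfix

theorem IsReduced.isLeftDescent {ω : List B} {i : B} (h : cs.IsReduced (i :: ω)) :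
    cs.IsLeftDescent (cs.wordProd (i :: ω)) i := by
  rw [IsLeftDescent, h.eq, cs.wordProd_cons, cs.simple_mul_simple_cancel_left, h.tail.eq]
  simp

theorem IsReduced.not_isLeftDescent {ω : List B} {i : B} (h : cs.IsReduced (i :: ω)) :
    ¬cs.IsLeftDescent (cs.wordProd ω) i := by
  rw [IsLeftDescent, ← cs.wordProd_cons, h.eq, h.tail.eq]
  simp

theorem IsReduced.not_isRightDescent {ω : List B} {i : B} (h : cs.IsReduced (ω ++ [i])) :
    ¬cs.IsRightDescent (cs.wordProd ω) i := by
  have h' : cs.IsReduced ω := h.of_isInfix (List.prefix_append _ _).isInfix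
  rw [IsRightDescent, ← cs.wordProd_singleton, ← cs.wordProd_append, h.eq, h'.eq]
  simp

theorem exists_isReduced_cons {w : W} {i : B} (h : cs.IsLeftDescent w i) :
    ∃ ω, cs.IsReduced (i :: ω) ∧ cs.wordProd (i :: ω) = w := by
  obtain ⟨ω, hω, h1⟩ := cs.exists_isReduced (cs.simple i * w)
  have h2 : cs.wordProd (i :: ω) = w := by
    rw [cs.wordProd_cons, ← h1, cs.simple_mul_simple_cancel_left]
  refine ⟨ω, ?_, h2⟩
  have h3 := cs.isLeftDescent_iff.1 h
  rw [h1, hω.eq] at h3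
  rw [IsReduced, h2, ← h3, List.length_cons]

theorem isLeftDescent_simple_mul_of_eq_two (hM : M.SimplyLaced) {w : W} {i k : B}
    (hki : M k i = 2) (hi : cs.IsLeftDescent w i) : cs.IsLeftDescent (cs.simple k * w) i := by
  rw [isLeftDescent_iff_nonpos hM] at hi ⊢
  rwa [mul_inv_rev, inv_simple, reflectionRep_mul_apply, reflectionRep_simple,
    M.simpleReflection_of_eq_two hki]

/-- The rank-two fact behind a reduced word that starts with k i k: the signs follow from w⁻¹(α_k +
α_i) ≤ 0 and s_k s_i α_k = α_i. -/
theorem isLeftDescent_simple_mul_of_eq_three (hM : M.SimplyLaced) {w : W} {i k : B}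
    (hki : M k i = 3) (hi : cs.IsLeftDescent w i) (hk : cs.IsLeftDescent w k) :
    cs.IsLeftDescent (cs.simple k * w) i ∧
      cs.IsLeftDescent (cs.simple i * (cs.simple k * w)) k := by
  simp only [isLeftDescent_iff_nonpos hM] at hi hk ⊢
  have h3 : M i k = 3 := by rw [M.symmetric]; exact hki
  simp only [mul_inv_rev, inv_simple, reflectionRep_mul_apply, reflectionRep_simple,
    M.simpleReflection_of_eq_three hki, M.simpleReflection_of_eq_three h3, map_add,
    M.simpleReflection_self]
  refine ⟨add_nonpos hk hi, ?_⟩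
  rw [← map_add]
  simpa using hi

variable [DecidableEq B] [DecidableRel M.coxeterGraph.Adj]

open SimpleGraph in
-- Induction on the length, comparing the first letters k of u and i of v. Equal letters cancel. If
-- they commute, i is a descent of the rest of u, so u is equivalent to a word k i z and then to i k
-- z. If m k i = 3, both being descents makes u equivalent to a word k i k z, which is not
-- braid-free.
theorem commEquiv_of_wordProd_eq (hM : M.SimplyLaced) {u v : List B}
    (hu : M.coxeterGraph.BraidFree u) (hur : cs.IsReduced u) (hvr : cs.IsReduced v)
    (h : cs.wordProd u = cs.wordProd v) : M.CommEquiv u v := by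
  obtain ⟨n, hn⟩ : ∃ n, u.length = n := ⟨_, rfl⟩
  induction n generalizing u v with
  | zero =>
    have h1 := hur.eq
    rw [h, hvr.eq, hn] at h1
    rw [List.length_eq_zero_iff.1 hn, List.length_eq_zero_iff.1 h1]
  | succ n ih =>
    have hl := hur.eq
    rw [h, hvr.eq] at hl
    obtain ⟨k, u, rfl⟩ := List.exists_cons_of_length_eq_add_one hn
    obtain ⟨i, v, rfl⟩ := List.exists_cons_of_length_eq_add_one (hl.trans hn)
    simp only [List.length_cons] at hn hl
    have hu' := hu.of_isInfix (List.suffix_cons k u).isInfix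
    have hk := hur.isLeftDescent
    have hi := hvr.isLeftDescent
    rw [← h] at hi
    have hsku : cs.simple k * cs.wordProd (k :: u) = cs.wordProd u := by
      rw [cs.wordProd_cons, cs.simple_mul_simple_cancel_left]
    by_cases hik : i = k
    · subst hik
      rw [cs.wordProd_cons, cs.wordProd_cons, mul_left_cancel_iff] at h
      exact (ih hu' hur.tail hvr.tail h (by omega)).cons i
    rcases hM k i (Ne.symm hik) with h2 | h3
    · have hd := isLeftDescent_simple_mul_of_eq_two hM h2 hi
      rw [hsku] at hd
      obtain ⟨z, hz, hzu⟩ := exists_isReduced_cons hd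
      have e1 := ((ih hu' hur.tail hz hzu.symm (by omega)).cons k).trans (.swap h2 z)
      refine e1.trans (.cons i ?_)
      have hb := e1.braidFree hu
      have hr := hur.congr_commEquiv e1
      have hp := e1.wordProd_eq cs
      refine ih (hb.of_isInfix (List.suffix_cons i _).isInfix) hr.tail hvr.tail ?_ ?_
      · rw [h, cs.wordProd_cons i, cs.wordProd_cons i] at hp
        exact (mul_left_cancel hp).symm
      · have := e1.perm.length_eq
        simp only [List.length_cons] at this ⊢
        omega
    · exfalso
      obtain ⟨hd, hd'⟩ := isLeftDescent_simple_mul_of_eq_three hM h3 hi hk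
      rw [hsku] at hd hd'
      obtain ⟨z, hz, hzw⟩ := exists_isReduced_cons hd'
      have hzu : cs.wordProd (i :: k :: z) = cs.wordProd u := by
        rw [cs.wordProd_cons, hzw, cs.simple_mul_simple_cancel_left]
      have hr : cs.IsReduced (i :: k :: z) := by
        have := cs.isLeftDescent_iff.1 hd
        rw [← hzw, hz.eq] at this
        rw [IsReduced, hzu, ← this]
        rfl
      have e1 := (ih hu' hur.tail hr hzu.symm (by omega)).cons k
      have := (e1.braidFree hu k).2
      have hadj : M.coxeterGraph.Adj k i := ⟨Ne.symm hik, by rw [h3]; norm_num⟩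
      rw [trace_cons_self, trace_cons_of_adj hadj, trace_cons_self] at this
      exact this ⟨[], _, rfl⟩

open SimpleGraph in
/-- Braid-free words are reduced. -/
theorem isReduced_of_braidFree (hM : M.SimplyLaced) {ω : List B}
    (h : M.coxeterGraph.BraidFree ω) : cs.IsReduced ω := by
  obtain ⟨n, hn⟩ : ∃ n, ω.length = n := ⟨_, rfl⟩
  induction n generalizing ω with
  | zero => rw [List.length_eq_zero_iff.1 hn]; simp [IsReduced]
  | succ n ih =>
    obtain ⟨ω, i, rfl⟩ : ∃ ω' i, ω = ω' ++ [i] := by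
      rcases List.eq_nil_or_concat ω with rfl | ⟨ω', i, h⟩
      · simp at hn
      · exact ⟨ω', i, by simpa using h⟩
    simp only [List.length_append, List.length_singleton, Nat.add_right_cancel_iff] at hn
    have hω := ih (h.of_isInfix (List.prefix_append _ _).isInfix) hn
    by_contra hr
    have hd : cs.IsRightDescent (cs.wordProd ω) i := by
      by_contra hd
      rw [cs.not_isRightDescent_iff] at hd
      refine hr ?_
      rw [IsReduced, cs.wordProd_append, cs.wordProd_singleton, hd, hω.eq]
      simp
    obtain ⟨α, β, k, rfl, hk⟩ := exists_eq_simpleRoot_of_nonpos hM (reflectionRep_nonpos hM hd)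
    have hπ : cs.wordProd (k :: β) = cs.wordProd (β ++ [i]) := by
      rw [cs.wordProd_cons, cs.wordProd_append, cs.wordProd_singleton,
        mul_simple_eq_simple_mul hM hk]
    have hkr : cs.IsReduced (k :: β) := hω.of_isInfix (List.suffix_append _ _).isInfix
    have hc := commEquiv_of_wordProd_eq hM (h.of_isInfix ⟨α, [i], by simp⟩) hkr
      (isReduced_of_eq hkr hπ.symm (by simp)) hπ
    have hki : k = i := by
      have := (hc.perm.trans (List.perm_append_singleton i β)).count_eq i
      by_contra hki
      simp [hki] at this
    subst hki
    -- With T the trace of β at k this reads true :: T = T ++ [true]. So T is empty or starts with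
    -- `true`, and either way the trace of k β k contains [true, true].
    have ht := hc.trace_eq k
    rw [trace_cons_self, trace_append, trace_cons_self, trace_nil] at ht
    have h1 : [true, true] <:+: M.coxeterGraph.trace k (k :: β ++ [k]) := by
      rw [List.cons_append, trace_cons_self, trace_append, trace_cons_self, trace_nil]
      rcases hL : M.coxeterGraph.trace k β with _ | ⟨b, L⟩
      · exact ⟨[], [], rfl⟩
      · rw [hL] at ht
        simp only [List.cons_append, List.cons.injEq] at ht
        exact ⟨[], L ++ [true], by simp [ht.1]⟩
    exact (h k).1 (h1.trans (trace_isInfix ⟨α, [], by simp⟩ k))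

theorem isFullyCommutative_of_braidFree (hM : M.SimplyLaced) {ω : List B}
    (h : M.coxeterGraph.BraidFree ω) : cs.IsFullyCommutative (cs.wordProd ω) := by
  have hω := isReduced_of_braidFree (cs := cs) hM h
  refine ⟨ω, Set.ext fun ω' => ⟨fun h' => ?_, fun h' => ?_⟩⟩
  · exact commEquiv_of_wordProd_eq hM h hω h'.1 h'.2.symm
  · exact ⟨hω.congr_commEquiv h', (CoxeterMatrix.CommEquiv.wordProd_eq cs h').symm⟩

end CoxeterSystem

/-! ### Contractible triples and long braids -/

namespace CoxeterMatrix

variable {B : Type*} {M : CoxeterMatrix B}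

theorem simpleReflection_simpleReflection (i : B) (v : B →₀ ℝ) :
    M.simpleReflection i (M.simpleReflection i v) = v := by
  simp only [simpleReflection_apply, map_sub, map_smul, coxeterForm_simpleRoot_self]
  module

/-- If three consecutive roots of a root sequence form a triple `{a, b, a + b}`, then the
corresponding letters are `i, j, i` with `m i j = 3`. -/
theorem eq_and_eq_three_of_sum (hM : M.SimplyLaced) {i j k : B} {a b c : B →₀ ℝ}
    (ha : a = M.simpleRoot i) (hb : b = M.simpleReflection i (M.simpleRoot j))
    (hc : c = M.simpleReflection i (M.simpleReflection j (M.simpleRoot k)))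
    (h : a = b + c ∨ b = a + c ∨ c = a + b) : k = i ∧ M i j = 3 := by
  -- The height of a vector. After applying s_i the three roots are -α_i, α_j and s_j α_k, of
  -- heights -1, 1 and one of -1, 2, 1. Only b = a + c with height 2 is consistent.
  let d : (B →₀ ℝ) →ₗ[ℝ] ℝ := Finsupp.linearCombination ℝ fun _ => (1 : ℝ)
  have hd : ∀ l, d (M.simpleRoot l) = 1 := fun l => by simp [d, simpleRoot]
  have ea := congrArg (M.simpleReflection i) ha
  have eb := congrArg (M.simpleReflection i) hb
  have ec := congrArg (M.simpleReflection i) hc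
  rw [simpleReflection_simpleReflection] at eb ec
  rw [simpleReflection_self] at ea
  have hk : (k = j ∧ M.simpleReflection j (M.simpleRoot k) = -M.simpleRoot j) ∨
      (M j k = 3 ∧ M.simpleReflection j (M.simpleRoot k) = M.simpleRoot j + M.simpleRoot k) ∨
      M.simpleReflection j (M.simpleRoot k) = M.simpleRoot k := by
    by_cases hkj : k = j
    · subst hkj; exact .inl ⟨rfl, M.simpleReflection_self k⟩
    · rcases hM j k (Ne.symm hkj) with h2 | h3
      · exact .inr (.inr (M.simpleReflection_of_eq_two h2))
      · exact .inr (.inl ⟨h3, M.simpleReflection_of_eq_three h3⟩)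
  rcases h with h | h | h <;> have h := congrArg (M.simpleReflection i) h <;>
    rw [map_add, ea, eb, ec] at h <;> have hdeg := congrArg d h <;>
    rcases hk with ⟨hkj, hk⟩ | ⟨hjk, hk⟩ | hk <;> rw [hk] at h hdeg <;>
    simp only [map_add, map_neg, hd] at hdeg <;> norm_num at hdeg
  have h' : M.simpleRoot k = M.simpleRoot i := by
    rw [← sub_eq_zero] at h ⊢
    rw [← neg_eq_zero, ← h]; abel
  have hki : k = i := Finsupp.single_left_injective (one_ne_zero) h'
  subst hki
  exact ⟨rfl, by rw [M.symmetric]; exact hjk⟩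

end CoxeterMatrix

namespace CoxeterSystem

variable {B : Type*} {M : CoxeterMatrix B} {W : Type*} [Group W] {cs : CoxeterSystem M W}

theorem length_rootSequence (ω : List B) : (cs.rootSequence ω).length = ω.length := by
  induction ω with
  | nil => rfl
  | cons i ω ih => simp [rootSequence, ih]

theorem rootSequence_append (α β : List B) :
    cs.rootSequence (α ++ β) = cs.rootSequence β ++
      (cs.rootSequence α).map (cs.reflectionRep (cs.wordProd β)⁻¹) := by
  induction α with
  | nil => simp [rootSequence]
  | cons i α ih =>
    simp [rootSequence, ih, cs.wordProd_append]

theorem exists_append_of_rootSequence_eq {ω : List B} {A C : List (B →₀ ℝ)}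
    (h : cs.rootSequence ω = A ++ C) :
    ∃ α β, ω = α ++ β ∧ cs.rootSequence β = A ∧
      (cs.rootSequence α).map (cs.reflectionRep (cs.wordProd β)⁻¹) = C := by
  have hl := congrArg List.length h
  rw [length_rootSequence, List.length_append] at hl
  refine ⟨ω.take C.length, ω.drop C.length, (List.take_append_drop _ _).symm, ?_⟩
  rw [← List.take_append_drop C.length ω, rootSequence_append] at h
  exact List.append_inj h (by rw [length_rootSequence, List.length_drop]; omega)

theorem exists_of_mem_rootSequence {ω : List B} {r : B →₀ ℝ} (h : r ∈ cs.rootSequence ω) :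
    ∃ α i β, ω = α ++ i :: β ∧ r = cs.reflectionRep (cs.wordProd β)⁻¹ (M.simpleRoot i) := by
  induction ω with
  | nil => simp [rootSequence] at h
  | cons i ω ih =>
    simp only [rootSequence, List.mem_append, List.mem_singleton] at h
    rcases h with h | h
    · obtain ⟨α, j, β, rfl, hr⟩ := ih h
      exact ⟨i :: α, j, β, rfl, hr⟩
    · exact ⟨[], i, ω, rfl, h⟩

theorem IsReduced.reflectionRep_nonneg (hM : M.SimplyLaced) {i : B} {β : List B}
    (h : cs.IsReduced (i :: β)) :
    0 ≤ cs.reflectionRep (cs.wordProd β)⁻¹ (M.simpleRoot i) :=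
  CoxeterSystem.reflectionRep_nonneg hM
    (by rw [cs.isRightDescent_inv_iff]; exact h.not_isLeftDescent)

theorem mem_inversionSet_of_mem_rootSequence (hM : M.SimplyLaced) {ω : List B}
    (hω : cs.IsReduced ω) {r : B →₀ ℝ} (h : r ∈ cs.rootSequence ω) :
    r ∈ cs.inversionSet (cs.wordProd ω) := by
  obtain ⟨α, i, β, rfl, rfl⟩ := exists_of_mem_rootSequence h
  refine ⟨⟨⟨_, i, rfl⟩, ?_⟩, ⟨⟨cs.wordProd α, i, ?_⟩, ?_⟩⟩
  · exact IsReduced.reflectionRep_nonneg hM (hω.of_isInfix (List.suffix_append _ _).isInfix)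
  all_goals
    have e : -cs.reflectionRep (cs.wordProd (α ++ i :: β))
        (cs.reflectionRep (cs.wordProd β)⁻¹ (M.simpleRoot i)) =
          cs.reflectionRep (cs.wordProd α) (M.simpleRoot i) := by
      rw [← reflectionRep_mul_apply, cs.wordProd_append, cs.wordProd_cons]
      simp only [mul_assoc, mul_inv_cancel, mul_one]
      rw [reflectionRep_mul_apply, reflectionRep_simple, M.simpleReflection_self, map_neg, neg_neg]
    rw [e]
  refine CoxeterSystem.reflectionRep_nonneg hM (IsReduced.not_isRightDescent ?_)
  exact hω.of_isInfix ⟨[], β, by simp⟩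

theorem coxeterForm_self_of_mem_inversionSet {w : W} {r : B →₀ ℝ} (h : r ∈ cs.inversionSet w) :
    M.coxeterForm r r = 1 := by
  obtain ⟨⟨⟨v, i, rfl⟩, -⟩, -⟩ := h
  rw [coxeterForm_reflectionRep, M.coxeterForm_simpleRoot_self]

theorem wordProd_braid {i j : B} (h : M i j = 3) (α β : List B) :
    cs.wordProd (α ++ (i :: j :: i :: β)) = cs.wordProd (α ++ (j :: i :: j :: β)) := by
  have := simple_braid (cs := cs) h
  simp only [cs.wordProd_append, cs.wordProd_cons, ← mul_assoc]
  simp only [mul_assoc (cs.wordProd α)] at this ⊢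
  rw [this]

theorem IsReduced.braid {i j : B} (h : M i j = 3) {α β : List B}
    (hr : cs.IsReduced (α ++ (i :: j :: i :: β))) :
    cs.IsReduced (α ++ (j :: i :: j :: β)) :=
  isReduced_of_eq hr (wordProd_braid h α β).symm (by simp)

/-- A contractible triple comes from a long braid in a reduced expression. -/
theorem IsContractibleTriple.exists_braid (hM : M.SimplyLaced) {w : W} {T : Set (B →₀ ℝ)}
    (h : cs.IsContractibleTriple w T) :
    ∃ α i j β, M i j = 3 ∧ α ++ (i :: j :: i :: β) ∈ cs.reducedExpressions w := by
  obtain ⟨⟨hT, x, y, hxy⟩, ω, hω, a, b, c, habc, hinf⟩ := h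
  have hf : ∀ r ∈ T, M.coxeterForm r r = 1 := fun r hr =>
    coxeterForm_self_of_mem_inversionSet (hT hr)
  have hx := hf x (by simp [hxy])
  have hy := hf y (by simp [hxy])
  have hs := hf (x + y) (by simp [hxy])
  -- Roots have norm one, while x = y would give x + y norm four. Nondegeneracy makes a, b, c a
  -- genuine rearrangement of x, y, x + y.
  have hne : x ≠ y := by
    rintro rfl
    simp only [map_add, LinearMap.add_apply, hx] at hs
    norm_num at hs
  have hx0 : x ≠ 0 := by rintro rfl; simp at hx
  have hy0 : y ≠ 0 := by rintro rfl; simp at hy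
  have hsum : a = b + c ∨ b = a + c ∨ c = a + b := by
    have h1 : x ∈ ({a, b, c} : Set (B →₀ ℝ)) := by rw [← habc, hxy]; simp
    have h2 : y ∈ ({a, b, c} : Set (B →₀ ℝ)) := by rw [← habc, hxy]; simp
    have h3 : x + y ∈ ({a, b, c} : Set (B →₀ ℝ)) := by rw [← habc, hxy]; simp
    simp only [Set.mem_insert_iff, Set.mem_singleton_iff] at h1 h2 h3
    have h4 : x + y ≠ x := by simpa using hy0
    have h5 : x + y ≠ y := by simpa using hx0
    grind
  obtain ⟨s, t, hst⟩ := hinf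
  obtain ⟨α, β, rfl, -, hα⟩ := exists_append_of_rootSequence_eq
    (cs := cs) (ω := ω) (A := s) (C := [a, b, c] ++ t) (by rw [← hst, List.append_assoc])
  obtain ⟨P, Q, hPQ, hP, -⟩ := List.map_eq_append_iff.1 hα
  obtain ⟨α, δ, rfl, hδ, -⟩ := exists_append_of_rootSequence_eq hPQ
  subst hδ
  have hlen := congrArg List.length hP
  rw [List.length_map, length_rootSequence] at hlen
  obtain ⟨k, j, i, rfl⟩ := List.length_eq_three.1 hlen
  simp only [rootSequence, wordProd_nil, List.nil_append, List.map_cons,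
    List.map_nil, List.cons_append, List.cons.injEq, and_true, inv_one, map_one,
    Module.End.one_apply, cs.wordProd_cons, mul_inv_rev, inv_simple, mul_one,
    reflectionRep_mul_apply, reflectionRep_simple] at hP
  obtain ⟨rfl, rfl, rfl⟩ := hP
  obtain ⟨rfl, h3⟩ := M.eq_and_eq_three_of_sum hM rfl rfl rfl (by
    simpa only [← map_add, (reflectionRep_injective _).eq_iff] using hsum)
  exact ⟨α, k, j, β, h3, by simpa using hω⟩

/-- There are no contractible triples at all: replacing i j i by j i j changes the number of letters
i, while a commutation class consists of permutations of one word. -/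
theorem IsFullyCommutative.isFreelyBraided (hM : M.SimplyLaced) {w : W}
    (h : cs.IsFullyCommutative w) : cs.IsFreelyBraided w := by
  classical
  intro T T' hT
  exfalso
  obtain ⟨ω, hω⟩ := h
  obtain ⟨α, i, j, β, hij, hr⟩ := hT.exists_braid hM
  have hr' : α ++ (j :: i :: j :: β) ∈ cs.reducedExpressions w :=
    ⟨hr.1.braid hij, by rw [← hr.2, wordProd_braid hij]⟩
  rw [hω] at hr hr'
  have hp := ((CoxeterMatrix.CommEquiv.perm hr).symm.trans
    (CoxeterMatrix.CommEquiv.perm hr')).count_eq i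
  have hne : i ≠ j := by rintro rfl; simp at hij
  simp [List.count_append, hne.symm] at hp

end CoxeterSystem

/-! ### Overlapping braids are impossible in freely braided elements -/

namespace CoxeterMatrix

variable {B : Type*} {M : CoxeterMatrix B}

theorem SimplyLaced.eq_three_symm (hM : M.SimplyLaced) {i j : B} (h : M.coxeterGraph.Adj i j) :
    M j i = 3 := hM.eq_three h.symm

end CoxeterMatrix

namespace CoxeterSystem

set_option linter.unusedSectionVars false

variable {B : Type*} {M : CoxeterMatrix B} {W : Type*} [Group W] {cs : CoxeterSystem M W}

variable (cs) in
/-- The roots that belong to the letters `i, j, i` of a word `α ++ i :: j :: i :: β`. -/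
def braidRoots (i j : B) (β : List B) : Set (B →₀ ℝ) :=
  cs.reflectionRep (cs.wordProd β)⁻¹ ''
    {M.simpleRoot i, M.simpleRoot j, M.simpleRoot i + M.simpleRoot j}

/-- The converse of `IsContractibleTriple.exists_braid`: read from the right, the letters i, j, i
contribute v α_i, v (α_i + α_j), v α_j, where v is the inverse of β. -/
theorem isContractibleTriple_braidRoots (hM : M.SimplyLaced) {i j : B} (h : M i j = 3)
    {α β : List B} (hr : cs.IsReduced (α ++ (i :: j :: i :: β))) :
    cs.IsContractibleTriple (cs.wordProd (α ++ (i :: j :: i :: β))) (cs.braidRoots i j β) := by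
  have hji : M j i = 3 := by rw [M.symmetric]; exact h
  set v := cs.reflectionRep (cs.wordProd β)⁻¹ with hv
  have hs : cs.rootSequence (α ++ (i :: j :: i :: β)) = cs.rootSequence β ++
      [v (M.simpleRoot i), v (M.simpleRoot i + M.simpleRoot j), v (M.simpleRoot j)] ++
      (cs.rootSequence α).map (cs.reflectionRep (cs.wordProd (i :: j :: i :: β))⁻¹) := by
    rw [rootSequence_append]
    have e2 : M.simpleReflection i (M.simpleReflection j (M.simpleRoot i)) = M.simpleRoot j := by
      rw [M.simpleReflection_of_eq_three hji, map_add, M.simpleReflection_self,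
        M.simpleReflection_of_eq_three h]
      abel
    simp only [rootSequence, cs.wordProd_cons, mul_inv_rev, inv_simple, reflectionRep_mul_apply,
      reflectionRep_simple, e2]
    rw [M.simpleReflection_of_eq_three h]
    simp [hv]
  have hT : cs.braidRoots i j β =
      {v (M.simpleRoot i), v (M.simpleRoot i + M.simpleRoot j), v (M.simpleRoot j)} := by
    rw [braidRoots, Set.image_insert_eq, Set.image_insert_eq, Set.image_singleton]
    exact congrArg _ (Set.pair_comm _ _)
  refine ⟨⟨fun r hr' => mem_inversionSet_of_mem_rootSequence hM hr ?_, v (M.simpleRoot i),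
    v (M.simpleRoot j), ?_⟩,
    _, ⟨hr, rfl⟩, _, _, _, hT, ⟨_, _, hs.symm⟩⟩
  · rw [hT] at hr'
    rw [hs]
    simp only [Set.mem_insert_iff, Set.mem_singleton_iff] at hr'
    simp only [List.mem_append, List.mem_cons]
    tauto
  · rw [braidRoots, Set.image_insert_eq, Set.image_insert_eq, Set.image_singleton, map_add]

theorem IsFreelyBraided.braidRoots_eq_or_disjoint (hM : M.SimplyLaced) {w : W}
    (hw : cs.IsFreelyBraided w) {i j k l : B} (hij : M i j = 3) (hkl : M k l = 3)
    {α β α' β' : List B} (h : α ++ (i :: j :: i :: β) ∈ cs.reducedExpressions w)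
    (h' : α' ++ (k :: l :: k :: β') ∈ cs.reducedExpressions w) :
    cs.braidRoots i j β = cs.braidRoots k l β' ∨
      Disjoint (cs.braidRoots i j β) (cs.braidRoots k l β') := by
  have h1 := isContractibleTriple_braidRoots hM hij h.1
  have h2 := isContractibleTriple_braidRoots hM hkl h'.1
  rw [h.2] at h1
  rw [h'.2] at h2
  exact or_iff_not_imp_left.2 (hw _ _ h1 h2)

theorem reflectionRep_inv_simpleRoot_of_forall {i : B} {β : List B}
    (h : ∀ k ∈ β, M k i = 2) :
    cs.reflectionRep (cs.wordProd β) (M.simpleRoot i) = M.simpleRoot i := by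
  induction β with
  | nil => simp
  | cons k β ih =>
    rw [cs.wordProd_cons, reflectionRep_mul_apply, ih fun l hl => h l (by simp [hl]),
      reflectionRep_simple, M.simpleReflection_of_eq_two (h k (by simp))]

variable [DecidableEq B] [DecidableRel M.coxeterGraph.Adj]

open SimpleGraph

theorem reflectionRep_simpleRoot_of_trace_eq_nil {i : B} {β : List B}
    (h : M.coxeterGraph.trace i β = []) :
    cs.reflectionRep (cs.wordProd β) (M.simpleRoot i) = M.simpleRoot i :=
  reflectionRep_inv_simpleRoot_of_forall fun k hk => by
    have := trace_eq_nil_iff.1 h k hk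
    rw [M.symmetric]
    exact M.eq_two_of_not_adj this.1.symm this.2

/-- In a reduced word of a freely braided element, two long braids do not share an outer letter. -/
theorem IsFreelyBraided.not_mem_reducedExpressions (hM : M.SimplyLaced) {w : W}
    (hw : cs.IsFreelyBraided w) {α β γ : List B} {i j k : B}
    (hij : M.coxeterGraph.Adj i j) (hik : M.coxeterGraph.Adj i k) (hβ : M.coxeterGraph.trace i β = []) :
    α ++ (i :: j :: i :: (β ++ k :: i :: γ)) ∉ cs.reducedExpressions w := by
  intro hr
  have hij3 := hM.eq_three hij
  have hik3 := hM.eq_three hik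
  have hki3 := hM.eq_three_symm hik
  have hc : M.CommEquiv (α ++ (i :: j :: i :: (β ++ k :: i :: γ)))
      ((α ++ (i :: j :: β)) ++ (i :: k :: i :: γ)) := by
    have := ((CoxeterMatrix.CommEquiv.cons_append hβ (k :: i :: γ)).cons j).cons i
    simpa using this.append_left α
  have hr' : (α ++ (i :: j :: β)) ++ (i :: k :: i :: γ) ∈ cs.reducedExpressions w :=
    ⟨hr.1.congr_commEquiv hc, by rw [← hc.wordProd_eq cs, hr.2]⟩
  have hβinv : cs.reflectionRep (cs.wordProd β)⁻¹ (M.simpleRoot i) = M.simpleRoot i := by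
    conv_lhs => rw [← reflectionRep_simpleRoot_of_trace_eq_nil (cs := cs) hβ]
    rw [reflectionRep_inv_apply_self]
  -- The root of the second i. It closes the braid i j i, and after commuting past β it opens the
  -- braid i k i; so both triples contain it.
  have hshare : cs.reflectionRep (cs.wordProd γ)⁻¹ (M.simpleRoot k) ∈
      cs.braidRoots i j (β ++ k :: i :: γ) := by
    refine ⟨M.simpleRoot i, by simp, ?_⟩
    rw [cs.wordProd_append, cs.wordProd_cons, cs.wordProd_cons]
    simp only [mul_inv_rev, inv_simple, reflectionRep_mul_apply, reflectionRep_simple, hβinv]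
    rw [M.simpleReflection_of_eq_three hki3, map_add, M.simpleReflection_self,
      M.simpleReflection_of_eq_three hik3]
    simp
  rcases hw.braidRoots_eq_or_disjoint hM hij3 hik3 hr hr' with h | h
  -- If the triples coincided, the root of the last i would lie in the first one. But β k i γ sends
  -- that root to -(α_i + β α_k), whose i-th coordinate is negative, and the first triple to
  -- positive vectors.
  · have h1 : cs.reflectionRep (cs.wordProd γ)⁻¹ (M.simpleRoot i) ∈
        cs.braidRoots i j (β ++ k :: i :: γ) := by
      rw [h]; exact ⟨_, by simp, rfl⟩
    obtain ⟨r, hr1, hr2⟩ := h1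
    have hr3 : r = -(M.simpleRoot i + cs.reflectionRep (cs.wordProd β) (M.simpleRoot k)) := by
      have h2 := congrArg (cs.reflectionRep (cs.wordProd (β ++ k :: i :: γ))) hr2
      rw [reflectionRep_apply_inv_self, ← reflectionRep_mul_apply, cs.wordProd_append,
        cs.wordProd_cons, cs.wordProd_cons] at h2
      simp only [mul_assoc, mul_inv_cancel, mul_one] at h2
      rw [reflectionRep_mul_apply, reflectionRep_mul_apply, reflectionRep_simple,
        reflectionRep_simple, M.simpleReflection_self, map_neg,
        M.simpleReflection_of_eq_three hki3, map_neg, map_add,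
        reflectionRep_simpleRoot_of_trace_eq_nil hβ] at h2
      rw [h2, add_comm]
    have hpos : 0 ≤ cs.reflectionRep (cs.wordProd β) (M.simpleRoot k) :=
      CoxeterSystem.reflectionRep_nonneg hM
        (IsReduced.not_isRightDescent (hr.1.of_isInfix ⟨α ++ [i, j, i], i :: γ, by simp⟩))
    have h4 : 0 ≤ r := by
      simp only [Set.mem_insert_iff, Set.mem_singleton_iff] at hr1
      rcases hr1 with rfl | rfl | rfl
      · exact M.simpleRoot_nonneg _
      · exact M.simpleRoot_nonneg _
      · exact add_nonneg (M.simpleRoot_nonneg _) (M.simpleRoot_nonneg _)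
    have h5 := h4 i
    have h6 := hpos i
    rw [hr3] at h5
    simp only [Finsupp.coe_zero, Pi.zero_apply, Finsupp.coe_neg, Finsupp.coe_add, Pi.neg_apply,
      Pi.add_apply, M.simpleRoot_self_apply] at h5 h6
    linarith
  · exact Set.disjoint_left.1 h hshare ⟨_, by simp, rfl⟩

/-- In a reduced word of a freely braided element, long braids are not nested. -/
theorem IsFreelyBraided.not_mem_reducedExpressions_nested (hM : M.SimplyLaced) {w : W}
    (hw : cs.IsFreelyBraided w) {α γ : List B} {l h k : B}
    (hlh : M.coxeterGraph.Adj l h) (hhk : M.coxeterGraph.Adj h k) (hlk : M l k = 2) :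
    α ++ (l :: h :: k :: h :: l :: γ) ∉ cs.reducedExpressions w := by
  intro hr
  have hkl : M k l = 2 := by rw [M.symmetric]; exact hlk
  have hhk3 := hM.eq_three hhk
  have hkh3 := hM.eq_three_symm hhk
  have hlh3 := hM.eq_three hlh
  have h1 : (α ++ [l]) ++ (k :: h :: k :: (l :: γ)) ∈ cs.reducedExpressions w := by
    have e : α ++ (l :: h :: k :: h :: l :: γ) = (α ++ [l]) ++ (h :: k :: h :: (l :: γ)) := by simp
    rw [e] at hr
    exact ⟨hr.1.braid hhk3, by rw [← hr.2, wordProd_braid hhk3]⟩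
  -- After the inner braid move, l k h k l is commutation equivalent to k l h l k, which exhibits a
  -- braid on l and h.
  have hc : M.CommEquiv ((α ++ [l]) ++ (k :: h :: k :: (l :: γ)))
      ((α ++ [k]) ++ (l :: h :: l :: (k :: γ))) := by
    have e1 := CoxeterMatrix.CommEquiv.swap hlk (h :: k :: l :: γ)
    have e2 := (((CoxeterMatrix.CommEquiv.swap hkl γ).cons h).cons l).cons k
    simpa using (e1.trans e2).append_left α
  have h2 : (α ++ [k]) ++ (l :: h :: l :: (k :: γ)) ∈ cs.reducedExpressions w :=
    ⟨h1.1.congr_commEquiv hc, by rw [← hc.wordProd_eq cs, h1.2]⟩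
  have hne1 := hlh.ne
  have hne2 := hhk.ne
  have hne3 : l ≠ k := M.ne_of_eq_two hlk
  rcases hw.braidRoots_eq_or_disjoint hM hkh3 hlh3 h1 h2 with hd | hd
  -- The triples differ: s_k maps α_l, α_h and α_l + α_h to vectors involving α_l or α_h, hence
  -- never to α_k.
  · have hk : cs.reflectionRep (cs.wordProd (l :: γ))⁻¹ (M.simpleRoot k) ∈
        cs.braidRoots l h (k :: γ) := by
      rw [← hd]; exact ⟨_, by simp, rfl⟩
    obtain ⟨r, hr1, hr2⟩ := hk
    rw [cs.wordProd_cons, cs.wordProd_cons] at hr2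
    simp only [mul_inv_rev, inv_simple, reflectionRep_mul_apply, reflectionRep_simple] at hr2
    rw [(reflectionRep_injective _).eq_iff, M.simpleReflection_of_eq_two hlk] at hr2
    simp only [Set.mem_insert_iff, Set.mem_singleton_iff] at hr1
    rcases hr1 with rfl | rfl | rfl
    · rw [M.simpleReflection_of_eq_two hkl] at hr2
      have := DFunLike.congr_fun hr2 l
      simp [M.simpleRoot_self_apply, M.simpleRoot_apply_of_ne, hne3.symm] at this
    · rw [M.simpleReflection_of_eq_three hkh3] at hr2
      have := DFunLike.congr_fun hr2 h
      simp [M.simpleRoot_self_apply, M.simpleRoot_apply_of_ne, hne2.symm] at this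
    · rw [map_add, M.simpleReflection_of_eq_two hkl, M.simpleReflection_of_eq_three hkh3] at hr2
      have := DFunLike.congr_fun hr2 l
      simp [M.simpleRoot_self_apply, M.simpleRoot_apply_of_ne, hne3.symm, hne1.symm] at this
  -- The triples meet in the image of α_l + α_k + α_h, the middle root of both braids.
  · refine Set.disjoint_left.1 hd (?_ : cs.reflectionRep (cs.wordProd γ)⁻¹
      (M.simpleRoot l + M.simpleRoot k + M.simpleRoot h) ∈ _) ?_
    · refine ⟨M.simpleRoot k + M.simpleRoot h, by simp, ?_⟩
      rw [cs.wordProd_cons]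
      simp only [mul_inv_rev, inv_simple, reflectionRep_mul_apply, reflectionRep_simple]
      rw [map_add (M.simpleReflection l), M.simpleReflection_of_eq_two hlk,
        M.simpleReflection_of_eq_three hlh3]
      congr 1
      abel
    · refine ⟨M.simpleRoot l + M.simpleRoot h, by simp, ?_⟩
      rw [cs.wordProd_cons]
      simp only [mul_inv_rev, inv_simple, reflectionRep_mul_apply, reflectionRep_simple]
      rw [map_add (M.simpleReflection k), M.simpleReflection_of_eq_two hkl,
        M.simpleReflection_of_eq_three hkh3]
      congr 1
      abel

variable (cs) in
/-- A reduced word is overlap-free if no reduced word of the same element has long braids that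
share an outer letter, or nested long braids. -/
structure OverlapFree (ω : List B) : Prop where
  isReduced : cs.IsReduced ω
  not_shared : ∀ {α β γ : List B} {i j k : B}, M.coxeterGraph.Adj i j → M.coxeterGraph.Adj i k →
    M.coxeterGraph.trace i β = [] →
    α ++ (i :: j :: i :: (β ++ k :: i :: γ)) ∉ cs.reducedExpressions (cs.wordProd ω)
  not_nested : ∀ {α γ : List B} {l h k : B}, M.coxeterGraph.Adj l h → M.coxeterGraph.Adj h k →
    M l k = 2 →
    α ++ (l :: h :: k :: h :: l :: γ) ∉ cs.reducedExpressions (cs.wordProd ω)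

theorem IsFreelyBraided.overlapFree (hM : M.SimplyLaced) {w : W} (hw : cs.IsFreelyBraided w)
    {ω : List B} (hω : ω ∈ cs.reducedExpressions w) : cs.OverlapFree ω := by
  obtain ⟨hr, rfl⟩ := hω
  exact ⟨hr, hw.not_mem_reducedExpressions hM, hw.not_mem_reducedExpressions_nested hM⟩

namespace OverlapFree

theorem congr {ω ω' : List B} (h : cs.OverlapFree ω)
    (h' : ω' ∈ cs.reducedExpressions (cs.wordProd ω)) : cs.OverlapFree ω' :=
  ⟨h'.1, by rw [h'.2]; exact h.not_shared, by rw [h'.2]; exact h.not_nested⟩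

theorem congr_commEquiv {ω ω' : List B} (h : cs.OverlapFree ω) (hc : M.CommEquiv ω ω') :
    cs.OverlapFree ω' :=
  h.congr ⟨h.isReduced.congr_commEquiv hc, (hc.wordProd_eq cs).symm⟩

theorem braid (hM : M.SimplyLaced) {α β : List B} {i j : B} (hij : M.coxeterGraph.Adj i j)
    (h : cs.OverlapFree (α ++ (i :: j :: i :: β))) :
    cs.OverlapFree (α ++ (j :: i :: j :: β)) :=
  h.congr ⟨h.isReduced.braid (hM.eq_three hij), (wordProd_braid (hM.eq_three hij) α β).symm⟩

/-- Replacing a factor by another reduced word of the same element keeps the whole word reduced, so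
an overlap in the factor gives one in the whole word. -/
theorem of_isInfix {ω ω' : List B} (h : cs.OverlapFree ω) (hi : ω' <:+: ω) : cs.OverlapFree ω' := by
  have hr := h.isReduced.of_isInfix hi
  obtain ⟨s, t, rfl⟩ := hi
  have key : ∀ ρ ∈ cs.reducedExpressions (cs.wordProd ω'),
      s ++ ρ ++ t ∈ cs.reducedExpressions (cs.wordProd (s ++ ω' ++ t)) := by
    intro ρ hρ
    have hπ : cs.wordProd (s ++ ρ ++ t) = cs.wordProd (s ++ ω' ++ t) := by
      rw [cs.wordProd_append, cs.wordProd_append, cs.wordProd_append, cs.wordProd_append, hρ.2]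
    have hl : ρ.length = ω'.length := by rw [← hρ.1.eq, hρ.2, hr.eq]
    exact ⟨isReduced_of_eq h.isReduced hπ (by simp [hl]), hπ⟩
  refine ⟨hr, fun {α β γ i j k} h1 h2 h3 h4 => ?_, fun {α γ l m k} h1 h2 h3 h4 => ?_⟩
  · exact h.not_shared (α := s ++ α) (γ := γ ++ t) h1 h2 h3 (by simpa using key _ h4)
  · exact h.not_nested (α := s ++ α) (γ := γ ++ t) h1 h2 h3 (by simpa using key _ h4)

theorem not_shared_self {α β γ : List B} {i j k : B} (hij : M.coxeterGraph.Adj i j)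
    (hik : M.coxeterGraph.Adj i k) (hβ : M.coxeterGraph.trace i β = []) :
    ¬cs.OverlapFree (α ++ (i :: j :: i :: (β ++ k :: i :: γ))) :=
  fun h => h.not_shared hij hik hβ ⟨h.isReduced, rfl⟩

theorem not_nested_self {α γ : List B} {l h k : B} (hlh : M.coxeterGraph.Adj l h)
    (hhk : M.coxeterGraph.Adj h k) (hlk : M l k = 2) :
    ¬cs.OverlapFree (α ++ (l :: h :: k :: h :: l :: γ)) :=
  fun h => h.not_nested hlh hhk hlk ⟨h.isReduced, rfl⟩

end OverlapFree

end CoxeterSystem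

/-! ### Deleting the letters that start a braid -/

namespace SimpleGraph

set_option linter.unusedSectionVars false

variable {V : Type*} [DecidableEq V] (G : SimpleGraph V) [DecidableRel G.Adj]

/-- In the word `i :: ω`, exactly one neighbour of `i` separates the first letter from the next
occurrence of `i`. -/
def StartsBraid (i : V) (ω : List V) : Prop := [false, true] <+: G.trace i ω

instance (i : V) (ω : List V) : Decidable (G.StartsBraid i ω) :=
  inferInstanceAs (Decidable (_ <+: _))

/-- Delete from a word, which is followed by the word `ρ`, all letters that start a braid. -/
def prune (ρ : List V) : List V → List V
  | [] => []
  | i :: ω => if G.StartsBraid i (ω ++ ρ) then prune ρ ω else i :: prune ρ ω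

variable {G}

theorem prune_append (ρ α β : List V) :
    G.prune ρ (α ++ β) = G.prune (β ++ ρ) α ++ G.prune ρ β := by
  induction α with
  | nil => rfl
  | cons i α ih =>
    simp only [List.cons_append, prune, ih, List.append_assoc]
    split_ifs <;> rfl

theorem prune_cons_of_startsBraid {ρ ω : List V} {i : V} (h : G.StartsBraid i (ω ++ ρ)) :
    G.prune ρ (i :: ω) = G.prune ρ ω := by simp [prune, h]

theorem prune_cons_of_not_startsBraid {ρ ω : List V} {i : V} (h : ¬G.StartsBraid i (ω ++ ρ)) :
    G.prune ρ (i :: ω) = i :: G.prune ρ ω := by simp [prune, h]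

/-- Locates a retained letter in the original word; the letters before it are pruned with regard to
the unpruned remainder. -/
theorem exists_of_prune_eq {ρ ω α' γ' : List V} {i : V} (h : G.prune ρ ω = α' ++ i :: γ') :
    ∃ α γ, ω = α ++ i :: γ ∧ G.prune (i :: γ ++ ρ) α = α' ∧ ¬G.StartsBraid i (γ ++ ρ) := by
  induction ω generalizing α' with
  | nil => simp [prune] at h
  | cons k ω ih =>
    by_cases hk : G.StartsBraid k (ω ++ ρ)
    · rw [prune_cons_of_startsBraid hk] at h
      obtain ⟨α, γ, rfl, h1, h2⟩ := ih h
      refine ⟨k :: α, γ, rfl, ?_, h2⟩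
      rw [prune_cons_of_startsBraid (by simpa using hk), h1]
    · rw [prune_cons_of_not_startsBraid hk] at h
      rcases α' with _ | ⟨l, α'⟩
      · simp only [List.nil_append, List.cons.injEq] at h
        obtain ⟨rfl, -⟩ := h
        exact ⟨[], ω, rfl, rfl, hk⟩
      · simp only [List.cons_append, List.cons.injEq] at h
        obtain ⟨rfl, h⟩ := h
        obtain ⟨α, γ, rfl, h1, h2⟩ := ih h
        refine ⟨k :: α, γ, rfl, ?_, h2⟩
        rw [prune_cons_of_not_startsBraid (by simpa using hk), h1]

/-- Compares two continuations of a word: if every neighbour deleted before `ρ'` is also deleted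
before `ρ`, fewer survive before `ρ`. -/
theorem nbrCount_prune_mono {i : V} {ρ ρ' ω : List V}
    (h : ∀ α g γ, ω = α ++ g :: γ → G.Adj i g → G.StartsBraid g (γ ++ ρ') →
      G.StartsBraid g (γ ++ ρ)) :
    G.nbrCount i (G.prune ρ ω) ≤ G.nbrCount i (G.prune ρ' ω) := by
  induction ω with
  | nil => rfl
  | cons k ω ih =>
    have ih' := ih fun α g γ e => h (k :: α) g γ (by rw [e]; rfl)
    have hk := h [] k ω rfl
    simp only [prune]
    by_cases hadj : G.Adj i k
    · split_ifs with h1 h2 h2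
      · exact ih'
      · rw [nbrCount_cons_of_adj hadj]; omega
      · exact absurd (hk hadj h2) h1
      · rw [nbrCount_cons_of_adj hadj, nbrCount_cons_of_adj hadj]; omega
    · split_ifs <;> simpa [nbrCount_cons_of_not_adj hadj] using ih'

theorem nbrCount_prune_pos {i h : V} {ρ α β : List V} (hadj : G.Adj i h)
    (hb : ¬G.StartsBraid h (β ++ ρ)) :
    G.nbrCount i (G.prune (h :: β ++ ρ) α) + 1 ≤ G.nbrCount i (G.prune ρ (α ++ h :: β)) := by
  rw [prune_append, prune_cons_of_not_startsBraid hb, nbrCount_append, nbrCount_cons_of_adj hadj]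
  omega

theorem exists_last_nbr {i : V} {β : List V} (hi : i ∉ β) (h : 1 ≤ G.nbrCount i β) :
    ∃ α k γ, β = α ++ k :: γ ∧ G.Adj i k ∧ G.trace i γ = [] := by
  induction β with
  | nil => simp [nbrCount] at h
  | cons k β ih =>
    have hi' : i ∉ β := fun h' => hi (List.mem_cons_of_mem _ h')
    by_cases h0 : 1 ≤ G.nbrCount i β
    · obtain ⟨α, l, γ, rfl, h1, h2⟩ := ih hi' h0
      exact ⟨k :: α, l, γ, rfl, h1, h2⟩
    · have h1 : G.nbrCount i β = 0 := by omega
      refine ⟨[], k, β, rfl, ?_, by rw [trace_of_notMem hi', h1]; rfl⟩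
      by_contra hadj
      rw [nbrCount_cons_of_not_adj hadj, h1] at h
      omega

theorem notMem_of_trace_eq_nil {i : V} {β : List V} (h : G.trace i β = []) : i ∉ β :=
  fun hi => (trace_eq_nil_iff.1 h i hi).1 rfl

theorem notMem_of_trace_eq_nil_of_adj {i k : V} {β : List V} (h : G.trace i β = [])
    (hadj : G.Adj i k) : k ∉ β :=
  fun hk => (trace_eq_nil_iff.1 h k hk).2 hadj

theorem trace_eq_nil_of_nbrCount {i : V} {β : List V} (hi : i ∉ β) (h : G.nbrCount i β = 0) :
    G.trace i β = [] := by rw [trace_of_notMem hi, h]; rfl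

theorem StartsBraid.exists_eq {i : V} {ω : List V} (h : G.StartsBraid i ω) :
    ∃ L, G.trace i ω = false :: true :: L := by
  obtain ⟨L, hL⟩ := h
  exact ⟨L, by rw [← hL]; rfl⟩

theorem startsBraid_of_eq {i : V} {ω : List V} {L : List Bool}
    (h : G.trace i ω = false :: true :: L) : G.StartsBraid i ω := ⟨L, by rw [h]; rfl⟩

theorem StartsBraid.append {i : V} {ω : List V} (h : G.StartsBraid i ω) (ρ : List V) :
    G.StartsBraid i (ω ++ ρ) := by
  rw [StartsBraid, trace_append]
  exact h.trans (List.prefix_append _ _)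

/-- A braid that starts at `h` and is not completed before the neighbour `i` of `h` has this `i` as
its middle letter. -/
theorem trace_eq_nil_of_startsBraid {h i : V} {β γ : List V} (hadj : G.Adj i h)
    (h1 : G.StartsBraid h (β ++ i :: γ)) (h2 : ¬G.StartsBraid h β) :
    G.trace h β = [] ∧ ∃ L, G.trace h γ = true :: L := by
  obtain ⟨L, hL⟩ := h1.exists_eq
  rw [trace_append, trace_cons_of_adj hadj.symm] at hL
  rcases hβ : G.trace h β with _ | ⟨x, _ | ⟨y, t⟩⟩
  · rw [hβ] at hL
    simp only [List.nil_append, List.cons.injEq, true_and] at hL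
    exact ⟨rfl, L, hL⟩
  · simp [hβ] at hL
  · rw [hβ] at hL
    simp only [List.cons_append, List.cons.injEq] at hL
    obtain ⟨rfl, rfl, -⟩ := hL
    exact absurd (startsBraid_of_eq hβ) h2

theorem not_startsBraid_of_notMem {h : V} {β : List V} (hβ : h ∉ β) : ¬G.StartsBraid h β := by
  intro hb
  obtain ⟨L, hL⟩ := hb.exists_eq
  exact hβ (mem_of_true_mem_trace (G := G) (by rw [hL]; simp))

theorem BraidFree.cons {i : V} {ω : List V} (h : G.BraidFree ω)
    (hi : ∀ β γ, ω = β ++ i :: γ → i ∉ β → 2 ≤ G.nbrCount i β) : G.BraidFree (i :: ω) := by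
  refine braidFree_of_two_le fun α k β γ e hk => ?_
  rcases α with _ | ⟨l, α⟩
  · simp only [List.nil_append, List.cons.injEq] at e
    obtain ⟨rfl, e⟩ := e
    exact hi β γ e hk
  · simp only [List.cons_append, List.cons.injEq] at e
    obtain ⟨rfl, rfl⟩ := e
    exact h.two_le hk

end SimpleGraph

/-! ### Pruned overlap-free words are braid-free -/

namespace CoxeterSystem

set_option linter.unusedSectionVars false

variable {B : Type*} {M : CoxeterMatrix B} {W : Type*} [Group W] {cs : CoxeterSystem M W}

open SimpleGraph CoxeterMatrix

theorem not_isReduced_cons_cons (i : B) (α β : List B) : ¬cs.IsReduced (α ++ i :: i :: β) := by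
  intro h
  have := (h.of_isInfix (ω' := [i, i]) ⟨α, β, by simp⟩).eq
  simp [cs.wordProd_cons] at this

theorem not_isReduced_alternating {i j : B} (h : M i j = 3) (α β : List B) :
    ¬cs.IsReduced (α ++ i :: j :: i :: j :: β) := fun hr =>
  not_isReduced_cons_cons j (α ++ [j, i]) β (by simpa using hr.braid h)

variable [DecidableEq B] [DecidableRel M.coxeterGraph.Adj]

theorem exists_commEquiv_of_trace {i : B} {ω : List B} {L : List Bool}
    (h : M.coxeterGraph.trace i ω = false :: true :: L) :
    ∃ β j ρ, M.coxeterGraph.Adj i j ∧ M.coxeterGraph.trace i β = [] ∧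
      M.coxeterGraph.trace i ρ = L ∧ M.CommEquiv ω (β ++ j :: i :: ρ) := by
  obtain ⟨β, j, γ, rfl, hβ, hj, hγ⟩ := trace_eq_false_cons h
  obtain ⟨δ, ε, rfl, hδ, hε⟩ := trace_eq_true_cons hγ
  refine ⟨β, j, δ ++ ε, hj, hβ, by simp [hδ, hε], ?_⟩
  exact (((CommEquiv.cons_append hδ ε).symm).cons j).append_left β

namespace OverlapFree

theorem trace_ne_true_cons {i : B} {ω : List B} (h : cs.OverlapFree (i :: ω)) (L : List Bool) :
    M.coxeterGraph.trace i ω ≠ true :: L := by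
  intro hL
  obtain ⟨ρ, hρ⟩ := CommEquiv.exists_cons hL
  exact not_isReduced_cons_cons i [] ρ (h.congr_commEquiv (hρ.cons i)).isReduced

/-- The i that closes one braid would open another, and commutations would bring the word to the
excluded form with a shared outer letter. -/
theorem trace_ne_of_startsBraid {i : B} {ω : List B} (h : cs.OverlapFree (i :: ω))
    (L : List Bool) : M.coxeterGraph.trace i ω ≠ false :: true :: false :: true :: L := by
  intro hL
  obtain ⟨β, j, ρ, hj, hβ, hρ, hc⟩ := exists_commEquiv_of_trace hL
  obtain ⟨β', k, ρ', hk, hβ', -, hc'⟩ := exists_commEquiv_of_trace hρ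
  have e1 : M.CommEquiv (i :: ω) (β ++ i :: j :: i :: (β' ++ k :: i :: ρ')) :=
    (hc.cons i).trans ((CommEquiv.cons_append hβ _).trans
      ((((hc'.cons i).cons j).cons i).append_left β))
  exact not_shared_self hj hk hβ' (h.congr_commEquiv e1)

/-- A deleted i is paired with the next i, which closes its braid. That one is retained, since
otherwise two braids would share it. -/
theorem count_le {ω : List B} (h : cs.OverlapFree ω) (i : B) :
    ω.count i ≤ 2 * (M.coxeterGraph.prune [] ω).count i := by
  obtain ⟨n, hn⟩ : ∃ n, ω.length = n := ⟨_, rfl⟩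
  induction n using Nat.strong_induction_on generalizing ω with
  | _ n ih =>
  rcases ω with _ | ⟨k, ω⟩
  · simp
  have hω := h.of_isInfix (List.suffix_cons k ω).isInfix
  have ih' := ih ω.length (by simp at hn; omega) hω rfl
  by_cases hk : k = i
  · subst hk
    by_cases hb : M.coxeterGraph.StartsBraid k (ω ++ [])
    · rw [prune_cons_of_startsBraid hb]
      rw [List.append_nil] at hb
      obtain ⟨L, hL⟩ := hb.exists_eq
      obtain ⟨β, j, γ, rfl, hβ, hj, hγ⟩ := trace_eq_false_cons hL
      obtain ⟨δ, ε, rfl, hδ, hε⟩ := trace_eq_true_cons hγ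
      have hb2 : ¬M.coxeterGraph.StartsBraid k (ε ++ []) := by
        intro hb2
        rw [List.append_nil] at hb2
        obtain ⟨L', hL'⟩ := hb2.exists_eq
        rw [← hε, hL'] at hL
        exact h.trace_ne_of_startsBraid _ hL
      have e : β ++ j :: (δ ++ k :: ε) = (β ++ j :: δ) ++ k :: ε := by simp
      have ihε := ih ε.length (by simp at hn; omega)
        (hω.of_isInfix ⟨β ++ j :: (δ ++ [k]), [], by simp⟩) rfl
      have h0 : (β ++ j :: δ).count k = 0 := by
        rw [List.count_eq_zero]
        simp [notMem_of_trace_eq_nil hβ, notMem_of_trace_eq_nil hδ, hj.ne]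
      simp only [e, prune_append, prune_cons_of_not_startsBraid hb2, List.count_cons_self,
        List.count_append] at h0 ⊢
      omega
    · rw [prune_cons_of_not_startsBraid hb, List.count_cons_self, List.count_cons_self]
      omega
  · rw [List.count_cons_of_ne hk, prune]
    split_ifs
    · exact ih'
    · rwa [List.count_cons_of_ne hk]

theorem length_le {ω : List B} (h : cs.OverlapFree ω) :
    ω.length ≤ 2 * (M.coxeterGraph.prune [] ω).length := by
  have : (ω : Multiset B) ≤ 2 • (M.coxeterGraph.prune [] ω : Multiset B) := by
    rw [Multiset.le_iff_count]
    intro i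
    rw [Multiset.count_nsmul, Multiset.coe_count, Multiset.coe_count]
    exact h.count_le i
  simpa using Multiset.card_le_card this

/-- The middle letter of a braid is not pruned. -/
theorem middle_not_startsBraid (hM : M.SimplyLaced) {i k : B} {α β γ : List B}
    (h : cs.OverlapFree (i :: (α ++ k :: (β ++ i :: γ)))) (hk : M.coxeterGraph.Adj i k)
    (hα : M.coxeterGraph.trace i α = []) (hβ : M.coxeterGraph.trace i β = []) :
    ¬M.coxeterGraph.StartsBraid k (β ++ i :: γ) := by
  -- Otherwise the closing i is the middle of a braid of k, and commutations produce the nonreduced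
  -- factor i k i k.
  intro hb
  obtain ⟨h1, L, h2⟩ := trace_eq_nil_of_startsBraid hk hb
    (not_startsBraid_of_notMem (notMem_of_trace_eq_nil_of_adj hβ hk))
  obtain ⟨γ', hγ'⟩ := CommEquiv.exists_cons h2
  have e1 : M.CommEquiv (i :: (α ++ k :: (β ++ i :: γ))) (α ++ i :: k :: i :: (β ++ k :: γ')) := by
    refine (CommEquiv.cons_append hα _).trans (CommEquiv.append_left α
      (.cons i (.cons k ?_)))
    exact ((CommEquiv.cons_append hβ γ).symm).trans (.cons i (hγ'.append_left β))
  have e2 : M.CommEquiv (α ++ i :: k :: i :: (β ++ k :: γ'))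
      (α ++ i :: k :: i :: k :: (β ++ γ')) :=
    CommEquiv.append_left α (.cons i (.cons k (.cons i (CommEquiv.cons_append h1 γ').symm)))
  exact not_isReduced_alternating (hM.eq_three hk) _ _
    (h.congr_commEquiv (e1.trans e2)).isReduced

/-- The last neighbour of `i` before a braid with outer letters `i` is not pruned. -/
theorem last_nbr_not_startsBraid (hM : M.SimplyLaced) {i k : B} {β γ : List B}
    (h : cs.OverlapFree (k :: (β ++ i :: γ))) (hk : M.coxeterGraph.Adj i k)
    (hβ : M.coxeterGraph.trace i β = []) (hγ : M.coxeterGraph.StartsBraid i γ) :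
    ¬M.coxeterGraph.StartsBraid k (β ++ i :: γ) := by
  -- Here commutations would produce the nonreduced factor k i k i.
  intro hb
  obtain ⟨h1, L, h2⟩ := trace_eq_nil_of_startsBraid hk hb
    (not_startsBraid_of_notMem (notMem_of_trace_eq_nil_of_adj hβ hk))
  obtain ⟨γ', hγ'⟩ := CommEquiv.exists_cons h2
  obtain ⟨L', hL'⟩ := hγ.exists_eq
  rw [hγ'.trace_eq, trace_cons_of_adj hk, List.cons.injEq] at hL'
  obtain ⟨γ'', hγ''⟩ := CommEquiv.exists_cons hL'.2
  have e1 : M.CommEquiv (k :: (β ++ i :: γ)) (β ++ k :: i :: k :: i :: γ'') :=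
    (CommEquiv.cons_append h1 _).trans (CommEquiv.append_left β (.cons k (.cons i
      (hγ'.trans (.cons k hγ'')))))
  exact not_isReduced_alternating (hM.eq_three_symm hk) _ _ (h.congr_commEquiv e1).isReduced

/-- At most one neighbour of `i` starts a braid whose middle letter is a given occurrence of `i`. -/
theorem trace_ne_nil_of_common_middle (hM : M.SimplyLaced) {i g h : B} {α β γ : List B}
    (ho : cs.OverlapFree (g :: (α ++ h :: (β ++ i :: γ)))) (hg : M.coxeterGraph.Adj i g)
    (hh : M.coxeterGraph.Adj i h) (h1 : M.coxeterGraph.trace g (α ++ h :: β) = [])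
    (h2 : M.coxeterGraph.trace h β = []) {L L' : List Bool}
    (h3 : M.coxeterGraph.trace g γ = true :: L) (h4 : M.coxeterGraph.trace h γ = true :: L') :
    False := by
  have hgh := trace_eq_nil_iff.1 h1 h (by simp)
  obtain ⟨γ', hγ'⟩ := CommEquiv.exists_cons h3
  rw [hγ'.trace_eq, trace_cons_of_not_adj hgh.1.symm (fun h' => hgh.2 h'.symm)] at h4
  obtain ⟨γ'', hγ''⟩ := CommEquiv.exists_cons h4
  have e1 : M.CommEquiv (g :: (α ++ h :: (β ++ i :: γ)))
      ((α ++ h :: β) ++ g :: i :: γ) := by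
    simpa using CommEquiv.cons_append h1 (i :: γ)
  have e2 : M.CommEquiv ((α ++ h :: β) ++ g :: i :: γ)
      ((α ++ β ++ [h]) ++ g :: i :: g :: h :: γ'') := by
    have := (CommEquiv.cons_append h2 (g :: i :: γ)).trans
      (CommEquiv.append_left β (.cons h (.cons g (.cons i (hγ'.trans (.cons g hγ''))))))
    simpa using this.append_left α
  -- The word now contains h g i g h. Braiding the inner part gives h i g i h, a nested pair,
  -- because g and h commute.
  have h5 := (ho.congr_commEquiv (e1.trans e2)).braid hM hg.symm
  rw [show α ++ β ++ [h] ++ i :: g :: i :: h :: γ'' = α ++ β ++ h :: i :: g :: i :: h :: γ''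
    by simp] at h5
  refine not_nested_self hh.symm hg ?_ h5
  rw [M.symmetric]
  exact M.eq_two_of_not_adj hgh.1.symm hgh.2

/-- The case where no braid of a neighbour of i straddles the closing i. The last neighbour k in the
gap then survives, because k does not recur after it inside the gap; the work is to find a second
survivor. -/
theorem two_le_nbrCount_prune_of_inner {i : B} {β γ : List B}
    (h : cs.OverlapFree (i :: (β ++ i :: γ))) (hi : i ∉ β)
    (h2 : 2 ≤ M.coxeterGraph.nbrCount i β)
    (hinner : ∀ α g δ, β = α ++ g :: δ → M.coxeterGraph.Adj i g →
      M.coxeterGraph.StartsBraid g (δ ++ i :: γ) → M.coxeterGraph.StartsBraid g δ) :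
    2 ≤ M.coxeterGraph.nbrCount i (M.coxeterGraph.prune (i :: γ) β) := by
  obtain ⟨α, k, b, rfl, hk, hb⟩ := exists_last_nbr (G := M.coxeterGraph) hi (by omega)
  have hkb : ¬M.coxeterGraph.StartsBraid k (b ++ i :: γ) := fun hs =>
    not_startsBraid_of_notMem (notMem_of_trace_eq_nil_of_adj hb hk) (hinner _ _ _ rfl hk hs)
  refine le_trans ?_ (nbrCount_prune_pos hk hkb)
  have hib : i ∉ b := notMem_of_trace_eq_nil hb
  have hiα : i ∉ α := fun h' => hi (by simp [h'])
  have hbn : M.coxeterGraph.nbrCount i b = 0 := by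
    rw [trace_of_notMem hib] at hb; simpa using hb
  rw [nbrCount_append, nbrCount_cons_of_adj hk, hbn] at h2
  obtain ⟨α, g, c, rfl, hg, hc⟩ := exists_last_nbr (G := M.coxeterGraph) hiα (by omega)
  have hkc : k ∉ c := notMem_of_trace_eq_nil_of_adj hc hk
  suffices 1 ≤ M.coxeterGraph.nbrCount i
      (M.coxeterGraph.prune (k :: b ++ i :: γ) (α ++ g :: c)) by omega
  -- If the last neighbour but one, g, is deleted, its braid closes inside the gap. The only
  -- neighbour of i left there is k, so g = k.
  by_cases hgs : M.coxeterGraph.StartsBraid g (c ++ (k :: b ++ i :: γ))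
  swap
  · exact le_trans (by omega) (nbrCount_prune_pos hg hgs)
  have hgs' := hinner α g (c ++ k :: b) (by simp) hg (by simpa using hgs)
  have hgk : g = k := by
    by_contra hgk
    refine not_startsBraid_of_notMem ?_ hgs'
    simp [hgk, notMem_of_trace_eq_nil_of_adj hc hg, notMem_of_trace_eq_nil_of_adj hb hg]
  subst hgk
  obtain ⟨L, hL⟩ := hgs'.exists_eq
  obtain ⟨c1, l, ρ, e1, hc1, hl, hρ⟩ := trace_eq_false_cons hL
  have hLb := hL
  rw [trace_append, trace_cons_self, trace_of_notMem hkc] at hLb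
  have hn1 : M.coxeterGraph.nbrCount g c = 1 := by
    generalize M.coxeterGraph.nbrCount g c = n at hLb
    rcases n with _ | _ | n
    · simp at hLb
    · rfl
    · simp [List.replicate_succ] at hLb
  have hcT : M.coxeterGraph.trace g c = [false] := by rw [trace_of_notMem hkc, hn1]; rfl
  have hbT : M.coxeterGraph.trace g b = L := by
    rw [hn1] at hLb
    simpa using hLb
  -- The last two neighbours now form a braid g l g. A preceding neighbour f of i survives:
  -- otherwise f = g by the same reason, and two braids would share the middle g.
  by_cases hα0 : 1 ≤ M.coxeterGraph.nbrCount i α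
  · have hiα' : i ∉ α := fun h' => hi (by simp [h'])
    obtain ⟨α, f, e, rfl, hf, he⟩ := exists_last_nbr (G := M.coxeterGraph) hiα' hα0
    by_cases hfs : M.coxeterGraph.StartsBraid f (e ++ (g :: c ++ (g :: b ++ i :: γ)))
    · exfalso
      have hfs' := hinner α f (e ++ g :: c ++ g :: b) (by simp) hf (by simpa using hfs)
      have hfg : f = g := by
        by_contra hfg
        refine not_startsBraid_of_notMem ?_ hfs'
        simp [hfg, notMem_of_trace_eq_nil_of_adj hc hf, notMem_of_trace_eq_nil_of_adj hb hf,
          notMem_of_trace_eq_nil_of_adj he hf]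
      subst hfg
      obtain ⟨L', hL'⟩ := hfs'.exists_eq
      have hfe : f ∉ e := notMem_of_trace_eq_nil_of_adj he hf
      have heT : M.coxeterGraph.trace f e = [false] := by
        rw [trace_of_notMem hfe] at *
        simp only [trace_append, trace_of_notMem hfe, trace_cons_self, List.append_assoc,
          List.cons_append] at hL'
        generalize M.coxeterGraph.nbrCount f e = n at *
        rcases n with _ | _ | n
        · simp at hL'
        · rfl
        · simp [List.replicate_succ] at hL'
      have ho : cs.OverlapFree (f :: (e ++ f :: (c ++ f :: (b ++ i :: γ)))) :=
        h.of_isInfix ⟨i :: α, [], by simp⟩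
      refine ho.trace_ne_of_startsBraid (M.coxeterGraph.trace f (b ++ i :: γ)) ?_
      simp [heT, hcT]
    · rw [prune_append]
      rw [nbrCount_append]
      have := nbrCount_prune_pos (α := α) hf hfs
      omega
  -- Without a third neighbour, commutations contract the gap to i g l g i, which is a nested pair
  -- as l commutes with i.
  · exfalso
    have hαT : M.coxeterGraph.trace i α = [] :=
      trace_eq_nil_of_nbrCount (fun h' => hi (by simp [h'])) (by omega)
    obtain ⟨c1, l, c2, rfl, hc1, hl, hc2⟩ := trace_eq_false_cons hcT
    have hil := trace_eq_nil_iff.1 hc l (by simp)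
    simp only [trace_append, List.append_eq_nil_iff] at hc
    have hc2i : M.coxeterGraph.trace i c2 = [] := by
      have := hc.2
      rwa [trace_cons_of_not_adj hil.1 hil.2] at this
    have e1 : M.CommEquiv (i :: ((α ++ g :: (c1 ++ l :: c2)) ++ g :: b ++ i :: γ))
        (α ++ i :: g :: (c1 ++ l :: (c2 ++ g :: (b ++ i :: γ)))) := by
      simpa using CommEquiv.cons_append hαT (g :: (c1 ++ l :: (c2 ++ g :: (b ++ i :: γ))))
    have e2 : M.CommEquiv (i :: g :: (c1 ++ l :: (c2 ++ g :: (b ++ i :: γ))))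
        (i :: (c1 ++ g :: l :: g :: i :: (c2 ++ (b ++ γ)))) := by
      refine .cons i ((CommEquiv.cons_append hc1 _).trans (CommEquiv.append_left c1
        (.cons g (.cons l ?_))))
      refine ((CommEquiv.cons_append hc2 _).symm).trans (.cons g ?_)
      have : M.coxeterGraph.trace i (c2 ++ b) = [] := by simp [hc2i, hb]
      simpa using (CommEquiv.cons_append this γ).symm
    have e3 := CommEquiv.append_left α (e2.trans (CommEquiv.cons_append hc.1 _))
    have h5 := h.congr_commEquiv (e1.trans e3)
    rw [← List.append_assoc] at h5
    exact not_nested_self hg hl (M.eq_two_of_not_adj hil.1.symm hil.2) h5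

/-- If a neighbour k has a braid k i k straddling the closing i, turn it into i k i. The gap then
becomes `a ++ b`, without k, and its end can be cut off so that the previous lemma applies. As k is
deleted anyway, survivors in the new gap have to be compared with those in the old one. -/
theorem two_le_nbrCount_prune (hM : M.SimplyLaced) {i : B} {β γ : List B}
    (h : cs.OverlapFree (i :: (β ++ i :: γ))) (hi : i ∉ β)
    (h2 : 2 ≤ M.coxeterGraph.nbrCount i β) :
    2 ≤ M.coxeterGraph.nbrCount i (M.coxeterGraph.prune (i :: γ) β) := by
  by_cases hinner : ∀ α g δ, β = α ++ g :: δ → M.coxeterGraph.Adj i g →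
      M.coxeterGraph.StartsBraid g (δ ++ i :: γ) → M.coxeterGraph.StartsBraid g δ
  · exact two_le_nbrCount_prune_of_inner h hi h2 hinner
  push Not at hinner
  obtain ⟨a, k, b, rfl, hk, hs, hs'⟩ := hinner
  obtain ⟨hkb, L, hkγ⟩ := trace_eq_nil_of_startsBraid hk hs hs'
  obtain ⟨γ', hγ'⟩ := CommEquiv.exists_cons hkγ
  have hiab : i ∉ a ++ b := by
    intro h'; apply hi; simp only [List.mem_append, List.mem_cons] at h' ⊢; tauto
  have ho : cs.OverlapFree (i :: ((a ++ b) ++ i :: k :: i :: γ')) := by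
    have e : M.CommEquiv (i :: (a ++ k :: b ++ i :: γ)) ((i :: (a ++ b)) ++ k :: i :: k :: γ') := by
      have := (CommEquiv.cons_append hkb (i :: γ)).trans
        (CommEquiv.append_left b (.cons k (.cons i hγ')))
      simpa using this.append_left (i :: a)
    exact (h.congr_commEquiv e).braid hM hk.symm
  -- With only one neighbour u left in the gap, the braids i u i and i k i would share the middle i.
  have hab : 2 ≤ M.coxeterGraph.nbrCount i (a ++ b) := by
    rw [nbrCount_append, nbrCount_cons_of_adj hk] at h2
    by_contra hlt
    have h1 : M.coxeterGraph.nbrCount i (a ++ b) = 1 := by rw [nbrCount_append] at hlt ⊢; omega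
    obtain ⟨c, u, d, e, hu, hd⟩ := exists_last_nbr (G := M.coxeterGraph) hiab h1.ge
    rw [e] at h1 hiab ho
    have hcT : M.coxeterGraph.trace i c = [] := by
      refine trace_eq_nil_of_nbrCount (fun h' => hiab (by simp [h'])) ?_
      rw [nbrCount_append, nbrCount_cons_of_adj hu] at h1
      omega
    have e1 : M.CommEquiv (i :: ((c ++ u :: d) ++ i :: k :: i :: γ'))
        (c ++ i :: u :: i :: (d ++ k :: i :: γ')) := by
      have := (CommEquiv.cons_append hcT (u :: (d ++ i :: k :: i :: γ'))).trans
        (CommEquiv.append_left c (.cons i (.cons u (CommEquiv.cons_append hd _).symm)))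
      simpa using this
    exact not_shared_self hu hk hd (ho.congr_commEquiv e1)
  have hsing : ∀ (g : B) (δ : List B), M.coxeterGraph.Adj i g →
      M.coxeterGraph.StartsBraid g (δ ++ [i]) → M.coxeterGraph.StartsBraid g δ := by
    intro g δ hg hgs
    by_contra hn
    obtain ⟨-, L, hL⟩ := trace_eq_nil_of_startsBraid hg hgs hn
    simp at hL
  have h3 := two_le_nbrCount_prune_of_inner (γ := [])
    (ho.of_isInfix ⟨[], k :: i :: γ', by simp⟩) hiab hab (fun α g δ _ => hsing g δ)
  refine h3.trans ?_
  rw [prune_append, prune_append, prune_cons_of_startsBraid hs, nbrCount_append, nbrCount_append]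
  -- A neighbour g deleted from the old gap is deleted from the new one. Its braid does not have the
  -- closing i as middle, for that is the middle of the braid of k. The omitted k is irrelevant to
  -- it: if k closed it, two braids would share k; if k were its middle, g would recur in b, which
  -- contains no neighbour of k.
  refine add_le_add (nbrCount_prune_mono fun a1 g a2 e hg hgs => ?_)
    (nbrCount_prune_mono fun b1 g b2 e hg hgs => ?_)
  · subst e
    have ho2 : cs.OverlapFree (g :: (a2 ++ k :: (b ++ i :: γ))) :=
      h.of_isInfix ⟨i :: a1, [], by simp⟩
    have hgs2 : M.coxeterGraph.StartsBraid g (a2 ++ k :: b) := by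
      by_contra hn
      obtain ⟨h4, L', h5⟩ := trace_eq_nil_of_startsBraid (γ := γ) hg (by simpa using hgs) hn
      exact ho2.trace_ne_nil_of_common_middle hM hg hk h4 hkb h5 hkγ
    rw [← List.append_assoc]
    apply StartsBraid.append
    obtain ⟨L', hL'⟩ := hgs2.exists_eq
    by_cases hgk : g = k
    · subst hgk
      rw [trace_append, trace_cons_self, hkb] at hL'
      rcases hT : M.coxeterGraph.trace g a2 with _ | ⟨x, _ | ⟨y, t⟩⟩ <;> rw [hT] at hL'
      · simp at hL'
      · exfalso
        simp only [List.cons_append, List.nil_append, List.cons.injEq] at hL'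
        refine ho2.trace_ne_of_startsBraid L ?_
        simp [hT, hL'.1, hkb, trace_cons_of_adj hg.symm, hkγ]
      · simp only [List.cons_append, List.cons.injEq] at hL'
        exact StartsBraid.append (startsBraid_of_eq (by rw [hT, hL'.1, hL'.2.1])) _
    · by_cases hadj : M.coxeterGraph.Adj g k
      · rw [trace_append, trace_cons_of_adj hadj] at hL'
        rcases hT : M.coxeterGraph.trace g a2 with _ | ⟨x, _ | ⟨y, t⟩⟩ <;> rw [hT] at hL'
        · exfalso
          simp only [List.nil_append, List.cons.injEq, true_and] at hL'
          exact notMem_of_trace_eq_nil_of_adj hkb hadj.symm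
            (mem_of_true_mem_trace (G := M.coxeterGraph) (by rw [hL']; simp))
        · simp at hL'
        · simp only [List.cons_append, List.cons.injEq] at hL'
          exact StartsBraid.append (startsBraid_of_eq (by rw [hT, hL'.1, hL'.2.1])) _
      · refine startsBraid_of_eq (L := L') ?_
        rw [← hL', trace_append, trace_append, trace_cons_of_not_adj (Ne.symm hgk) hadj]
  · subst e
    apply StartsBraid.append
    by_contra hn
    obtain ⟨h4, L', h5⟩ := trace_eq_nil_of_startsBraid hg hgs hn
    have ho2 : cs.OverlapFree (k :: (b1 ++ g :: (b2 ++ i :: γ))) :=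
      h.of_isInfix ⟨i :: a, [], by simp⟩
    exact ho2.trace_ne_nil_of_common_middle hM hk hg hkb h4 hkγ h5

/-- Deleting the letters that start a braid turns an overlap-free word into a braid-free one. -/
theorem braidFree_prune (hM : M.SimplyLaced) {ω : List B} (h : cs.OverlapFree ω) :
    M.coxeterGraph.BraidFree (M.coxeterGraph.prune [] ω) := by
  induction ω with
  | nil => simp [prune, BraidFree]
  | cons i ω ih =>
    have hω := h.of_isInfix (List.suffix_cons i ω).isInfix
    by_cases hs : M.coxeterGraph.StartsBraid i (ω ++ [])
    · rw [prune_cons_of_startsBraid hs]; exact ih hω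
    rw [prune_cons_of_not_startsBraid hs]
    rw [List.append_nil] at hs
    refine (ih hω).cons fun β' γ' e hi' => ?_
    obtain ⟨β, γ, rfl, hβ', hγ⟩ := exists_of_prune_eq e
    simp only [List.append_nil] at hβ' hγ
    subst hβ'
    -- Deleted occurrences of i may lie between the two retained ones. There is then exactly one;
    -- the last neighbour before it and the middle of its braid are the two required survivors.
    by_cases hi : i ∈ β
    · obtain ⟨β1, β2, rfl, hi1⟩ := List.eq_append_cons_of_mem hi
      have ho2 : cs.OverlapFree (i :: (β2 ++ i :: γ)) :=
        h.of_isInfix ⟨i :: β1, [], by simp⟩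
      have hs2 : M.coxeterGraph.StartsBraid i (β2 ++ i :: γ) := by
        by_contra hs2
        rw [prune_append, prune_cons_of_not_startsBraid hs2] at hi'
        simp at hi'
      rw [prune_append, prune_cons_of_startsBraid hs2, nbrCount_append]
      have h1 : 1 ≤ M.coxeterGraph.nbrCount i
          (M.coxeterGraph.prune (i :: β2 ++ i :: γ) β1) := by
        have h0 : 1 ≤ M.coxeterGraph.nbrCount i β1 := by
          by_contra h0
          refine h.trace_ne_true_cons (M.coxeterGraph.trace i (β2 ++ i :: γ)) ?_
          simp [trace_eq_nil_of_nbrCount (G := M.coxeterGraph) hi1 (by omega)]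
        obtain ⟨a, k, b, rfl, hk, hb⟩ := exists_last_nbr (G := M.coxeterGraph) hi1 h0
        have := last_nbr_not_startsBraid hM (γ := β2 ++ i :: γ)
          (h.of_isInfix ⟨i :: a, [], by simp⟩) hk hb hs2
        exact le_trans (by omega) (nbrCount_prune_pos hk this)
      have h2 : 1 ≤ M.coxeterGraph.nbrCount i (M.coxeterGraph.prune (i :: γ) β2) := by
        obtain ⟨L, hL⟩ := hs2.exists_eq
        -- A second deleted i would close one braid and open the next.
        have hi2 : i ∉ β2 := by
          intro hi2
          obtain ⟨β3, β4, rfl, hi3⟩ := List.eq_append_cons_of_mem hi2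
          have hs4 : M.coxeterGraph.StartsBraid i (β4 ++ i :: γ) := by
            by_contra hs4
            rw [prune_append, prune_cons_of_startsBraid hs2, prune_append,
              prune_cons_of_not_startsBraid hs4] at hi'
            simp at hi'
          obtain ⟨L', hL'⟩ := hs4.exists_eq
          rw [List.append_assoc, List.cons_append, trace_append, trace_cons_self, hL',
            trace_of_notMem hi3] at hL
          refine ho2.trace_ne_of_startsBraid L' ?_
          rw [List.append_assoc, List.cons_append, trace_append, trace_cons_self, hL',
            trace_of_notMem hi3]
          generalize M.coxeterGraph.nbrCount i β3 = n at *
          rcases n with _ | _ | n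
          · simp at hL
          · rfl
          · simp [List.replicate_succ] at hL
        obtain ⟨a, k, b, rfl, hk, hb⟩ := exists_last_nbr (G := M.coxeterGraph) hi2 (by
          by_contra h0
          refine ho2.trace_ne_true_cons (M.coxeterGraph.trace i γ) ?_
          simp [trace_eq_nil_of_nbrCount (G := M.coxeterGraph) hi2 (by omega)])
        have ha : M.coxeterGraph.trace i a = [] := by
          have hia : i ∉ a := fun h' => hi2 (by simp [h'])
          rw [trace_append, trace_append, trace_cons_of_adj hk, trace_cons_self, hb,
            trace_of_notMem hia] at hL
          rw [trace_of_notMem hia]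
          generalize M.coxeterGraph.nbrCount i a = n at *
          rcases n with _ | n
          · rfl
          · rcases n with _ | n <;> simp [List.replicate_succ] at hL
        have := middle_not_startsBraid hM (α := a) (β := b) (by simpa using ho2) hk ha hb
        exact le_trans (by omega) (nbrCount_prune_pos hk this)
      exact add_le_add h1 h2
    · refine two_le_nbrCount_prune hM h hi ?_
      by_contra hlt
      have : M.coxeterGraph.trace i (β ++ i :: γ) =
          List.replicate (M.coxeterGraph.nbrCount i β) false ++
            true :: M.coxeterGraph.trace i γ := by
        rw [trace_append, trace_cons_self, trace_of_notMem hi]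
      obtain h0 | h1 : M.coxeterGraph.nbrCount i β = 0 ∨ M.coxeterGraph.nbrCount i β = 1 := by
        omega
      · rw [h0] at this
        exact h.trace_ne_true_cons _ this
      · rw [h1] at this
        exact hs (startsBraid_of_eq this)

end OverlapFree

end CoxeterSystem

/-! ### Comparing the multiplicities of two letters -/

section ListCount

variable {α : Type*} [DecidableEq α]

theorem List.exists_consecutive_of_two_le_count {y : α} {ω : List α} (h : 2 ≤ ω.count y) :
    ∃ a β γ, ω = a ++ y :: (β ++ y :: γ) ∧ y ∉ β := by
  obtain ⟨a, ρ, rfl, ha⟩ := List.eq_append_cons_of_mem (List.count_pos_iff.1 (by omega : 0 < ω.count y))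
  rw [List.count_append, List.count_cons_self, List.count_eq_zero.2 ha] at h
  obtain ⟨β, γ, rfl, hβ⟩ := List.eq_append_cons_of_mem
    (List.count_pos_iff.1 (by omega : 0 < ρ.count y))
  exact ⟨a, β, γ, rfl, hβ⟩

/-- The occurrences of x cut the word into `ω.count x + 1` pieces, each containing y at most once.
-/
theorem List.count_le_count_add_one {x y : α} (hxy : x ≠ y) {ω : List α}
    (h : ∀ β, β <:+: ω → x ∉ β → β.count y ≤ 1) : ω.count y ≤ ω.count x + 1 := by
  obtain ⟨n, hn⟩ : ∃ n, ω.length = n := ⟨_, rfl⟩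
  induction n using Nat.strong_induction_on generalizing ω with
  | _ n ih =>
  by_cases hx : x ∈ ω
  · obtain ⟨β, γ, rfl, hβ⟩ := List.eq_append_cons_of_mem hx
    have h1 := h β (List.prefix_append _ _).isInfix hβ
    have h2 := ih γ.length (by simp at hn; omega)
      (fun δ hδ => h δ (hδ.trans ⟨β ++ [x], [], by simp⟩)) rfl
    rw [List.count_append, List.count_append, List.count_cons_of_ne hxy, List.count_cons_self]
    omega
  · exact (h ω List.infix_rfl hx).trans (by omega)

end ListCount

/-! ### Braid-free words on the infinite tree of type E -/

namespace SimpleGraph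

theorem two_le_nbrCount_of_two_le_count {V : Type*} [DecidableEq V] {G : SimpleGraph V}
    [DecidableRel G.Adj] {ω : List V} (h : G.BraidFree ω) {i : V} (h2 : 2 ≤ ω.count i) :
    2 ≤ G.nbrCount i ω := by
  obtain ⟨a, β, γ, rfl, hi⟩ := List.exists_consecutive_of_two_le_count h2
  refine (h.two_le hi).trans ?_
  simp only [nbrCount, List.countP_append, List.countP_cons]
  omega

/-- The graph on `ℕ` that consists of the infinite path `1 - 2 - 3 - ⋯` and of the vertex `0`, which
is joined to `3` only. -/
def infiniteE : SimpleGraph ℕ where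
  Adj i j := (i = 0 ∧ j = 3) ∨ (i = 3 ∧ j = 0) ∨ (1 ≤ i ∧ j = i + 1) ∨ (1 ≤ j ∧ i = j + 1)
  symm := ⟨fun i j h => by omega⟩
  loopless := ⟨fun i h => by omega⟩

theorem infiniteE_adj {i j : ℕ} : infiniteE.Adj i j ↔
    (i = 0 ∧ j = 3) ∨ (i = 3 ∧ j = 0) ∨ (1 ≤ i ∧ j = i + 1) ∨ (1 ≤ j ∧ i = j + 1) := Iff.rfl

instance : DecidableRel infiniteE.Adj := fun _ _ => inferInstanceAs (Decidable (_ ∨ _))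

namespace infiniteE

theorem nbrCount_zero (β : List ℕ) : infiniteE.nbrCount 0 β = β.count 3 := by
  refine List.countP_congr fun x _ => ?_
  simp [infiniteE_adj]

theorem nbrCount_one (β : List ℕ) : infiniteE.nbrCount 1 β = β.count 2 := by
  refine List.countP_congr fun x _ => ?_
  simp [infiniteE_adj]
  omega

theorem nbrCount_two (β : List ℕ) : infiniteE.nbrCount 2 β = β.count 1 + β.count 3 := by
  induction β with
  | nil => rfl
  | cons x β ih =>
    have h : infiniteE.Adj 2 x ↔ x = 1 ∨ x = 3 := by rw [infiniteE_adj]; omega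
    simp only [nbrCount, List.countP_cons, List.count_cons, h, decide_eq_true_eq,
      beq_iff_eq] at ih ⊢
    rw [ih]
    split_ifs <;> omega

theorem nbrCount_three (β : List ℕ) :
    infiniteE.nbrCount 3 β = β.count 0 + β.count 2 + β.count 4 := by
  induction β with
  | nil => rfl
  | cons x β ih =>
    have h : infiniteE.Adj 3 x ↔ x = 0 ∨ x = 2 ∨ x = 4 := by rw [infiniteE_adj]; omega
    simp only [nbrCount, List.countP_cons, List.count_cons, h, decide_eq_true_eq,
      beq_iff_eq] at ih ⊢
    rw [ih]
    split_ifs <;> omega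

theorem nbrCount_succ {v : ℕ} (hv : 3 ≤ v) (β : List ℕ) :
    infiniteE.nbrCount (v + 1) β = β.count v + β.count (v + 2) := by
  induction β with
  | nil => rfl
  | cons x β ih =>
    have h : infiniteE.Adj (v + 1) x ↔ x = v ∨ x = v + 2 := by rw [infiniteE_adj]; omega
    simp only [nbrCount, List.countP_cons, List.count_cons, h, decide_eq_true_eq,
      beq_iff_eq] at ih ⊢
    rw [ih]
    split_ifs <;> omega

variable {ω : List ℕ} {m : ℕ}

/-- Induction from the far end of the arm. Two consecutive letters v + 1 with no v between them need
two letters v + 2 between them; but v + 1 is absent from that gap, so v + 2 occurs at most once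
there. -/
theorem count_succ_le_one (h : infiniteE.BraidFree ω) (hm : ∀ x ∈ ω, x ≤ m) {v : ℕ} (hv : 3 ≤ v)
    (hvω : v ∉ ω) : ω.count (v + 1) ≤ 1 := by
  obtain ⟨d, hd⟩ : ∃ d, m - v = d := ⟨_, rfl⟩
  induction d generalizing v ω with
  | zero =>
    rw [List.count_eq_zero.2 fun h' => by have := hm _ h'; omega]
    omega
  | succ d ih =>
    by_contra hc
    obtain ⟨a, β, γ, rfl, hβ⟩ := List.exists_consecutive_of_two_le_count 
        (y := v + 1) (ω := ω) (by omega)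
    have h1 := h.two_le hβ
    rw [nbrCount_succ hv, List.count_eq_zero.2 fun h' => hvω (by simp [h'])] at h1
    have : β.count (v + 2) ≤ 1 := ih (h.of_isInfix ⟨a ++ [v + 1], (v + 1) :: γ, by simp⟩)
      (fun x hx => hm x (by simp [hx])) (by omega : 3 ≤ v + 1) hβ (by omega)
    omega

theorem count_zero_le_one (h : infiniteE.BraidFree ω) (hω : 3 ∉ ω) : ω.count 0 ≤ 1 := by
  by_contra hc
  have := two_le_nbrCount_of_two_le_count h (i := 0) (by omega)
  rw [nbrCount_zero, List.count_eq_zero.2 hω] at this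
  omega

theorem count_one_le_one (h : infiniteE.BraidFree ω) (hω : 2 ∉ ω) : ω.count 1 ≤ 1 := by
  by_contra hc
  have := two_le_nbrCount_of_two_le_count h (i := 1) (by omega)
  rw [nbrCount_one, List.count_eq_zero.2 hω] at this
  omega

theorem count_two_le_one (h : infiniteE.BraidFree ω) (hω : 3 ∉ ω) : ω.count 2 ≤ 1 := by
  by_contra hc
  obtain ⟨a, β, γ, rfl, hβ⟩ := List.exists_consecutive_of_two_le_count 
        (y := 2) (ω := ω) (by omega)
  have h1 := h.two_le hβ
  have h3 : β.count 3 = 0 := List.count_eq_zero.2 fun h' => hω (by simp [h'])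
  rw [nbrCount_two] at h1
  have := count_one_le_one (h.of_isInfix (ω := _) (α := β) ⟨a ++ [2], 2 :: γ, by simp⟩) hβ
  omega

/-- Every inner gap between consecutive occurrences of the branch vertex contains the first vertex
of the long arm. -/
theorem four_mem_of_gaps {β₁ β₂ β₃ : List ℕ}
    (h : infiniteE.BraidFree (3 :: (β₁ ++ 3 :: (β₂ ++ 3 :: (β₃ ++ [3])))))
    (h1 : 3 ∉ β₁) (h2 : 3 ∉ β₂) (h3 : 3 ∉ β₃) : 4 ∈ β₂ := by
  by_contra h4
  obtain ⟨m, hm⟩ : ∃ m, ∀ x ∈ 3 :: (β₁ ++ 3 :: (β₂ ++ 3 :: (β₃ ++ [3]))), x ≤ m :=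
    ⟨_, fun x hx => List.le_sum_of_mem hx⟩
  have f1 : infiniteE.BraidFree β₁ := h.of_isInfix ⟨[3], 3 :: (β₂ ++ 3 :: (β₃ ++ [3])), by simp⟩
  have f2 : infiniteE.BraidFree β₂ := h.of_isInfix ⟨3 :: (β₁ ++ [3]), 3 :: (β₃ ++ [3]), by simp⟩
  have f3 : infiniteE.BraidFree β₃ :=
    h.of_isInfix ⟨3 :: (β₁ ++ 3 :: (β₂ ++ [3])), [3], by simp⟩
  have n1 := h.two_le (α := []) h1
  have n2 := h.two_le (α := 3 :: β₁) h2
  have n3 := (h.of_isInfix ⟨3 :: β₁, [], by simp⟩ : infiniteE.BraidFree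
    (3 :: (β₂ ++ 3 :: (β₃ ++ [3])))).two_le (α := 3 :: β₂) (γ := []) h3
  rw [nbrCount_three] at n1 n2 n3
  have c4 := List.count_eq_zero.2 h4
  have z2 := count_zero_le_one f2 h2
  have t1 := count_two_le_one f1 h1
  have t2 := count_two_le_one f2 h2
  have t3 := count_two_le_one f3 h3
  have q1 := count_succ_le_one f1 (fun x hx => hm x (by simp [hx])) le_rfl h1
  have q3 := count_succ_le_one f3 (fun x hx => hm x (by simp [hx])) le_rfl h3
  have z1 : β₁.count 0 = 0 := by
    by_contra hne
    have g : infiniteE.BraidFree (β₁ ++ 3 :: β₂) :=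
      h.of_isInfix ⟨[3], 3 :: (β₃ ++ [3]), by simp⟩
    have := two_le_nbrCount_of_two_le_count g (i := 0)
      (by rw [List.count_append, List.count_cons_of_ne (by omega)]; omega)
    rw [nbrCount_zero, List.count_append, List.count_cons_self, List.count_eq_zero.2 h1,
      List.count_eq_zero.2 h2] at this
    omega
  have z3 : β₃.count 0 = 0 := by
    by_contra hne
    have g : infiniteE.BraidFree (β₂ ++ 3 :: β₃) :=
      h.of_isInfix ⟨3 :: (β₁ ++ [3]), [3], by simp⟩
    have := two_le_nbrCount_of_two_le_count g (i := 0)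
      (by rw [List.count_append, List.count_cons_of_ne (by omega)]; omega)
    rw [nbrCount_zero, List.count_append, List.count_cons_self, List.count_eq_zero.2 h2,
      List.count_eq_zero.2 h3] at this
    omega
  norm_num at q1 q3
  obtain ⟨a, a', rfl, -⟩ := List.eq_append_cons_of_mem
    (List.count_pos_iff.1 (by omega : 0 < β₁.count 2))
  obtain ⟨b, b', rfl, -⟩ := List.eq_append_cons_of_mem
    (List.count_pos_iff.1 (by omega : 0 < β₂.count 2))
  obtain ⟨c, c', rfl, -⟩ := List.eq_append_cons_of_mem
    (List.count_pos_iff.1 (by omega : 0 < β₃.count 2))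
  rw [List.count_append, List.count_cons_self] at t1 t2 t3
  simp only [List.mem_append, List.mem_cons, not_or] at h1 h2 h3
  have g1 : infiniteE.BraidFree ((3 :: a) ++ 2 :: ((a' ++ 3 :: b) ++
      2 :: ((b' ++ 3 :: c) ++ 2 :: (c' ++ [3])))) := by simpa using h
  have m1 : 2 ∉ a' := List.count_eq_zero.1 (by omega)
  have m2 : 2 ∉ b := List.count_eq_zero.1 (by omega)
  have m3 : 2 ∉ b' := List.count_eq_zero.1 (by omega)
  have m4 : 2 ∉ c := List.count_eq_zero.1 (by omega)
  have w1 := g1.two_le (by simp [m1, m2])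
  have w2 := (g1.of_isInfix ⟨3 :: (a ++ 2 :: (a' ++ 3 :: b)), [], by simp⟩ : infiniteE.BraidFree
    ([] ++ 2 :: ((b' ++ 3 :: c) ++ 2 :: (c' ++ [3])))).two_le
      (by simp [m3, m4])
  rw [nbrCount_two] at w1 w2
  have g2 : infiniteE.BraidFree ((a' ++ 3 :: b) ++ 2 :: (b' ++ 3 :: c)) :=
    g1.of_isInfix ⟨3 :: (a ++ [2]), 2 :: (c' ++ [3]), by simp⟩
  have e3 : (a' ++ 3 :: b).count 3 = 1 ∧ (b' ++ 3 :: c).count 3 = 1 := by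
    have k1 := List.count_eq_zero.2 h1.2.2
    have k2 := List.count_eq_zero.2 h2.1
    have k3 := List.count_eq_zero.2 h2.2.2
    have k4 := List.count_eq_zero.2 h3.1
    rw [List.count_append, List.count_append, List.count_cons_self, List.count_cons_self]
    omega
  have := two_le_nbrCount_of_two_le_count g2 (i := 1)
    (by rw [List.count_append, List.count_cons_of_ne (by omega)]; omega)
  rw [nbrCount_one] at this
  simp only [List.count_append, List.count_cons_self, List.count_cons_of_ne
    (show (3 : ℕ) ≠ 2 by omega)] at this
  omega

theorem count_succ_le_of_gaps (h : infiniteE.BraidFree ω) (hm : ∀ x ∈ ω, x ≤ m) {v : ℕ}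
    (hv : 3 ≤ v)
    (hg : ∀ β, (v + 1) :: (β ++ [v + 1]) <:+: ω → v + 1 ∉ β → β.count v ≤ 1) :
    ω.count (v + 1) ≤ m - v := by
  obtain ⟨d, hd⟩ : ∃ d, m - v = d := ⟨_, rfl⟩
  induction d generalizing v with
  | zero =>
    rw [List.count_eq_zero.2 fun h' => by have := hm _ h'; omega]
    omega
  | succ d ih =>
    have hsep : ∀ β, β <:+: ω → v + 2 ∉ β → β.count (v + 1) ≤ 1 := by
      intro β hβ hvβ
      by_contra hc
      obtain ⟨a, δ, γ, rfl, hδ⟩ := List.exists_consecutive_of_two_le_count 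
        (y := v + 1) (ω := β) (by omega)
      have h1 := (h.of_isInfix hβ).two_le hδ
      have h2 := hg δ (List.IsInfix.trans ⟨a, γ, by simp⟩ hβ) hδ
      have h3 : δ.count (v + 2) = 0 := List.count_eq_zero.2 fun h' => hvβ (by simp [h'])
      rw [nbrCount_succ hv] at h1
      omega
    have h1 := List.count_le_count_add_one (by omega : v + 2 ≠ v + 1) hsep
    have h2 := ih (v := v + 1) (by omega) (fun β hβ hvβ =>
      hsep β (List.IsInfix.trans ⟨[v + 2], [v + 2], by simp⟩ hβ) hvβ) (by omega)
    have e : v + 1 + 1 = v + 2 := rfl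
    rw [e] at h2
    omega

theorem count_three_le (h : infiniteE.BraidFree ω) (hm : ∀ x ∈ ω, x ≤ m) :
    ω.count 3 ≤ m + 2 := by
  by_contra hc
  obtain ⟨a, ρ, rfl, ha⟩ := List.eq_append_cons_of_mem
    (List.count_pos_iff.1 (by omega : 0 < ω.count 3))
  rw [List.count_append, List.count_cons_self, List.count_eq_zero.2 ha] at hc
  obtain ⟨σ, γ, rfl, hγ⟩ : ∃ σ γ, ρ = σ ++ 3 :: γ ∧ 3 ∉ γ := by
    have h3 : 3 ∈ ρ.reverse := List.mem_reverse.2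
      (List.count_pos_iff.1 (by omega : 0 < ρ.count 3))
    obtain ⟨x, y, hxy, hx⟩ := List.eq_append_cons_of_mem h3
    exact ⟨y.reverse, x.reverse, by simpa using congrArg List.reverse hxy, by simpa using hx⟩
  rw [List.count_append, List.count_cons_self, List.count_eq_zero.2 hγ] at hc
  have h' : infiniteE.BraidFree (3 :: (σ ++ [3])) := h.of_isInfix ⟨a, γ, by simp⟩
  have hσ : infiniteE.BraidFree σ := h'.of_isInfix ⟨[3], [3], by simp⟩
  have hmσ : ∀ x ∈ σ, x ≤ m := fun x hx => hm x (by simp [hx])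
  have hsep : ∀ β, β <:+: σ → 4 ∉ β → β.count 3 ≤ 1 := by
    intro β hβ h4
    by_contra hc
    obtain ⟨b, δ, c, rfl, hδ⟩ := List.exists_consecutive_of_two_le_count 
        (y := 3) (ω := β) (by omega)
    obtain ⟨s, t, rfl⟩ := hβ
    obtain ⟨x, y, hxy, hx⟩ := List.eq_append_cons_of_mem
      (show 3 ∈ (3 :: (s ++ b)).reverse by simp)
    have hxy' : 3 :: (s ++ b) = y.reverse ++ 3 :: x.reverse := by
      simpa using congrArg List.reverse hxy
    obtain ⟨z, w, hzw, hz⟩ := List.eq_append_cons_of_mem (show 3 ∈ c ++ t ++ [3] by simp)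
    have e : 3 :: (s ++ (b ++ 3 :: (δ ++ 3 :: c)) ++ t ++ [3]) =
        y.reverse ++ (3 :: (x.reverse ++ 3 :: (δ ++ 3 :: (z ++ [3])))) ++ w := by
      calc _ = (3 :: (s ++ b)) ++ 3 :: (δ ++ 3 :: (c ++ t ++ [3])) := by simp
        _ = _ := by rw [hxy', hzw]; simp
    rw [e] at h'
    exact h4 (by simp [four_mem_of_gaps (h'.of_isInfix ⟨_, _, rfl⟩) (by simpa using hx) hδ hz])
  have h1 := List.count_le_count_add_one (by omega : 4 ≠ 3) hsep
  have h2 := count_succ_le_of_gaps hσ hmσ le_rfl fun β hβ h4 =>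
    hsep β (List.IsInfix.trans ⟨[3 + 1], [3 + 1], by simp⟩ hβ) h4
  have h3 := hm 3 (by simp)
  norm_num at h2
  omega

theorem count_le (h : infiniteE.BraidFree ω) (hm : ∀ x ∈ ω, x ≤ m) (k : ℕ) :
    ω.count k ≤ m + 5 + k := by
  have h3 := count_three_le h hm
  have h2 := List.count_le_count_add_one (x := 3) (y := 2) (ω := ω) (by omega) fun β hβ hx =>
    count_two_le_one (h.of_isInfix hβ) hx
  have h0 := List.count_le_count_add_one (x := 3) (y := 0) (ω := ω) (by omega) fun β hβ hx =>
    count_zero_le_one (h.of_isInfix hβ) hx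
  have h1 := List.count_le_count_add_one (x := 2) (y := 1) (ω := ω) (by omega) fun β hβ hx =>
    count_one_le_one (h.of_isInfix hβ) hx
  obtain hk | hk := Nat.lt_or_ge k 3
  · interval_cases k <;> omega
  · induction k, hk using Nat.le_induction with
    | base => omega
    | succ k hk ih =>
      have := List.count_le_count_add_one (x := k) (y := k + 1) (ω := ω) (by omega) fun β hβ hx =>
        count_succ_le_one (h.of_isInfix hβ) (fun x hx => hm x (hβ.subset hx)) hk hx
      omega

end infiniteE

section Transfer

variable {V : Type*} [DecidableEq V] {G : SimpleGraph V} [DecidableRel G.Adj]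

theorem count_true_trace (i : V) (ω : List V) : (G.trace i ω).count true = ω.count i := by
  induction ω with
  | nil => rfl
  | cons k ω ih =>
    by_cases hk : k = i
    · subst hk; simp [ih]
    · rw [List.count_cons_of_ne hk, ← ih]
      rcases trace_cons_of_ne (G := G) hk ω with h | h <;> simp [h]

/-- The counts of letters in a braid-free word are bounded on each union of components that embeds
into `infiniteE`. -/
theorem count_le_of_embedding {S : Set V} (hS : ∀ x ∈ S, ∀ y, G.Adj x y → y ∈ S) {f : S → ℕ}
    (hf : Function.Injective f) (hadj : ∀ x y : S, G.Adj x y ↔ infiniteE.Adj (f x) (f y))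
    {m : ℕ} (hm : ∀ x, f x ≤ m) {ω : List V} (h : G.BraidFree ω) (i : S) :
    ω.count (i : V) ≤ m + 5 + f i := by
  classical
  let g : V → Option ℕ := fun x => if hx : x ∈ S then some (f ⟨x, hx⟩) else none
  have key : ∀ (i : S) (ω : List V),
      infiniteE.trace (f i) (ω.filterMap g) = G.trace (i : V) ω := by
    intro i ω
    induction ω with
    | nil => rfl
    | cons y ω ih =>
      by_cases hy : y ∈ S
      · have hg : g y = some (f ⟨y, hy⟩) := by simp [g, hy]
        rw [List.filterMap_cons_some hg]
        by_cases hyi : y = i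
        · subst hyi
          rw [trace_cons_self, trace_cons_self, ih]
        · have hne : f ⟨y, hy⟩ ≠ f i := fun e => hyi (congrArg Subtype.val (hf e))
          by_cases ha : G.Adj i y
          · rw [trace_cons_of_adj ha, trace_cons_of_adj ((hadj i ⟨y, hy⟩).1 ha), ih]
          · rw [trace_cons_of_not_adj hyi ha,
              trace_cons_of_not_adj hne (fun h' => ha ((hadj i ⟨y, hy⟩).2 h')), ih]
      · have hg : g y = none := by simp [g, hy]
        rw [List.filterMap_cons_none hg, ih, trace_cons_of_not_adj]
        · rintro rfl; exact hy i.2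
        · exact fun ha => hy (hS _ i.2 _ ha)
  have hbf : infiniteE.BraidFree (ω.filterMap g) := by
    intro n
    by_cases hn : n ∈ ω.filterMap g
    · obtain ⟨x, -, hx⟩ := List.mem_filterMap.1 hn
      by_cases hxS : x ∈ S
      · simp only [g, hxS, dif_pos, Option.some.injEq] at hx
        rw [← hx, key]
        exact h x
      · simp [g, hxS] at hx
    · rw [trace_of_notMem hn]
      constructor <;> intro h' <;> have := h'.subset (List.mem_cons_self) <;>
        simp [List.mem_replicate] at this
  have hle : ∀ x ∈ ω.filterMap g, x ≤ m := by
    intro n hn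
    obtain ⟨x, -, hx⟩ := List.mem_filterMap.1 hn
    by_cases hxS : x ∈ S
    · simp only [g, hxS, dif_pos, Option.some.injEq] at hx
      rw [← hx]; exact hm _
    · simp [g, hxS] at hx
  have := infiniteE.count_le hbf hle (f i)
  rwa [← count_true_trace (G := infiniteE), key, count_true_trace] at this

end Transfer

end SimpleGraph

namespace SimpleGraph

set_option linter.unusedSectionVars false

variable {V : Type*} [DecidableEq V] (G : SimpleGraph V) [DecidableRel G.Adj]

/-- In the periodic word `u ++ u ++ ⋯`, any two consecutive occurrences of a letter are separated by
at least two of its neighbours. -/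
def Recurrent (u : List V) : Prop :=
  ∀ x i y, u = x ++ i :: y → ∃ β γ, y ++ u = β ++ i :: γ ∧ i ∉ β ∧ 2 ≤ G.nbrCount i β

variable {G}

theorem append_cons_eq_of_notMem {i : V} {β β' γ γ' : List V} (h : β ++ i :: γ = β' ++ i :: γ')
    (hβ : i ∉ β) (hβ' : i ∉ β') : β = β' := by
  induction β generalizing β' with
  | nil =>
    rcases β' with _ | ⟨k, β'⟩
    · rfl
    · simp only [List.nil_append, List.cons_append, List.cons.injEq] at h
      simp [h.1] at hβ'
  | cons k β ih =>
    rcases β' with _ | ⟨l, β'⟩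
    · simp only [List.nil_append, List.cons_append, List.cons.injEq] at h
      simp [h.1] at hβ
    · simp only [List.cons_append, List.cons.injEq] at h
      rw [h.1, ih h.2 (fun h' => hβ (by simp [h'])) (fun h' => hβ' (by simp [h']))]

theorem flatten_replicate_append (n : ℕ) (u : List V) :
    (List.replicate n u).flatten ++ u = u ++ (List.replicate n u).flatten := by
  induction n with
  | zero => simp
  | succ n ih => rw [List.replicate_succ, List.flatten_cons, List.append_assoc, ih]

theorem Recurrent.braidFree {u : List V} (h : G.Recurrent u) (n : ℕ) :
    G.BraidFree (List.replicate n u).flatten := by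
  induction n with
  | zero => simp [BraidFree]
  | succ n ih =>
    rw [List.replicate_succ, List.flatten_cons]
    have key : ∀ x y, u = x ++ y → G.BraidFree (y ++ (List.replicate n u).flatten) := by
      intro x y
      induction y generalizing x with
      | nil => intro; exact ih
      | cons i y ihy =>
        intro hu
        refine (ihy (x ++ [i]) (by simp [hu])).cons fun β γ e hi => ?_
        obtain ⟨β', γ', e', hi', h2⟩ := h x i y hu
        have : β = β' := by
          refine append_cons_eq_of_notMem (i := i) (γ := γ ++ u)
            (γ' := γ' ++ (List.replicate n u).flatten) ?_ hi hi'
          calc β ++ i :: (γ ++ u) = (y ++ (List.replicate n u).flatten) ++ u := by rw [e]; simp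
            _ = (y ++ u) ++ (List.replicate n u).flatten := by
              rw [List.append_assoc, flatten_replicate_append, List.append_assoc]
            _ = _ := by rw [e']; simp
        rwa [this]
    exact key [] u rfl

theorem Recurrent.eq_nil {u : List V} (h : G.Recurrent u) {N : ℕ}
    (hN : ∀ ω, G.BraidFree ω → ω.length ≤ N) : u = [] := by
  by_contra hu
  have h1 := hN _ (h.braidFree (N + 1))
  have h2 := List.length_pos_iff.2 hu
  simp only [List.length_flatten, List.map_replicate, List.sum_replicate, smul_eq_mul] at h1
  nlinarith

theorem Recurrent.map {V' : Type*} [DecidableEq V'] {G' : SimpleGraph V'} [DecidableRel G'.Adj]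
    {f : V' → V} (hf : Function.Injective f) (hadj : ∀ i j, G'.Adj i j → G.Adj (f i) (f j))
    {u : List V'} (h : G'.Recurrent u) : G.Recurrent (u.map f) := by
  intro x i y e
  obtain ⟨x', t, rfl, rfl, ht⟩ := List.map_eq_append_iff.1 e
  obtain ⟨i', y', rfl, rfl, rfl⟩ := List.map_eq_cons_iff.1 ht
  obtain ⟨β, γ, e', hi, h2⟩ := h x' i' y' rfl
  refine ⟨β.map f, γ.map f, ?_, ?_, ?_⟩
  · rw [← List.map_append, e']; simp
  · rwa [List.mem_map_of_injective hf]
  · refine h2.trans ?_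
    rw [nbrCount, nbrCount, List.countP_map]
    refine List.countP_mono_left fun k _ hk => ?_
    simpa using hadj _ _ (by simpa using hk)

theorem count_le_nbrCount {i k : V} (h : G.Adj i k) (β : List V) :
    β.count k ≤ G.nbrCount i β := by
  rw [nbrCount, List.count]
  refine List.countP_mono_left fun l _ hl => ?_
  have : l = k := by simpa using hl
  simpa [this] using h

/-- Going around a cycle. -/
theorem recurrent_of_cycle {u : List V} (hu : u.Nodup) (h3 : 3 ≤ u.length)
    (hc : (u ++ u).IsChain G.Adj) : G.Recurrent u := by
  rintro x i y rfl
  refine ⟨y ++ x, y, by simp, ?_, ?_⟩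
  · simp only [List.nodup_append, List.nodup_cons, List.mem_append, List.mem_cons] at hu ⊢
    intro h
    rcases h with h | h
    · exact hu.2.1.1 h
    · exact hu.2.2 i h i (by simp) rfl
  · have hc' : (i :: (y ++ x) ++ [i]).IsChain G.Adj :=
      hc.infix ⟨x, y, by simp⟩
    rcases hxy : y ++ x with _ | ⟨a, t⟩
    · have := congrArg List.length hxy
      simp only [List.length_append, List.length_cons, List.length_nil] at h3 this
      omega
    rcases List.eq_nil_or_concat t with rfl | ⟨t, b, rfl⟩
    · have := congrArg List.length hxy
      simp only [List.length_append, List.length_cons, List.length_nil] at h3 this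
      omega
    rw [hxy] at hc'
    have h1 : G.Adj i a := by simp at hc'; exact hc'.1
    have h2 : G.Adj b i := by
      have := hc'.infix (l₁ := [b, i]) ⟨i :: a :: t, [], by simp⟩
      simpa using this
    simp [nbrCount_cons_of_adj h1, nbrCount_append, nbrCount_cons_of_adj h2.symm]

theorem two_le_nbrCount_turn {i p q : V} {y : List V} (hp : y = [] → G.Adj i p ∧ G.Adj i q)
    (hy : (i :: y).IsChain G.Adj) : 2 ≤ G.nbrCount i (y ++ p :: q :: y.reverse) := by
  rcases y with _ | ⟨e, y⟩
  · simp [nbrCount_cons_of_adj (hp rfl).1, nbrCount_cons_of_adj (hp rfl).2]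
  · have h1 : G.Adj i e := by simp at hy; exact hy.1
    refine le_trans ?_ (count_le_nbrCount h1 _)
    simp only [List.count_append, List.count_cons_self, List.cons_append, List.reverse_cons,
      List.count_cons]
    omega

/-- Going back and forth along a path with two leaves attached to each of its ends. -/
theorem recurrent_of_two_forks {a a' c c' : V} {d : List V} (hn : (a :: a' :: c :: c' :: d).Nodup)
    (hd : d ≠ []) (hc : d.IsChain G.Adj) (h1 : ∀ y t, d = y :: t → G.Adj y a ∧ G.Adj y a')
    (h2 : ∀ y t, d = t ++ [y] → G.Adj y c ∧ G.Adj y c') :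
    G.Recurrent (a :: a' :: (d ++ c :: c' :: d.reverse)) := by
  obtain ⟨e, de, hde⟩ := List.exists_cons_of_ne_nil hd
  obtain ⟨f, df, hdf⟩ : ∃ f df, d = df ++ [f] := by
    rcases List.eq_nil_or_concat d with h | ⟨df, f, h⟩
    · exact absurd h hd
    · exact ⟨f, df, by simpa using h⟩
  have he := h1 e de hde
  have hf := h2 f df hdf
  have hem : 1 ≤ d.count e := List.one_le_count_iff.2 (by simp [hde])
  have hfm : 1 ≤ d.count f := List.one_le_count_iff.2 (by simp [hdf])
  simp only [List.nodup_cons, List.mem_cons, not_or] at hn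
  obtain ⟨⟨n1, n2, n3, n4⟩, ⟨n5, n6, n7⟩, ⟨n8, n9⟩, n10, n11⟩ := hn
  intro x i y hxy
  rcases x with _ | ⟨x0, x⟩
  · simp only [List.nil_append, List.cons.injEq] at hxy
    obtain ⟨rfl, rfl⟩ := hxy
    refine ⟨a' :: (d ++ c :: c' :: d.reverse), a' :: (d ++ c :: c' :: d.reverse), by simp,
      by simp [n1, n2, n3, n4], le_trans ?_ (count_le_nbrCount he.1.symm _)⟩
    simp only [List.count_append, List.count_cons, List.count_reverse]
    omega
  rcases x with _ | ⟨x1, x⟩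
  · simp only [List.cons_append, List.nil_append, List.cons.injEq] at hxy
    obtain ⟨rfl, rfl, rfl⟩ := hxy
    refine ⟨d ++ c :: c' :: d.reverse ++ [a], d ++ c :: c' :: d.reverse, by simp,
      by simp [Ne.symm n1, n5, n6, n7], le_trans ?_ (count_le_nbrCount he.2.symm _)⟩
    simp only [List.count_append, List.count_cons, List.count_reverse]
    omega
  simp only [List.cons_append, List.cons.injEq] at hxy
  obtain ⟨rfl, rfl, hxy⟩ := hxy
  rcases List.append_eq_append_iff.1 hxy with ⟨z, hx, hz⟩ | ⟨z, hx, hz⟩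
  · rcases z with _ | ⟨z0, z⟩
    · simp only [List.nil_append, List.cons.injEq] at hz
      obtain ⟨rfl, rfl⟩ := hz
      refine ⟨c' :: (d.reverse ++ a :: a' :: d), c' :: d.reverse, by simp,
        by simp [n8, n9, Ne.symm n2, Ne.symm n5], le_trans ?_
          (count_le_nbrCount hf.1.symm _)⟩
      simp only [List.count_append, List.count_cons, List.count_reverse]
      omega
    rcases z with _ | ⟨z1, z⟩
    · simp only [List.cons_append, List.nil_append, List.cons.injEq] at hz
      obtain ⟨rfl, rfl, rfl⟩ := hz
      refine ⟨d.reverse ++ a :: a' :: d ++ [c], d.reverse, by simp,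
        by simp [Ne.symm n3, Ne.symm n6, Ne.symm n8, n10], le_trans ?_
          (count_le_nbrCount hf.2.symm _)⟩
      simp only [List.count_append, List.count_cons, List.count_reverse]
      omega
    simp only [List.cons_append, List.cons.injEq] at hz
    obtain ⟨rfl, rfl, hz⟩ := hz
    have hd' : d = y.reverse ++ i :: z.reverse := by simpa using congrArg List.reverse hz
    have hi : i ∉ y := by
      intro h
      rw [hd', List.nodup_append] at n11
      exact n11.2.2 i (by simpa using h) i (by simp) rfl
    have hid : i ∈ d := by simp [hd']
    refine ⟨y ++ a :: a' :: y.reverse, z.reverse ++ c :: c' :: d.reverse, by simp [hd'], ?_, ?_⟩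
    · have := ne_of_mem_of_not_mem hid n4
      have := ne_of_mem_of_not_mem hid n7
      simp [*]
    · refine two_le_nbrCount_turn (fun hy => h1 i z.reverse (by simp [hd', hy])) ?_
      have hr : (d.reverse).IsChain G.Adj := by
        rw [List.isChain_reverse]
        exact hc.imp fun _ _ h => h.symm
      exact hr.infix ⟨z, [], by simp [hz]⟩
  · rcases z with _ | ⟨z0, z⟩
    · simp only [List.nil_append, List.append_nil] at hz hx
      simp only [List.cons.injEq] at hz
      obtain ⟨rfl, rfl⟩ := hz
      refine ⟨c' :: (d.reverse ++ a :: a' :: d), c' :: d.reverse, by simp,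
        by simp [n8, n9, Ne.symm n2, Ne.symm n5], le_trans ?_
          (count_le_nbrCount hf.1.symm _)⟩
      simp only [List.count_append, List.count_cons, List.count_reverse]
      omega
    simp only [List.cons_append, List.cons.injEq] at hz
    obtain ⟨rfl, rfl⟩ := hz
    have hi : i ∉ z := by
      intro h
      rw [hx, List.nodup_append] at n11
      exact (List.nodup_cons.1 n11.2.1).1 h
    have hid : i ∈ d := by simp [hx]
    refine ⟨z ++ c :: c' :: z.reverse, x.reverse ++ a :: a' :: (d ++ c :: c' :: d.reverse),
      by simp [hx], ?_, ?_⟩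
    · have := ne_of_mem_of_not_mem hid n9
      have := ne_of_mem_of_not_mem hid n10
      simp [*]
    · refine two_le_nbrCount_turn (fun hz => h2 i x (by simp [hx, hz])) ?_
      exact hc.infix ⟨x, [], by simp [hx]⟩

theorem recurrent_of_forall_fin {u : List V}
    (h : ∀ k : Fin u.length, 2 ≤ G.nbrCount (u.get k)
      ((u.drop (k + 1) ++ u).takeWhile fun l => l ≠ u.get k)) : G.Recurrent u := by
  rintro x i y rfl
  have h' := h ⟨x.length, by simp⟩
  simp only [List.get_eq_getElem, List.getElem_append_right, le_refl, Nat.sub_self,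
    List.getElem_cons_zero] at h'
  have e : (x ++ i :: y).drop (x.length + 1) = y := by
    rw [← List.singleton_append, ← List.append_assoc]
    exact List.drop_left' (by simp)
  rw [e] at h'
  obtain ⟨β, γ, hβγ, hβ⟩ := List.eq_append_cons_of_mem
    (show i ∈ y ++ (x ++ i :: y) by simp)
  have e2 : (β ++ i :: γ).takeWhile (fun l => l ≠ i) = β := by
    rw [List.takeWhile_append_of_pos]
    · simp
    · intro l hl
      simpa using ne_of_mem_of_not_mem hl hβ
  refine ⟨β, γ, hβγ, hβ, ?_⟩
  rwa [hβγ, e2] at h'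

/-- The graph on `Fin n` with a given list of edges. -/
def ofEdges {n : ℕ} (E : List (Fin n × Fin n)) : SimpleGraph (Fin n) :=
  SimpleGraph.fromRel fun i j => (i, j) ∈ E

instance {n : ℕ} (E : List (Fin n × Fin n)) : DecidableRel (ofEdges E).Adj :=
  fun i j => inferInstanceAs (Decidable (i ≠ j ∧ ((i, j) ∈ E ∨ (j, i) ∈ E)))

theorem recurrent_map_get_of_ofEdges {l : List V} (hl : l.Nodup)
    {E : List (Fin l.length × Fin l.length)} (hE : ∀ p ∈ E, G.Adj (l.get p.1) (l.get p.2))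
    {u : List (Fin l.length)} (h : (ofEdges E).Recurrent u) : G.Recurrent (u.map l.get) := by
  refine h.map (List.nodup_iff_injective_get.1 hl) fun i j hij => ?_
  rcases hij.2 with h' | h'
  · exact hE _ h'
  · exact (hE _ h').symm

theorem recurrent_ofEdges_two_two_two :
    (ofEdges (n := 7) [(0, 1), (1, 2), (0, 3), (3, 4), (0, 5), (5, 6)]).Recurrent
      [0, 1, 3, 4, 0, 3, 5, 6, 0, 5, 1, 2] :=
  recurrent_of_forall_fin (by decide)

theorem exists_recurrent_of_arms_two_two_two {b x₁ x₂ y₁ y₂ z₁ z₂ : V}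
    (hn : [b, x₁, x₂, y₁, y₂, z₁, z₂].Nodup) (h1 : G.Adj b x₁) (h2 : G.Adj x₁ x₂)
    (h3 : G.Adj b y₁) (h4 : G.Adj y₁ y₂) (h5 : G.Adj b z₁) (h6 : G.Adj z₁ z₂) :
    ∃ u, u ≠ [] ∧ G.Recurrent u := by
  refine ⟨_, ?_, recurrent_map_get_of_ofEdges hn
    (E := ([(0, 1), (1, 2), (0, 3), (3, 4), (0, 5), (5, 6)] : List (Fin 7 × Fin 7))) ?_
    recurrent_ofEdges_two_two_two⟩
  · simp
  · simp [h1, h2, h3, h4, h5, h6]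

theorem recurrent_ofEdges_one_three_three :
    (ofEdges (n := 8) [(0, 1), (0, 2), (2, 3), (3, 4), (0, 5), (5, 6), (6, 7)]).Recurrent
      [0, 1, 2, 4, 3, 0, 2, 5, 6, 0, 1, 5, 7, 6, 0, 2, 5, 3] :=
  recurrent_of_forall_fin (by decide)

theorem exists_recurrent_of_arms_one_three_three {b a x₁ x₂ x₃ y₁ y₂ y₃ : V}
    (hn : [b, a, x₁, x₂, x₃, y₁, y₂, y₃].Nodup) (h1 : G.Adj b a) (h2 : G.Adj b x₁)
    (h3 : G.Adj x₁ x₂) (h4 : G.Adj x₂ x₃) (h5 : G.Adj b y₁) (h6 : G.Adj y₁ y₂)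
    (h7 : G.Adj y₂ y₃) : ∃ u, u ≠ [] ∧ G.Recurrent u := by
  refine ⟨_, ?_, recurrent_map_get_of_ofEdges hn
    (E := ([(0, 1), (0, 2), (2, 3), (3, 4), (0, 5), (5, 6), (6, 7)] : List (Fin 8 × Fin 8))) ?_
    recurrent_ofEdges_one_three_three⟩
  · simp
  · simp [h1, h2, h3, h4, h5, h6, h7]

end SimpleGraph

namespace SimpleGraph

set_option linter.unusedSectionVars false

variable {V : Type*} {G : SimpleGraph V}

variable (G) in
/-- A path, given by the list of its vertices. -/
def IsPathList (p : List V) : Prop := p.Nodup ∧ p.IsChain G.Adj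

variable (G) in
/-- A path of maximal length. -/
def IsLongestPathList (p : List V) : Prop :=
  G.IsPathList p ∧ ∀ q, G.IsPathList q → q.length ≤ p.length

theorem IsPathList.reverse {p : List V} (h : G.IsPathList p) : G.IsPathList p.reverse :=
  ⟨List.nodup_reverse.2 h.1, List.isChain_reverse.2 (h.2.imp fun _ _ h => h.symm)⟩

theorem IsPathList.of_isInfix {p q : List V} (h : G.IsPathList p) (hq : q <:+: p) :
    G.IsPathList q := ⟨h.1.sublist hq.sublist, h.2.infix hq⟩

theorem IsPathList.cons {v a : V} {p : List V} (h : G.IsPathList (a :: p)) (hv : v ∉ a :: p)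
    (hva : G.Adj v a) : G.IsPathList (v :: a :: p) :=
  ⟨List.nodup_cons.2 ⟨hv, h.1⟩, List.isChain_cons_cons.2 ⟨hva, h.2⟩⟩

theorem IsLongestPathList.reverse {p : List V} (h : G.IsLongestPathList p) :
    G.IsLongestPathList p.reverse :=
  ⟨h.1.reverse, fun q hq => by rw [List.length_reverse]; exact h.2 q hq⟩

variable (G) in
theorem exists_isLongestPathList [Finite V] : ∃ p, G.IsLongestPathList p := by
  have := Fintype.ofFinite V
  by_contra hn
  simp only [IsLongestPathList, not_exists, not_and, not_forall, not_le] at hn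
  have key : ∀ n, ∃ p, G.IsPathList p ∧ n ≤ p.length := by
    intro n
    induction n with
    | zero => exact ⟨[], ⟨by simp, by simp⟩, by simp⟩
    | succ n ih =>
      obtain ⟨p, hp, hl⟩ := ih
      obtain ⟨q, hq, hlt⟩ := hn p hp
      exact ⟨q, hq, by omega⟩
  obtain ⟨p, hp, hl⟩ := key (Fintype.card V + 1)
  have := hp.1.length_le_card
  omega

theorem Connected.exists_adj_boundary (hG : G.Connected) {S : Set V} {a c : V} (ha : a ∈ S)
    (hc : c ∉ S) : ∃ v ∉ S, ∃ b ∈ S, G.Adj v b := by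
  obtain ⟨p⟩ := hG.preconnected a c
  obtain ⟨d, -, h1, h2⟩ := p.exists_boundary_dart S ha hc
  exact ⟨d.snd, h2, d.fst, h1, d.adj.symm⟩

section

variable [DecidableEq V] [DecidableRel G.Adj] (hrec : ∀ u, G.Recurrent u → u = [])

include hrec

theorem not_adj_of_isPathList {a b : V} {m : List V} (h : G.IsPathList (a :: (m ++ [b])))
    (hm : m ≠ []) : ¬G.Adj b a := by
  intro hab
  have hl := List.length_pos_iff.2 hm
  have := hrec _ (recurrent_of_cycle h.1 (by simp; omega) (List.isChain_append.2
    ⟨h.2, h.2, fun x hx y hy => by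
      simp only [List.head?_cons, Option.mem_def, Option.some.injEq] at hy
      rw [← List.cons_append, List.getLast?_append] at hx
      simp only [List.getLast?_singleton, Option.some_or, Option.mem_def, Option.some.injEq] at hx
      rw [← hx, ← hy]; exact hab⟩))
  simp at this

theorem false_of_two_forks {a a' c c' y z : V} {d : List V}
    (hn : (a :: a' :: c :: c' :: d).Nodup) (hc : d.IsChain G.Adj) (hy : d.head? = some y)
    (hz : d.getLast? = some z) (h1 : G.Adj y a) (h2 : G.Adj y a') (h3 : G.Adj z c)
    (h4 : G.Adj z c') : False := by
  have := hrec _ (recurrent_of_two_forks hn (by rintro rfl; simp at hy) hc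
    (fun y' t e => by
      rw [e] at hy
      simp only [List.head?_cons, Option.some.injEq] at hy
      rw [hy]; exact ⟨h1, h2⟩)
    (fun z' t e => by
      rw [e] at hz
      simp only [List.getLast?_append, List.getLast?_singleton, Option.some_or,
        Option.some.injEq] at hz
      rw [hz]; exact ⟨h3, h4⟩))
  simp at this

theorem getElem_adj_iff {p : List V} (h : G.IsPathList p) {i j : ℕ} (hij : i < j)
    (hj : j < p.length) : G.Adj p[i] p[j] ↔ j = i + 1 := by
  constructor
  · intro hadj
    by_contra hne
    have e1 : p.drop i = p[i] :: p.drop (i + 1) := List.drop_eq_getElem_cons (by omega)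
    have e2 : p.drop j = p[j] :: p.drop (j + 1) := List.drop_eq_getElem_cons hj
    have e3 : p.drop (i + 1) = (p.drop (i + 1)).take (j - (i + 1)) ++ p.drop j := by
      conv_lhs => rw [← List.take_append_drop (j - (i + 1)) (p.drop (i + 1))]
      rw [List.drop_drop]
      congr 2
      omega
    refine not_adj_of_isPathList hrec (h.of_isInfix ?_)
      (m := (p.drop (i + 1)).take (j - (i + 1))) ?_ hadj.symm
    · refine ⟨p.take i, p.drop (j + 1), ?_⟩
      conv_rhs => rw [← List.take_append_drop i p, e1, e3, e2]
      simp
    · rw [← List.length_pos_iff, List.length_take, List.length_drop]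
      omega
  · rintro rfl
    exact List.isChain_iff_getElem.1 h.2 i hj

theorem isTypeA_of_isPathList {p : List V} (h : G.IsPathList p) (hp : p ≠ [])
    (hall : ∀ v, v ∈ p) : G.IsTypeA := by
  have hbij : Function.Bijective p.get :=
    ⟨List.nodup_iff_injective_get.1 h.1, fun v => List.get_of_mem (hall v)⟩
  refine ⟨p.length, List.length_pos_iff.2 hp, ⟨(RelIso.symm
    ⟨Equiv.ofBijective _ hbij, fun {i j} => ?_⟩ : G ≃g pathGraph p.length)⟩⟩
  rw [pathGraph_adj, Equiv.ofBijective_apply, Equiv.ofBijective_apply, List.get_eq_getElem,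
    List.get_eq_getElem]
  rcases lt_trichotomy (i : ℕ) j with hij | hij | hij
  · rw [getElem_adj_iff hrec h hij j.2]; omega
  · simp only [hij, SimpleGraph.irrefl, false_iff]; omega
  · rw [G.adj_comm, getElem_adj_iff hrec h hij i.2]; omega

/-- A vertex off a path is joined to at most one vertex of the path. -/
theorem eq_of_adj_of_isPathList {p : List V} (h : G.IsPathList p) {v b s : V} (hv : v ∉ p)
    (hb : b ∈ p) (hs : s ∈ p) (hvb : G.Adj v b) (hvs : G.Adj v s) : s = b := by
  have key : ∀ {b s : V} (x m y : List V), p = x ++ b :: (m ++ s :: y) → G.Adj v b →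
      G.Adj v s → False := by
    intro b s x m y e hvb hvs
    have hi : b :: (m ++ [s]) <:+: p := ⟨x, y, by simp [e]⟩
    have := (h.of_isInfix hi).cons (fun h' => hv (hi.subset h')) hvb
    rw [← List.cons_append] at this
    exact not_adj_of_isPathList hrec this (by simp) hvs.symm
  by_contra hne
  obtain ⟨x, y, e⟩ := List.append_of_mem hb
  rw [e, List.mem_append, List.mem_cons] at hs
  rcases hs with hs | hs | hs
  · obtain ⟨x1, x2, rfl⟩ := List.append_of_mem hs
    exact key x1 x2 y (by simp [e]) hvs hvb
  · exact hne hs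
  · obtain ⟨y1, y2, rfl⟩ := List.append_of_mem hs
    exact key x y1 y2 e hvb hvs

theorem nonempty_iso_pathWithLeaf {x y : List V} {b v : V} (h : G.IsPathList (x ++ b :: y))
    (hv : v ∉ x ++ b :: y) (hvb : G.Adj v b) (hall : ∀ w, w ∈ v :: (x ++ b :: y)) :
    Nonempty (G ≃g pathWithLeaf (x.length + y.length + 2) x.length) := by
  set p := x ++ b :: y with hp
  have hlen : p.length = x.length + y.length + 1 := by simp [hp]; omega
  obtain ⟨n, hn⟩ : ∃ n, n = x.length + y.length + 2 := ⟨_, rfl⟩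
  have hqn : (p ++ [v]).length = n := by simp [hlen, hn]
  rw [← hn, ← hqn]
  have hbij : Function.Bijective (p ++ [v]).get := by
    refine ⟨List.nodup_iff_injective_get.1 ?_, fun w => List.get_of_mem ?_⟩
    · rw [List.nodup_append]
      exact ⟨h.1, by simp, fun a ha c hc => by
        rw [List.mem_singleton.1 hc]; exact ne_of_mem_of_not_mem ha hv⟩
    · have := hall w
      simp only [List.mem_cons, List.mem_append] at this ⊢
      tauto
  have key : ∀ i j : Fin (p ++ [v]).length, (i : ℕ) < j →
      (G.Adj ((p ++ [v]).get i) ((p ++ [v]).get j) ↔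
        ((i : ℕ) + 1 = j ∧ (j : ℕ) + 1 < (p ++ [v]).length) ∨
          ((i : ℕ) = x.length ∧ (j : ℕ) + 1 = (p ++ [v]).length)) := by
    intro i j hij
    have hj := j.2
    have hlq : (p ++ [v]).length = p.length + 1 := by simp
    have hi : (i : ℕ) < p.length := by omega
    rw [List.get_eq_getElem, List.get_eq_getElem, List.getElem_append_left hi]
    by_cases hjp : (j : ℕ) < p.length
    · rw [List.getElem_append_left hjp, getElem_adj_iff hrec h hij hjp]
      omega
    · have hbx : p[x.length]'(by omega) = b := by simp [hp]
      have hjv : (p ++ [v])[(j : ℕ)] = v := by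
        rw [List.getElem_append_right (by omega)]
        simp
      rw [hjv]
      constructor
      · intro hadj
        have := eq_of_adj_of_isPathList hrec h hv (by simp [hp]) (List.getElem_mem hi) hvb hadj.symm
        rw [← hbx] at this
        exact .inr ⟨(h.1.getElem_inj_iff).1 this, by omega⟩
      · rintro (⟨-, h1⟩ | ⟨h1, -⟩)
        · omega
        · simp only [h1, hbx]; exact hvb.symm
  refine ⟨RelIso.symm ⟨Equiv.ofBijective _ hbij, fun {i j} => ?_⟩⟩
  rw [Equiv.ofBijective_apply, Equiv.ofBijective_apply, pathWithLeaf, fromRel_adj]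
  have hx : x.length + 1 < (p ++ [v]).length := by rw [hqn, hn]; omega
  have hi := i.2
  have hj := j.2
  rcases lt_trichotomy (i : ℕ) j with hij | hij | hij
  · rw [key i j hij, ne_eq, Fin.ext_iff]; omega
  · rw [Fin.ext hij]
    simp
  · rw [G.adj_comm, key j i hij, ne_eq, Fin.ext_iff]; omega

theorem isType_of_isLongestPathList_of_le (hG : G.Connected) {x y : List V} {b v : V}
    (h : G.IsLongestPathList (x ++ b :: y)) (hv : v ∉ x ++ b :: y) (hvb : G.Adj v b)
    (hxy : x.length ≤ y.length) : G.IsTypeD ∨ G.IsTypeE := by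
  obtain ⟨hp, hmax⟩ := h
  have hlen : (x ++ b :: y).length = x.length + y.length + 1 := by simp; omega
  have hend : ∀ {w : V} {s : List V}, w ∉ x ++ b :: y → x ++ b :: y = s →
      (∀ a t, s = a :: t → ¬G.Adj w a) := by
    rintro w s hw rfl a t e hwa
    have := hmax _ ((e ▸ hp).cons (e ▸ hw) hwa)
    rw [e] at this
    simp at this
  have hend' : ∀ {w a : V} {t : List V}, w ∉ x ++ b :: y → x ++ b :: y = t ++ [a] →
      ¬G.Adj w a := by
    intro w a t hw e hwa
    have e' : (x ++ b :: y).reverse = a :: t.reverse := by simp [e]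
    have := hmax _ ((e' ▸ hp.reverse).cons (by rw [← e', List.mem_reverse]; exact hw) hwa)
    rw [← List.length_reverse (as := x ++ b :: y), e'] at this
    simp at this
  have hN := hp.1
  have hC := hp.2
  obtain ⟨x', a₁, rfl⟩ : ∃ x' a₁, x = x' ++ [a₁] := by
    rcases List.eq_nil_or_concat' x with rfl | ⟨x', a, rfl⟩
    · exact absurd hvb (hend hv rfl b y rfl)
    · exact ⟨x', a, rfl⟩
  obtain ⟨c₁, y', rfl⟩ : ∃ c₁ y', y = c₁ :: y' := by
    rcases y with _ | ⟨c, y'⟩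
    · exact absurd hvb (hend' hv rfl)
    · exact ⟨c, y', rfl⟩
  have hba : G.Adj b a₁ := by
    have := hC.infix (l₁ := [a₁, b]) ⟨x', c₁ :: y', by simp⟩
    simpa [G.adj_comm] using this
  have hbc : G.Adj b c₁ := by
    have := hC.infix (l₁ := [b, c₁]) ⟨x' ++ [a₁], y', by simp⟩
    simpa using this
  have hall : ∀ w, w ∈ v :: (x' ++ [a₁] ++ b :: c₁ :: y') := by
    by_contra hne
    push Not at hne
    obtain ⟨w, hw⟩ := hne
    obtain ⟨v', hv', u, hu, hadj⟩ := hG.exists_adj_boundary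
      (S := {w | w ∈ v :: (x' ++ [a₁] ++ b :: c₁ :: y')}) (a := v) (c := w) (by simp) hw
    simp only [Set.mem_ofPred_eq, List.mem_cons, not_or] at hv'
    obtain ⟨hvv', hv'⟩ := hv'
    simp only [Set.mem_ofPred_eq] at hu
    rw [List.mem_cons, List.mem_append, List.mem_cons] at hu
    rcases hu with rfl | hu | rfl | hu
    · have hq : G.IsPathList (v' :: u :: b :: c₁ :: y') := by
        have h1 : G.IsPathList (b :: c₁ :: y') := hp.of_isInfix (List.suffix_append _ _).isInfix
        have h2 := h1.cons (fun h' => hv (List.mem_append_right _ h')) hvb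
        refine h2.cons ?_ hadj
        rw [List.mem_cons, not_or]
        exact ⟨hvv', fun h' => hv' (List.mem_append_right _ h')⟩
      have hl := hmax _ hq
      simp only [List.length_append, List.length_cons, List.length_nil] at hl hxy
      obtain ⟨x'', a₂, rfl⟩ : ∃ x'' a₂, x' = x'' ++ [a₂] := by
        rcases List.eq_nil_or_concat' x' with rfl | ⟨x'', a, rfl⟩
        · simp only [List.length_nil] at hl; omega
        · exact ⟨x'', a, rfl⟩
      obtain ⟨c₂, y'', rfl⟩ : ∃ c₂ y'', y' = c₂ :: y'' := by
        rcases y' with _ | ⟨c, y''⟩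
        · simp only [List.length_nil] at hl hxy; omega
        · exact ⟨c, y'', rfl⟩
      have haa : G.Adj a₁ a₂ := by
        have := hC.infix (l₁ := [a₂, a₁]) ⟨x'', b :: c₁ :: c₂ :: y'', by simp⟩
        simpa [G.adj_comm] using this
      have hcc : G.Adj c₁ c₂ := by
        have := hC.infix (l₁ := [c₁, c₂]) ⟨x'' ++ [a₂, a₁, b], y'', by simp⟩
        simpa using this
      have hN' : [a₂, a₁, b, c₁, c₂].Nodup :=
        hN.sublist (List.IsInfix.sublist ⟨x'', y'', by simp⟩)
      obtain ⟨u', hu', hr⟩ := exists_recurrent_of_arms_two_two_two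
        (b := b) (x₁ := u) (x₂ := v') (y₁ := a₁) (y₂ := a₂) (z₁ := c₁) (z₂ := c₂) (by
          simp only [List.mem_append, List.mem_cons, List.nodup_cons, not_or,
            List.not_mem_nil, not_false_eq_true] at hN' hv hv' ⊢
          grind) hvb.symm hadj.symm hba haa hbc hcc
      exact hu' (hrec _ hr)
    · obtain ⟨x₁, x₂, e⟩ := List.append_of_mem hu
      obtain ⟨x₃, a, rfl⟩ : ∃ x₃ a, x₁ = x₃ ++ [a] := by
        rcases List.eq_nil_or_concat' x₁ with rfl | ⟨x₃, a, rfl⟩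
        · exact absurd hadj (hend (s := u :: (x₂ ++ b :: c₁ :: y')) hv' (by rw [e]; simp) u _ rfl)
        · exact ⟨x₃, a, rfl⟩
      rw [e] at hN hC hv hv'
      have hua : G.Adj u a := by
        have := hC.infix (l₁ := [a, u]) ⟨x₃, x₂ ++ b :: c₁ :: y', by simp⟩
        simpa [G.adj_comm] using this
      have hN' : (a :: u :: (x₂ ++ [b, c₁])).Nodup :=
        hN.sublist (List.IsInfix.sublist ⟨x₃, y', by simp⟩)
      have hC' : (u :: (x₂ ++ [b])).IsChain G.Adj :=
        hC.infix ⟨x₃ ++ [a], c₁ :: y', by simp⟩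
      refine false_of_two_forks hrec (a := a) (a' := v') (c := v) (c' := c₁) ?_ hC' rfl
        (by rw [← List.cons_append, List.getLast?_append]; simp) hua hadj.symm hvb.symm hbc
      simp only [List.mem_append, List.mem_cons, List.nodup_cons, List.nodup_append, not_or,
        List.not_mem_nil, not_false_eq_true] at hN' hv hv' ⊢
      grind
    · refine false_of_two_forks hrec (a := a₁) (a' := c₁) (c := v) (c' := v') (d := [u]) ?_
        (by simp) rfl rfl hba hbc hvb.symm hadj.symm
      have hN' : [a₁, u, c₁].Nodup := hN.sublist (List.IsInfix.sublist ⟨x', y', by simp⟩)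
      simp only [List.mem_append, List.mem_cons, List.nodup_cons, not_or,
        List.not_mem_nil, not_false_eq_true] at hN' hv hv' ⊢
      grind
    · obtain ⟨y₁, y₂, e⟩ := List.append_of_mem hu
      rcases y₂ with _ | ⟨c, y₃⟩
      · exact hend' (t := x' ++ [a₁] ++ b :: y₁) hv' (by rw [e]; simp) hadj
      rw [e] at hN hC hv hv'
      have huc : G.Adj u c := by
        have := hC.infix (l₁ := [u, c]) ⟨x' ++ [a₁] ++ b :: y₁, y₃, by simp⟩
        simpa using this
      have hN' : (a₁ :: b :: (y₁ ++ [u, c])).Nodup :=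
        hN.sublist (List.IsInfix.sublist ⟨x', y₃, by simp⟩)
      have hC' : (b :: (y₁ ++ [u])).IsChain G.Adj :=
        hC.infix ⟨x' ++ [a₁], c :: y₃, by simp⟩
      refine false_of_two_forks hrec (a := a₁) (a' := v) (c := v') (c' := c) ?_ hC' rfl
        (by rw [← List.cons_append, List.getLast?_append]; simp) hba hvb.symm hadj.symm huc
      simp only [List.mem_append, List.mem_cons, List.nodup_cons, List.nodup_append, not_or,
        List.not_mem_nil, not_false_eq_true] at hN' hv hv' ⊢
      grind
  have hiso := nonempty_iso_pathWithLeaf hrec hp hv hvb hall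
  simp only [List.length_append, List.length_cons, List.length_nil] at hiso hxy
  rcases List.eq_nil_or_concat' x' with rfl | ⟨x'', a₂, rfl⟩
  · exact .inl ⟨_, by simp; omega, hiso⟩
  rcases List.eq_nil_or_concat' x'' with rfl | ⟨x''', a₃, rfl⟩
  · refine .inr ⟨_, ?_, hiso⟩
    simp at hxy ⊢
    omega
  exfalso
  obtain ⟨c₂, y'', rfl⟩ : ∃ c₂ y'', y' = c₂ :: y'' := by
    rcases y' with _ | ⟨c, y''⟩
    · simp at hxy
    · exact ⟨c, y'', rfl⟩
  obtain ⟨c₃, y''', rfl⟩ : ∃ c₃ y''', y'' = c₃ :: y''' := by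
    rcases y'' with _ | ⟨c, y'''⟩
    · simp at hxy
    · exact ⟨c, y''', rfl⟩
  have hi : [a₃, a₂, a₁, b, c₁, c₂, c₃] <:+:
      x''' ++ [a₃] ++ [a₂] ++ [a₁] ++ b :: c₁ :: c₂ :: c₃ :: y''' := ⟨x''', y''', by simp⟩
  have hN' := hN.sublist hi.sublist
  have hC' := hC.infix hi
  simp only [List.isChain_cons_cons] at hC'
  obtain ⟨k1, k2, k3, k4, k5, k6, -⟩ := hC'
  obtain ⟨u', hu', hr⟩ := exists_recurrent_of_arms_one_three_three
    (b := b) (a := v) (x₁ := a₁) (x₂ := a₂) (x₃ := a₃) (y₁ := c₁) (y₂ := c₂) (y₃ := c₃) (by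
      simp only [List.mem_append, List.mem_cons, List.nodup_cons, not_or,
        List.not_mem_nil, not_false_eq_true] at hN' hv ⊢
      grind) hvb.symm k3.symm k2.symm k1.symm k4 k5 k6
  exact hu' (hrec _ hr)

/-- A finite connected graph without nontrivial recurrent words is of type `A`, `D` or `E`. -/
theorem isType_of_forall_recurrent [Finite V] (hG : G.Connected) :
    G.IsTypeA ∨ G.IsTypeD ∨ G.IsTypeE := by
  obtain ⟨p, hp⟩ := G.exists_isLongestPathList
  have hp0 : p ≠ [] := by
    obtain ⟨v⟩ := hG.nonempty
    have := hp.2 [v] ⟨by simp, by simp⟩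
    rintro rfl
    simp at this
  by_cases hall : ∀ v, v ∈ p
  · exact .inl (isTypeA_of_isPathList hrec hp.1 hp0 hall)
  right
  push Not at hall
  obtain ⟨w, hw⟩ := hall
  obtain ⟨a, ha⟩ := List.exists_mem_of_ne_nil p hp0
  obtain ⟨v, hv, b, hb, hvb⟩ := hG.exists_adj_boundary (S := {v | v ∈ p}) ha hw
  obtain ⟨x, y, rfl⟩ := List.append_of_mem hb
  rcases le_total x.length y.length with h | h
  · exact isType_of_isLongestPathList_of_le hrec hG hp hv hvb h
  · refine isType_of_isLongestPathList_of_le hrec hG (x := y.reverse) (y := x.reverse) (b := b)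
      ?_ ?_ hvb (by simpa using h)
    · simpa using hp.reverse
    · simpa [or_comm, or_assoc, or_left_comm] using hv

end

end SimpleGraph

namespace SimpleGraph

variable {V : Type*} {G : SimpleGraph V}

theorem IsTypeA.exists_embedding_infiniteE (h : G.IsTypeA) :
    ∃ (f : V → ℕ) (m : ℕ), Function.Injective f ∧
      (∀ x y, G.Adj x y ↔ infiniteE.Adj (f x) (f y)) ∧ ∀ x, f x ≤ m := by
  obtain ⟨n, -, ⟨e⟩⟩ := h
  refine ⟨fun x => e x + 1, n, fun x y hxy => e.injective (Fin.ext (by simpa using hxy)),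
    fun x y => ?_, fun x => (e x).2⟩
  rw [← e.map_adj_iff, pathGraph_adj, infiniteE_adj]
  dsimp only
  omega

theorem exists_embedding_infiniteE_of_iso {n k : ℕ} (hk : k ≤ 2) (hn : k + 2 ≤ n)
    (e : G ≃g pathWithLeaf n k) :
    ∃ (f : V → ℕ) (m : ℕ), Function.Injective f ∧
      (∀ x y, G.Adj x y ↔ infiniteE.Adj (f x) (f y)) ∧ ∀ x, f x ≤ m := by
  refine ⟨fun x => if (e x : ℕ) + 1 = n then 0 else e x + (3 - k), n + 3, fun x y hxy => ?_,
    fun x y => ?_, fun x => ?_⟩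
  · have h1 := (e x).2
    have h2 := (e y).2
    refine e.injective (Fin.ext ?_)
    dsimp only at hxy
    split_ifs at hxy <;> omega
  · have h1 := (e x).2
    have h2 := (e y).2
    have h3 := fromRel_adj (fun i j : Fin n =>
      ((i : ℕ) + 1 = j ∧ (j : ℕ) + 1 < n) ∨ ((i : ℕ) = k ∧ (j : ℕ) + 1 = n)) (e x) (e y)
    rw [← e.map_adj_iff, infiniteE_adj]
    refine h3.trans ?_
    rw [ne_eq, Fin.ext_iff]
    beta_reduce
    have key : ∀ i : ℕ, ∃ t, (if i + 1 = n then 0 else i + (3 - k)) = t ∧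
        (i + 1 = n ∧ t = 0 ∨ i + 1 ≠ n ∧ t + k = i + 3) := by
      intro i
      refine ⟨_, rfl, ?_⟩
      split_ifs <;> omega
    obtain ⟨s, hs, hs'⟩ := key (e x)
    obtain ⟨t, ht, ht'⟩ := key (e y)
    rw [hs, ht]
    clear h3 key
    omega
  · have h1 := (e x).2
    dsimp only
    split_ifs <;> omega

theorem exists_embedding_infiniteE (h : G.IsTypeA ∨ G.IsTypeD ∨ G.IsTypeE) :
    ∃ (f : V → ℕ) (m : ℕ), Function.Injective f ∧
      (∀ x y, G.Adj x y ↔ infiniteE.Adj (f x) (f y)) ∧ ∀ x, f x ≤ m := by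
  rcases h with h | ⟨n, hn, ⟨e⟩⟩ | ⟨n, hn, ⟨e⟩⟩
  · exact h.exists_embedding_infiniteE
  · exact exists_embedding_infiniteE_of_iso (by omega) (by omega) e
  · exact exists_embedding_infiniteE_of_iso (by omega) (by omega) e

variable [DecidableEq V] [DecidableRel G.Adj]

theorem exists_length_le_of_braidFree [Finite V] (hG : ∀ C : G.ConnectedComponent,
    C.toSimpleGraph.IsTypeA ∨ C.toSimpleGraph.IsTypeD ∨ C.toSimpleGraph.IsTypeE) :
    ∃ N, ∀ ω, G.BraidFree ω → ω.length ≤ N := by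
  have := Fintype.ofFinite V
  have key : ∀ i, ∃ N, ∀ ω, G.BraidFree ω → ω.count i ≤ N := by
    intro i
    obtain ⟨f, m, hf, hadj, hm⟩ := exists_embedding_infiniteE (hG (G.connectedComponentMk i))
    refine ⟨_, fun ω hω => count_le_of_embedding (S := (G.connectedComponentMk i).supp) (f := f)
      (fun x hx y hxy => ConnectedComponent.mem_supp_of_adj_mem_supp _ hx hxy) hf
      (fun x y => hadj x y) hm hω ⟨i, rfl⟩⟩
  choose N hN using key
  refine ⟨∑ i, N i, fun ω hω => ?_⟩
  rw [← List.sum_toFinset_count_eq_length]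
  exact (Finset.sum_le_sum fun i _ => hN i ω hω).trans
    (Finset.sum_le_sum_of_subset (Finset.subset_univ _))

theorem isType_of_length_le [Finite V] {N : ℕ} (hN : ∀ ω, G.BraidFree ω → ω.length ≤ N)
    (C : G.ConnectedComponent) :
    C.toSimpleGraph.IsTypeA ∨ C.toSimpleGraph.IsTypeD ∨ C.toSimpleGraph.IsTypeE := by
  classical
  have : Finite C := inferInstanceAs (Finite C.supp)
  refine isType_of_forall_recurrent (fun u hu => ?_) C.connected_toSimpleGraph
  have h : G.Recurrent (u.map Subtype.val) :=
    hu.map Subtype.val_injective fun i j hij => hij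
  exact List.map_eq_nil_iff.1 (h.eq_nil hN)

theorem braidFree_singleton (i : V) : G.BraidFree [i] :=
  braidFree_of_two_le fun α j β γ h => by
    have := congrArg List.length h
    simp at this
    omega

theorem braidFree_pair {i j : V} (hij : i ≠ j) : G.BraidFree [i, j] :=
  braidFree_of_two_le fun α k β γ h => by
    have hl := congrArg List.length h
    simp only [List.length_cons, List.length_nil, List.length_append] at hl
    obtain rfl : α = [] := List.length_eq_zero_iff.1 (by omega)
    obtain rfl : β = [] := List.length_eq_zero_iff.1 (by omega)
    simp only [List.nil_append, List.cons.injEq] at h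
    exact absurd (h.1.trans h.2.1.symm) hij

end SimpleGraph

namespace CoxeterSystem

variable {B : Type*} {M : CoxeterMatrix B} {W : Type*} [Group W] {cs : CoxeterSystem M W}

theorem simple_injective (hM : M.SimplyLaced) : Function.Injective cs.simple := by
  classical
  intro i j h
  by_contra hij
  have := isReduced_of_braidFree (cs := cs) hM (SimpleGraph.braidFree_pair hij)
  rw [IsReduced, wordProd_cons, wordProd_singleton, h, simple_mul_simple_self, length_one] at this
  simp at this

theorem finite_of_finite_isFullyCommutative (hM : M.SimplyLaced)
    (h : {w : W | cs.IsFullyCommutative w}.Finite) : Finite B := by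
  classical
  have := h.to_subtype
  refine Finite.of_injective
    (fun i => (⟨cs.simple i, ?_⟩ : {w : W | cs.IsFullyCommutative w})) fun i j hij =>
      simple_injective hM (congrArg Subtype.val hij)
  have := isFullyCommutative_of_braidFree (cs := cs) hM (SimpleGraph.braidFree_singleton i)
  rwa [wordProd_singleton] at this

theorem exists_length_le_of_finite_isFullyCommutative [DecidableEq B]
    [DecidableRel M.coxeterGraph.Adj] (hM : M.SimplyLaced)
    (h : {w : W | cs.IsFullyCommutative w}.Finite) :
    ∃ N, ∀ ω, M.coxeterGraph.BraidFree ω → ω.length ≤ N := by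
  obtain ⟨N, hN⟩ := (h.image cs.length).bddAbove
  refine ⟨N, fun ω hω => ?_⟩
  have hr : cs.IsReduced ω := isReduced_of_braidFree hM hω
  rw [← hr]
  exact hN ⟨_, isFullyCommutative_of_braidFree hM hω, rfl⟩

theorem finite_isFreelyBraided_of_length_le [Finite B] [DecidableEq B]
    [DecidableRel M.coxeterGraph.Adj] (hM : M.SimplyLaced) {N : ℕ}
    (hN : ∀ ω, M.coxeterGraph.BraidFree ω → ω.length ≤ N) :
    {w : W | cs.IsFreelyBraided w}.Finite := by
  refine ((List.finite_length_le B (2 * N)).image cs.wordProd).subset fun w hw => ?_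
  obtain ⟨ω, hl, rfl⟩ := cs.exists_isReduced w
  have ho := IsFreelyBraided.overlapFree hM hw ⟨hl, rfl⟩
  have h1 := ho.length_le
  have h2 := hN _ (ho.braidFree_prune hM)
  exact ⟨ω, show ω.length ≤ 2 * N by omega, rfl⟩

end CoxeterSystem

/-- For a simply laced Coxeter group `W`, the set of freely braided elements is finite if and only
if the set of fully commutative elements is finite; and this is the case if and only if `W` has
finitely many generators and each connected component of its Coxeter graph is of type `A n`, `D n`
or `E n`, with `n` arbitrary. -/
theorem theorem3p3p3 {B : Type*} {M : CoxeterMatrix B} {W : Type*} [Group W]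
    (cs : CoxeterSystem M W) (hM : M.SimplyLaced) :
    ({w : W | cs.IsFreelyBraided w}.Finite ↔ {w : W | cs.IsFullyCommutative w}.Finite) ∧
    ({w : W | cs.IsFreelyBraided w}.Finite ↔
      Finite B ∧ ∀ C : M.coxeterGraph.ConnectedComponent,
        C.toSimpleGraph.IsTypeA ∨ C.toSimpleGraph.IsTypeD ∨ C.toSimpleGraph.IsTypeE) := by
  classical
  have h1 : {w : W | cs.IsFreelyBraided w}.Finite → {w : W | cs.IsFullyCommutative w}.Finite :=
    fun h => h.subset fun w hw => hw.isFreelyBraided hM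
  have h2 : {w : W | cs.IsFullyCommutative w}.Finite → Finite B ∧
      ∀ C : M.coxeterGraph.ConnectedComponent,
        C.toSimpleGraph.IsTypeA ∨ C.toSimpleGraph.IsTypeD ∨ C.toSimpleGraph.IsTypeE := by
    intro h
    have hB := CoxeterSystem.finite_of_finite_isFullyCommutative hM h
    obtain ⟨N, hN⟩ := CoxeterSystem.exists_length_le_of_finite_isFullyCommutative hM h
    exact ⟨hB, SimpleGraph.isType_of_length_le hN⟩
  have h3 : (Finite B ∧ ∀ C : M.coxeterGraph.ConnectedComponent,
      C.toSimpleGraph.IsTypeA ∨ C.toSimpleGraph.IsTypeD ∨ C.toSimpleGraph.IsTypeE) →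
      {w : W | cs.IsFreelyBraided w}.Finite := by
    rintro ⟨hB, hC⟩
    obtain ⟨N, hN⟩ := SimpleGraph.exists_length_le_of_braidFree hC
    exact CoxeterSystem.finite_isFreelyBraided_of_length_le hM hN
  exact ⟨⟨h1, fun h => h3 (h2 h)⟩, fun h => h2 (h1 h), h3⟩
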